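/- Let $\mathcal H=\mathbb C^2\otimes\mathbb C^2\otimes\mathbb C^2\otimes\mathbb C^2$ with systems $A,B,C,D$, and regard it as $\mathbb C^4\otimes\mathbb C^4$ by the cut $AB:CD$. A *4-qubit $4\times4$ UPB of size eight* is a family of eight orthonormal vectors $|a_i,b_i,c_i,d_i\rangle\in\mathcal H$ $(i=1,\dots,8)$ that are 4-qubit product vectors and such that no nonzero product vector $|p\rangle\otimes|q\rangle$ with $p,q\in\mathbb C^4$ (cut $AB:CD$) is orthogonal to all of them. Two such families are *equivalent* if, up to the order of the vectors and a phase of each vector, one is obtained from the other by a local unitary $U_1\otimes U_2\otimes U_3\otimes U_4$ ($U_k\in U(2)$) and a permutation of the systems that respects the cut (generated by $A\leftrightarrow B$, $C\leftrightarrow D$, and $AB\leftrightarrow CD$). For a unit vector $x=(x_0,x_1)\in\mathbb C^2$ let $x'=(-\bar x_1,\bar x_0)$ be the orthogonal state; write $0,1$ for $|0\rangle,|1\rangle$; $x\neq y$ between unit vectors means that they do not differ only by a phase, and $x=y$ that they do. Consider the $8\times4$ matrices, whose rows stand for product vectors and whose entries $f_k,g_k,h_k,i_k$ are unit vectors of $\mathbb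 C^2$: $$F_1=\begin{bmatrix}0&0&0&0\\0&1&0&1\\1&g_3&h_3&i_3\\1&g_3'&h_3&i_4\\f_5&g_3'&1&i_4'\\f_5&g_3&1&i_3'\\f_5'&0&h_3'&1\\f_5'&1&h_3'&0\end{bmatrix},\quad F_2=\begin{bmatrix}0&0&0&0\\0&1&0&i_2\\1&g_3&h_3&i_3\\1&g_3'&h_3&i_4\\f_5&g_3'&1&i_4'\\f_5&g_3&1&i_3'\\f_5'&1&h_3'&i_2'\\f_5'&0&h_3'&1\end{bmatrix},\quad F_3=\begin{bmatrix}0&0&0&0\\0&1&0&i_2\\1&g_3&h_3&0\\1&g_3'&h_4&i_2\\f_5&g_3'&1&i_2'\\f_5&g_3&1&1\\f_5'&1&h_3'&i_2'\\f_5'&0&h_4'&1\end{bmatrix},$$ $$F_4=\begin{bmatrix}0&0&0&0\\0&1&0&i_2\\1&g_3&h_3&i_3\\1&g_4&h_3&i_3'\\f_5&g_3'&1&i_3\\f_5&g_4'&1&i_3'\\f_5'&1&h_3'&i_2'\\f_5'&0&h_3'&1\end{bmatrix},\quad F_5=\begin{bmatrix}0&0&0&0\\0&1&0&i_2\\1&g_3&h_3&1\\1&g_3'&h_3&i_2'\\f_5&g_3&1&0\\f_6&g_3'&1&i_2\\f_5'&1&h_3'&i_2'\\f_6'&0&h_3'&1\end{bmatrix},\quad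 F_6=\begin{bmatrix}0&0&0&0\\0&1&h_2&i_2\\1&g_3&0&i_3\\1&g_3'&h_2&i_4\\f_5&1&h_2'&i_3'\\f_5&0&1&i_4'\\f_5'&g_3&1&i_2'\\f_5'&g_3'&h_2'&1\end{bmatrix}.$$ In all of them every parameter $f_k,g_k,h_k$ is $\neq0,1$. The further conditions are: - $F_1$: $i_3,i_4\ne0,1$ and $i_3\neq i_4$. - $F_2$: $i_2\neq0,1$ and $i_3\ne i_4,i_4'$. - $F_3$: $i_2\neq0,1$ and $h_3\neq h_4$. - $F_4$: $i_2,i_3\neq0,1$, $g_3\ne g_4,g_4'$, $i_2\neq i_3,i_3'$, and the parameters are not exceptional. Here, with $\zeta(x)=x_1/x_0$, $s=1+|\zeta(f_5)|^{-2}$ and $r=|\zeta(h_3)|^2$, they are *exceptional* if $\zeta(g_3)\overline{\zeta(g_4)}\in\{-s,-s^{-1}\}$ and $\zeta(i_2)\in\{(1+r)\zeta(i_3)+r/\overline{\zeta(i_3)},\ -(r\,\zeta(i_3)+(1+r)/\overline{\zeta(i_3)})\}$. - $F_5$: $i_2\neq0,1$ and $f_5\neq f_6$. - $F_6$: $i_2\neq0,i_3',i_4$;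 $i_3\neq0,i_4$; $i_4\neq1$; if $i_2=i_3$ then $i_2\neq1$ and $i_2\ne i_4'$; and $i_4=0$ is allowed only if $i_2=i_3$. Then: 1. Each of the six families is nonempty, and for all admissible parameters the rows of $F_j$ $(1\le j\le 6)$ form a 4-qubit $4\times4$ UPB of size eight. 2. The six families are pairwise inequivalent: for $j\neq k$, no member of the family $F_j$ is equivalent to a member of the family $F_k$. 3. Every 4-qubit $4\times4$ UPB of size eight is equivalent to a member of one of the six families. 4. The exclusion in $F_4$ is necessary: if the parameters satisfy the inequalities listed for $F_4$ but are exceptional, then the rows of $F_4$ do not form a UPB in $\mathbb C^4\otimes\mathbb C^4$. -/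

import Mathlib

/-- The state space `ℂ²` of one qubit. -/
abbrev Qubit := EuclideanSpace ℂ (Fin 2)

/-- The four-qubit space `ℂ² ⊗ ℂ² ⊗ ℂ² ⊗ ℂ²`, in coordinates with respect to the
computational basis. Systems `A, B, C, D` are numbered `0, 1, 2, 3`. -/
abbrev FourQubit := EuclideanSpace ℂ (Fin 4 → Fin 2)

/-- The space `ℂ⁴ = ℂ² ⊗ ℂ²` of a pair of qubits. -/
abbrev TwoQubit := EuclideanSpace ℂ (Fin 2 × Fin 2)

/-- The four-qubit product vector `ψ₀ ⊗ ψ₁ ⊗ ψ₂ ⊗ ψ₃`. -/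
noncomputable def tensorFour (ψ : Fin 4 → Qubit) : FourQubit :=
  WithLp.toLp 2 fun x => ∏ k, ψ k (x k)

/-- The vector `p ⊗ q` in `ℂ⁴ ⊗ ℂ⁴`, with `p` in the space of `AB` and `q` in that of `CD`. -/
noncomputable def tensorCut (p q : TwoQubit) : FourQubit :=
  WithLp.toLp 2 fun x => p (x 0, x 1) * q (x 2, x 3)

/-- `T` is a list of eight orthonormal four-qubit product vectors that form an unextendible
product basis of `ℂ⁴ ⊗ ℂ⁴` (cut `AB : CD`): no nonzero `p ⊗ q` is orthogonal to all of them. -/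
def IsUPB44 (T : Fin 8 → FourQubit) : Prop :=
  Orthonormal ℂ T ∧
  (∀ i, ∃ ψ : Fin 4 → Qubit, T i = tensorFour ψ) ∧
  ¬ ∃ p q : TwoQubit, p ≠ 0 ∧ q ≠ 0 ∧ ∀ i, inner ℂ (T i) (tensorCut p q) = 0

/-- The permutation of the four tensor factors given by `σ`. -/
noncomputable def permuteSystems (σ : Equiv.Perm (Fin 4)) (v : FourQubit) : FourQubit :=
  WithLp.toLp 2 fun x => v (x ∘ σ)

/-- The side of the cut `AB : CD` on which a system lies. -/
def side : Fin 4 → Fin 2 := ![0, 0, 1, 1]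

/-- The permutations of systems that respect the cut `AB : CD`: those generated by the exchange of
`A` and `B`, the exchange of `C` and `D`, and the exchange of the pair `AB` with the pair `CD`. -/
def RespectsCut (σ : Equiv.Perm (Fin 4)) : Prop :=
  ∀ k l, side (σ k) = side (σ l) ↔ side k = side l

/-- The operator `U₀ ⊗ U₁ ⊗ U₂ ⊗ U₃` on the four-qubit space. -/
noncomputable def localUnitary (U : Fin 4 → Matrix.unitaryGroup (Fin 2) ℂ) (v : FourQubit) :
    FourQubit :=
  WithLp.toLp 2 fun x =>
    ∑ y : Fin 4 → Fin 2, (∏ k, (U k : Matrix (Fin 2) (Fin 2) ℂ) (x k) (y k)) * v y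

/-- Equivalence of lists of eight four-qubit vectors: up to the order of the vectors and a global
phase of each of them, the second arises from the first by a permutation of systems respecting the
cut `AB : CD`, followed by a local unitary. -/
def Equivalent (T T' : Fin 8 → FourQubit) : Prop :=
  ∃ (σ : Equiv.Perm (Fin 4)) (U : Fin 4 → Matrix.unitaryGroup (Fin 2) ℂ)
    (τ : Equiv.Perm (Fin 8)) (c : Fin 8 → ℂ),
    RespectsCut σ ∧ (∀ i, ‖c i‖ = 1) ∧
    ∀ i, T' (τ i) = c i • localUnitary U (permuteSystems σ (T i))

/-- The computational basis vector `|0⟩`. -/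
noncomputable def ketZero : Qubit := !₂[1, 0]

/-- The computational basis vector `|1⟩`. -/
noncomputable def ketOne : Qubit := !₂[0, 1]

/-- The vector `|x'⟩` orthogonal to `|x⟩` and of the same norm. -/
noncomputable def perp (x : Qubit) : Qubit := !₂[-star (x 1), star (x 0)]

/-- `x ≁ y`: the unit vectors `x` and `y` are different states, that is, they do not just differ
by a phase. -/
def DifferentStates (x y : Qubit) : Prop := ¬ ∃ c : ℂ, ‖c‖ = 1 ∧ y = c • x

infix:50 " ≁ " => DifferentStates

/-- A qubit state: a unit vector. -/
def IsState (x : Qubit) : Prop := ‖x‖ = 1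

/-- A qubit state different from `|0⟩` and `|1⟩`. -/
def IsGenericState (x : Qubit) : Prop := IsState x ∧ x ≁ ketZero ∧ x ≁ ketOne

/-- An `8 × 4` matrix of qubit vectors; its rows stand for four-qubit product vectors. -/
abbrev QubitMatrix := Fin 8 → Fin 4 → Qubit

/-- The list of product vectors given by the rows of a matrix. -/
noncomputable def rowVectors (M : QubitMatrix) : Fin 8 → FourQubit := fun i => tensorFour (M i)

section Matrices

local notation "𝟬" => ketZero
local notation "𝟭" => ketOne
local postfix:max "′" => perp

noncomputable def F1 (f5 g3 h3 i3 i4 : Qubit) : QubitMatrix :=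
  ![![𝟬,   𝟬,   𝟬,   𝟬],
    ![𝟬,   𝟭,   𝟬,   𝟭],
    ![𝟭,   g3,  h3,  i3],
    ![𝟭,   g3′, h3,  i4],
    ![f5,  g3′, 𝟭,   i4′],
    ![f5,  g3,  𝟭,   i3′],
    ![f5′, 𝟬,   h3′, 𝟭],
    ![f5′, 𝟭,   h3′, 𝟬]]

noncomputable def F2 (f5 g3 h3 i2 i3 i4 : Qubit) : QubitMatrix :=
  ![![𝟬,   𝟬,   𝟬,   𝟬],
    ![𝟬,   𝟭,   𝟬,   i2],
    ![𝟭,   g3,  h3,  i3],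
    ![𝟭,   g3′, h3,  i4],
    ![f5,  g3′, 𝟭,   i4′],
    ![f5,  g3,  𝟭,   i3′],
    ![f5′, 𝟭,   h3′, i2′],
    ![f5′, 𝟬,   h3′, 𝟭]]

noncomputable def F3 (f5 g3 h3 h4 i2 : Qubit) : QubitMatrix :=
  ![![𝟬,   𝟬,   𝟬,   𝟬],
    ![𝟬,   𝟭,   𝟬,   i2],
    ![𝟭,   g3,  h3,  𝟬],
    ![𝟭,   g3′, h4,  i2],
    ![f5,  g3′, 𝟭,   i2′],
    ![f5,  g3,  𝟭,   𝟭],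
    ![f5′, 𝟭,   h3′, i2′],
    ![f5′, 𝟬,   h4′, 𝟭]]

noncomputable def F4 (f5 g3 g4 h3 i2 i3 : Qubit) : QubitMatrix :=
  ![![𝟬,   𝟬,   𝟬,   𝟬],
    ![𝟬,   𝟭,   𝟬,   i2],
    ![𝟭,   g3,  h3,  i3],
    ![𝟭,   g4,  h3,  i3′],
    ![f5,  g3′, 𝟭,   i3],
    ![f5,  g4′, 𝟭,   i3′],
    ![f5′, 𝟭,   h3′, i2′],
    ![f5′, 𝟬,   h3′, 𝟭]]

noncomputable def F5 (f5 f6 g3 h3 i2 : Qubit) : QubitMatrix :=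
  ![![𝟬,   𝟬,   𝟬,   𝟬],
    ![𝟬,   𝟭,   𝟬,   i2],
    ![𝟭,   g3,  h3,  𝟭],
    ![𝟭,   g3′, h3,  i2′],
    ![f5,  g3,  𝟭,   𝟬],
    ![f6,  g3′, 𝟭,   i2],
    ![f5′, 𝟭,   h3′, i2′],
    ![f6′, 𝟬,   h3′, 𝟭]]

noncomputable def F6 (f5 g3 h2 i2 i3 i4 : Qubit) : QubitMatrix :=
  ![![𝟬,   𝟬,   𝟬,   𝟬],
    ![𝟬,   𝟭,   h2,  i2],
    ![𝟭,   g3,  𝟬,   i3],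
    ![𝟭,   g3′, h2,  i4],
    ![f5,  𝟭,   h2′, i3′],
    ![f5,  𝟬,   𝟭,   i4′],
    ![f5′, g3,  𝟭,   i2′],
    ![f5′, g3′, h2′, 𝟭]]

/-- The parameters allowed in `F1`. -/
def Cond1 (f5 g3 h3 i3 i4 : Qubit) : Prop :=
  IsGenericState f5 ∧ IsGenericState g3 ∧ IsGenericState h3 ∧
  IsGenericState i3 ∧ IsGenericState i4 ∧ i3 ≁ i4

/-- The parameters allowed in `F2`. -/
def Cond2 (f5 g3 h3 i2 i3 i4 : Qubit) : Prop :=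
  IsGenericState f5 ∧ IsGenericState g3 ∧ IsGenericState h3 ∧
  IsGenericState i2 ∧ IsState i3 ∧ IsState i4 ∧ i3 ≁ i4 ∧ i3 ≁ i4′

/-- The parameters allowed in `F3`. -/
def Cond3 (f5 g3 h3 h4 i2 : Qubit) : Prop :=
  IsGenericState f5 ∧ IsGenericState g3 ∧ IsGenericState h3 ∧ IsGenericState h4 ∧
  IsGenericState i2 ∧ h3 ≁ h4

/-- The inequalities between the parameters of `F4`. -/
def Ineq4 (f5 g3 g4 h3 i2 i3 : Qubit) : Prop :=
  IsGenericState f5 ∧ IsGenericState g3 ∧ IsGenericState g4 ∧ IsGenericState h3 ∧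
  IsGenericState i2 ∧ IsGenericState i3 ∧
  g3 ≁ g4 ∧ g3 ≁ g4′ ∧ i2 ≁ i3 ∧ i2 ≁ i3′

/-- The affine coordinate `⟨1|x⟩ / ⟨0|x⟩` of a state `x` different from `|1⟩`. -/
noncomputable def affineCoord (x : Qubit) : ℂ := x 1 / x 0

/-- The exceptional parameters of `F4`, where cross-ratios coincide both in the columns `A, B`
and in the columns `C, D`. -/
def Exceptional4 (f5 g3 g4 h3 i2 i3 : Qubit) : Prop :=
  let s : ℂ := ((1 + (‖affineCoord f5‖ ^ 2)⁻¹ : ℝ) : ℂ)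
  let r : ℂ := ((‖affineCoord h3‖ ^ 2 : ℝ) : ℂ)
  (affineCoord g3 * star (affineCoord g4) = -s ∨ affineCoord g3 * star (affineCoord g4) = -s⁻¹) ∧
  (affineCoord i2 = (1 + r) * affineCoord i3 + r / star (affineCoord i3) ∨
    affineCoord i2 = -(r * affineCoord i3 + (1 + r) / star (affineCoord i3)))

/-- The parameters allowed in `F4`. -/
def Cond4 (f5 g3 g4 h3 i2 i3 : Qubit) : Prop :=
  Ineq4 f5 g3 g4 h3 i2 i3 ∧ ¬ Exceptional4 f5 g3 g4 h3 i2 i3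

/-- The parameters allowed in `F5`. -/
def Cond5 (f5 f6 g3 h3 i2 : Qubit) : Prop :=
  IsGenericState f5 ∧ IsGenericState f6 ∧ IsGenericState g3 ∧ IsGenericState h3 ∧
  IsGenericState i2 ∧ f5 ≁ f6

/-- The parameters allowed in `F6`. -/
def Cond6 (f5 g3 h2 i2 i3 i4 : Qubit) : Prop :=
  IsGenericState f5 ∧ IsGenericState g3 ∧ IsGenericState h2 ∧
  IsState i2 ∧ IsState i3 ∧ IsState i4 ∧
  i2 ≁ 𝟬 ∧ i2 ≁ i3′ ∧ i2 ≁ i4 ∧ i3 ≁ 𝟬 ∧ i3 ≁ i4 ∧ i4 ≁ 𝟭 ∧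
  -- if `i2 = i3`, then this state is neither `|1⟩` nor orthogonal to `i4`
  (i2 ≁ i3 ∨ (i2 ≁ 𝟭 ∧ i2 ≁ i4′)) ∧
  -- `i4 = |0⟩` is possible only if `i2 = i3`
  (i4 ≁ 𝟬 ∨ ¬ i2 ≁ i3)

/-- The six families of matrices `F_1, …, F_6` (numbered from `0` to `5`). -/
noncomputable def family : Fin 6 → Set QubitMatrix :=
  ![{M | ∃ f5 g3 h3 i3 i4, Cond1 f5 g3 h3 i3 i4 ∧ M = F1 f5 g3 h3 i3 i4},
    {M | ∃ f5 g3 h3 i2 i3 i4, Cond2 f5 g3 h3 i2 i3 i4 ∧ M = F2 f5 g3 h3 i2 i3 i4},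
    {M | ∃ f5 g3 h3 h4 i2, Cond3 f5 g3 h3 h4 i2 ∧ M = F3 f5 g3 h3 h4 i2},
    {M | ∃ f5 g3 g4 h3 i2 i3, Cond4 f5 g3 g4 h3 i2 i3 ∧ M = F4 f5 g3 g4 h3 i2 i3},
    {M | ∃ f5 f6 g3 h3 i2, Cond5 f5 f6 g3 h3 i2 ∧ M = F5 f5 f6 g3 h3 i2},
    {M | ∃ f5 g3 h2 i2 i3 i4, Cond6 f5 g3 h2 i2 i3 i4 ∧ M = F6 f5 g3 h2 i2 i3 i4}]

end Matrices

/-!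
The theorem is reduced to a finite combinatorial problem about rays.

*Configurations.* Only the rays of the entries matter, together with the operation that takes a ray
of `ℂ²` to the orthogonal one. Two rows are orthogonal if their entries are orthogonal in some
column, and a product vector `p ⊗ q` orthogonal to all rows splits the rows into a set `K` that does
not span `ℂ² ⊗ ℂ²` in the columns `A, B` and a complement that does not span it in the columns
`C, D` (`isUPB44_iff`). There are two evident combinatorial reasons for a set of rows not to span:
it carries at most three pairs of rays, or each of its rows has the ray `u` in one column or the ray
`v` in the other (`Dependent.singular`). So the rays of a UPB form an `8 × 4` array in which any two
rows are orthogonal in some column, and in which no set of rows and its complement both fail to span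
for such a reason (`IsConfiguration`).

*Completeness.* The configurations are classified by an exhaustive search, which is evaluated by the
kernel and proved sound. It assigns a column of orthogonality to one pair of rows after another,
keeps track of the equalities and orthogonality relations that follow and of the sets of rows that
are known to be dependent, and discards a branch as soon as these contradict each other. A first
search shows that no row is orthogonal to three others in one column
(`IsConfiguration.uncrowded`). Hence the first row is orthogonal to two, two, two and one of the
others in the four columns, and a second search starts from this pattern. All its branches end in a
contradiction or in one of seven templates, of which the last two make up the family `F6`
(`IsConfiguration.matches`). Local unitaries that take the first row to `|0000⟩` then produce a
member of a family (`exists_equivalent`).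

*Inequivalence.* An equivalence induces a permutation of the rows and an admissible permutation of
the columns that preserve the relations of equality and orthogonality between rays. For every
template there is a table of the relations that are possible between its entries, and backtracking
over the permutations shows that the tables of templates of different families are incompatible
(`familyIndex_eq_of_fits`).

*Members are unextendible.* Up to sign and conjugation, the determinant of four product vectors
`a r ⊗ b r` is a difference of two products of brackets `[v, w] = v₀ w₁ - v₁ w₀`. It is nonzero if
two equal `a`-factors make one of the products vanish and the other one does not
(`quadDet_ne_zero_of_parallel`), and also for a square with orthogonal `a`-factors along two
opposite sides and orthogonal `b`-factors along the other two, as then one product has absolute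
value one and the other, apart from a degenerate case, a smaller one
(`quadDet_ne_zero_of_antipodal`). For every partition of the rows into two sets, one of these
criteria shows that the first set spans in `A, B` or the second one in `C, D`, with the exception of
four partitions of the rows of `F4` into two quadruples (`certified_or`). The determinants of these
quadruples are computed explicitly, and both of them vanish for one of the four partitions exactly
if the parameters are exceptional (`exceptional4_iff`).
-/

noncomputable section

namespace UPB

/-! ### Boolean operations for evaluation in the kernel -/

/-- `f n`, written so that reduction to normal form evaluates the number `n` before it is
substituted, and hence only once. -/
def force {α : Type} (n : ℕ) (f : ℕ → α) : α := Nat.rec (f 0) (fun k _ => f (Nat.succ k)) n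

/-- Disjunction whose second argument is not evaluated if the first is `true`. -/
def orElse (a b : Bool) : Bool := Bool.rec b true a

/-- Conjunction whose second argument is not evaluated if the first is `false`. -/
def andAlso (a b : Bool) : Bool := Bool.rec false b a

/-- `if c then a else b` for a Boolean `c`. -/
def branch {α : Type} (c : Bool) (a b : α) : α := Bool.rec b a c

/-- Lazy version of `List.any`. -/
def anyOf {α : Type} (l : List α) (f : α → Bool) : Bool :=
  List.rec false (fun a _ ih => orElse (f a) ih) l

/-- Lazy version of `List.all`. -/
def allOf {α : Type} (l : List α) (f : α → Bool) : Bool :=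
  List.rec true (fun a _ ih => andAlso (f a) ih) l

/-- Whether `i` belongs to the set with bit mask `m`. -/
def hit (m i : ℕ) : Bool := Nat.beq (Nat.land (Nat.shiftRight m i) 1) 1

/-! ### Partial knowledge of a configuration -/

/-- What is known about one column: a list of pairs `(p, n)` of disjoint bit masks, each of them
meaning that the rows in `p` share one ray and the rows in `n` the ray orthogonal to it. A row that
occurs nowhere stands for the pair consisting of itself and the empty set. -/
abbrev Column := List (ℕ × ℕ)

/-- Finds the pair of `col` that contains the row `i`, interchanging its two masks if necessary so
that `i` lies in the first one, and passes both masks and the rest of the list on to a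
continuation. -/
def pull {α : Type} (i : ℕ) (col : Column) : (ℕ → ℕ → Column → α) → α :=
  List.rec (fun k => k (Nat.shiftLeft 1 i) 0 [])
    (fun b l ih k => branch (hit b.1 i) (k b.1 b.2 l) (branch (hit b.2 i) (k b.2 b.1 l)
      (ih fun p n l' => k p n (b :: l')))) col

/-- Whether `col` contains the information that the rays of `i` and `j` are equal (`s = false`) or
orthogonal (`s = true`). -/
def linked (s : Bool) (i j : ℕ) (col : Column) : Bool :=
  pull i col fun p n _ => hit (branch s n p) j

/-- Adds to `col` the information that the rays of `i` and `j` are equal (`s = false`) or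
orthogonal (`s = true`). The value is `same` if this is known already, `contra` if the opposite is
known, and otherwise `k` applied to the pair that arises from the union of two pairs, and to the
rest of the list. -/
def glue {α : Type} (s : Bool) (i j : ℕ) (col : Column) (contra : α) (same : α)
    (k : ℕ → ℕ → Column → α) : α :=
  pull i col fun p n rest =>
    branch (hit (branch s n p) j) same (branch (hit (branch s p n) j) contra
      (pull j rest fun p' n' rest' =>
        branch s (force (Nat.lor p n') fun a => force (Nat.lor n p') fun b => k a b rest')
          (force (Nat.lor p p') fun a => force (Nat.lor n n') fun b => k a b rest')))

/-- Whether the mask `m < 256` has at least two elements: the bits of the constant are the answers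
for all `m`. -/
def large2 (m : ℕ) : Bool :=
  hit 0xfffffffffffffffffffffffffffffffefffffffffffffffefffffffefffefee8 m

/-- Whether the mask `m < 256` has at least three elements. -/
def large3 (m : ℕ) : Bool :=
  hit 0xfffffffffffffffefffffffefffefee8fffffffefffefee8fffefee8fee8e880 m

/-- Whether the mask `m < 256` has at least four elements. -/
def large4 (m : ℕ) : Bool :=
  hit 0xfffffffefffefee8fffefee8fee8e880fffefee8fee8e880fee8e880e8808000 m

/-- Whether the mask `m < 256` has at least five elements. -/
def large5 (m : ℕ) : Bool :=
  hit 0xfffefee8fee8e880fee8e880e8808000fee8e880e8808000e880800080000000 m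

/-- Partial knowledge of a configuration: the information `c0, …, c3` about its four columns; bit
masks `s0`, `s1` of length 256 that record sets of rows known to be dependent, where bit `v` of
`s0` stands for the set `v` in the columns `A, B`, and bit `v` of `s1` for the complement of `v` in
the columns `C, D`; and sets `d0`, `d1` of at least two rows known to agree in both columns `A, B`
or in both columns `C, D` (`0` if none is known). -/
structure Partial where
  c0 : Column
  c1 : Column
  c2 : Column
  c3 : Column
  s0 : ℕ
  d0 : ℕ
  s1 : ℕ
  d1 : ℕ

def rows : List ℕ := [0, 1, 2, 3, 4, 5, 6, 7]

/-- Records in `S` the unions of the set `m` with a single row outside it. Sets are complemented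
before they are recorded if `x = 255`, and recorded as they are if `x = 0`. -/
def addRow (x m : ℕ) (S : ℕ) : ℕ :=
  List.rec S (fun r _ ih => branch (hit m r) ih
    (Nat.lor ih (Nat.shiftLeft 1 (Nat.xor x (Nat.lor m (Nat.shiftLeft 1 r)))))) rows

/-- Records in `S` the unions of the set `m` with two rows outside it. -/
def addTwoRows (x m : ℕ) (S : ℕ) : ℕ :=
  List.rec S (fun r _ ih => branch (hit m r) ih (addRow x (Nat.lor m (Nat.shiftLeft 1 r)) ih)) rows

/-- Whether `n = 0`. -/
def isZero (n : ℕ) : Bool := Nat.beq n 0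

/-- Negation. -/
def negate (b : Bool) : Bool := Bool.rec true false b

/-- The consequences of the fact that the rows in `a` agree in one column and the rows in `b` in
the other column of a pair: the set `a ∪ b` is dependent. The value `true` signals a contradiction,
which arises if a dependent set has five rows, or if two sets of rows with repeated pairs of rays
have three rows in their union. -/
def addUnion (x a b S D : ℕ) (k : ℕ → ℕ → Bool) : Bool :=
  branch (large2 b) (force (Nat.lor a b) fun u =>
      orElse (large5 u)
        (force (branch (large4 u) (Nat.lor S (Nat.shiftLeft 1 (Nat.xor x u))) S) fun S =>
          branch (large2 (Nat.land a b))
            (force (Nat.land a b) fun d =>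
              orElse (andAlso (negate (isZero D)) (large3 (Nat.lor D d)))
                (force (addTwoRows x d S) fun S => k S d))
            (k S D))) (k S D)

/-- `addUnion` for the set `a` and all sets of rows that agree in the other column. -/
def addUnions (x a : ℕ) (col : Column) (S D : ℕ) (k : ℕ → ℕ → Bool) : Bool :=
  List.rec (motive := fun _ => ℕ → ℕ → Bool) k
    (fun b _ ih S D => addUnion x a b.1 S D fun S D => addUnion x a b.2 S D ih) col S D

/-- The consequences of the fact that the rows in `a` agree in one column, where `col` is the other
column of the same pair. -/
def addClass (x a : ℕ) (col : Column) (S D : ℕ) (k : ℕ → ℕ → Bool) : Bool :=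
  branch (large2 a)
    (orElse (large4 a) (branch (large3 a)
      (force (addRow x a S) fun S => addUnions x a col S D k)
      (addUnions x a col S D k)))
    (k S D)

/-- The consequences of a new pair `(p, n)` in a column, where `other` is the other column of the
same pair and `T` records the dependent sets of the opposite pair. It is a contradiction if a set
is dependent for one pair of columns and its complement for the other one. If `deg` is set, no row
may be orthogonal to three others in one column. -/
def addBasis (deg : Bool) (x p n : ℕ) (other : Column) (S D T : ℕ) (k : ℕ → ℕ → Bool) : Bool :=
  orElse (andAlso deg (orElse (large3 p) (large3 n)))
    (addClass x p other S D fun S D => addClass x n other S D fun S D =>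
      orElse (negate (isZero (Nat.land S T))) (k S D))

/-- Assumes that the rays of `i` and `j` in column `c` are equal (`s = false`) or orthogonal
(`s = true`) and continues with the knowledge that results. The value is `true` if there is a
contradiction. -/
def attempt (deg : Bool) (s : Bool) (c i j : ℕ) (st : Partial) (cont : Partial → Bool) : Bool :=
  Partial.rec (fun c0 c1 c2 c3 s0 d0 s1 d1 =>
    branch (Nat.beq c 0)
      (glue s i j c0 true (cont ⟨c0, c1, c2, c3, s0, d0, s1, d1⟩) fun p n l =>
        addBasis deg 0 p n c1 s0 d0 s1 fun S D => cont ⟨(p, n) :: l, c1, c2, c3, S, D, s1, d1⟩)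
    (branch (Nat.beq c 1)
      (glue s i j c1 true (cont ⟨c0, c1, c2, c3, s0, d0, s1, d1⟩) fun p n l =>
        addBasis deg 0 p n c0 s0 d0 s1 fun S D => cont ⟨c0, (p, n) :: l, c2, c3, S, D, s1, d1⟩)
    (branch (Nat.beq c 2)
      (glue s i j c2 true (cont ⟨c0, c1, c2, c3, s0, d0, s1, d1⟩) fun p n l =>
        addBasis deg 255 p n c3 s1 d1 s0 fun S D => cont ⟨c0, c1, (p, n) :: l, c3, s0, d0, S, D⟩)
      (glue s i j c3 true (cont ⟨c0, c1, c2, c3, s0, d0, s1, d1⟩) fun p n l =>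
        addBasis deg 255 p n c2 s1 d1 s0 fun S D =>
          cont ⟨c0, c1, c2, (p, n) :: l, s0, d0, S, D⟩)))) st

/-- The information about column `c`. -/
def Partial.col (st : Partial) (c : ℕ) : Column :=
  Partial.rec (fun c0 c1 c2 c3 _ _ _ _ =>
    branch (Nat.beq c 0) c0 (branch (Nat.beq c 1) c1 (branch (Nat.beq c 2) c2 c3))) st

/-- Whether the rows `i` and `j` are known to be orthogonal in some column. -/
def covered (st : Partial) (i j : ℕ) : Bool :=
  Partial.rec (fun c0 c1 c2 c3 _ _ _ _ => orElse (linked true i j c0) (orElse (linked true i j c1)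
    (orElse (linked true i j c2) (linked true i j c3)))) st

/-! ### The exhaustive search -/

/-- Exhaustive search over the pairs of rows in the list: if the pair is not known to be
orthogonal, each of the four columns is tried as the one where it is. The value is `true` if every
branch ends in a contradiction or in a leaf where `leaf` is `true`. -/
def search (deg : Bool) (leaf : Partial → Bool) (es : List (ℕ × ℕ)) : Partial → Bool :=
  List.rec leaf (fun e _ ih st =>
    branch (covered st e.1 e.2) (ih st)
      (andAlso (attempt deg true 0 e.1 e.2 st ih) (andAlso (attempt deg true 1 e.1 e.2 st ih)
        (andAlso (attempt deg true 2 e.1 e.2 st ih) (attempt deg true 3 e.1 e.2 st ih))))) es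

/-- A search in which every pair in the list is assigned a column, the columns being weakly
increasing along the list and at least `lo`. The order of the rows can be chosen such that this
holds. -/
def chain (deg : Bool) (cont : Partial → Bool) (es : List (ℕ × ℕ)) : ℕ → Partial → Bool :=
  List.rec (fun _ st => cont st) (fun e _ ih lo st =>
    allOf [0, 1, 2, 3] fun c =>
      orElse (negate (Nat.ble lo c)) (attempt deg true c e.1 e.2 st (ih c))) es

/-- The entry of a list at a given index, or `d` if there is none. -/
def nth {α : Type} (d : α) (l : List α) (n : ℕ) : α :=
  List.rec (motive := fun _ => ℕ → α) (fun _ => d)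
    (fun a _ ih n => Nat.rec a (fun m _ => ih m) n) l n

/-! ### Templates and the leaves of the search -/

/-- The combinatorial pattern of a family of matrices. The label of row `r` in column `c` is
`2 * b` if the ray of row `r` is that of row `b`, and `2 * b + 1` if it is orthogonal to it, where
the rows `b` represent the different rays of the column. An element `(c, r, b, s)` of `neqs`
demands that in column `c` the rays of `r` and `b` are not equal (`s = false`) or not orthogonal
(`s = true`). -/
structure Template where
  labels : List (List ℕ)
  neqs : List (ℕ × ℕ × ℕ × Bool)

/-- The digit at position `i`, counted from the left, of a number `w` with `len` hexadecimal
digits. -/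
def nibble (len w i : ℕ) : ℕ :=
  Nat.land (Nat.shiftRight w (Nat.mul 4 (Nat.sub len (Nat.succ i)))) 15

/-- The patterns of `F1, …, F5`, that of `F6` with `i2 ≠ i3`, and that of `F6` with `i2 = i3`. -/
def templates : List Template :=
  [⟨[[0, 0, 1, 1, 8, 8, 9, 9], [0, 1, 4, 5, 5, 4, 0, 1], [0, 0, 4, 4, 1, 1, 5, 5],
      [0, 1, 4, 6, 7, 5, 1, 0]],
    [(0, 0, 4, false), (0, 0, 4, true), (1, 0, 2, false), (1, 0, 2, true), (2, 0, 2, false),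
      (2, 0, 2, true), (3, 0, 2, false), (3, 0, 2, true), (3, 0, 3, false), (3, 0, 3, true),
      (3, 2, 3, false)]⟩,
   ⟨[[0, 0, 1, 1, 8, 8, 9, 9], [0, 1, 4, 5, 5, 4, 1, 0], [0, 0, 4, 4, 1, 1, 5, 5],
      [0, 2, 4, 6, 7, 5, 3, 1]],
    [(0, 0, 4, false), (0, 0, 4, true), (1, 0, 2, false), (1, 0, 2, true), (2, 0, 2, false),
      (2, 0, 2, true), (3, 0, 1, false), (3, 0, 1, true), (3, 2, 3, false), (3, 2, 3, true)]⟩,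
   ⟨[[0, 0, 1, 1, 8, 8, 9, 9], [0, 1, 4, 5, 5, 4, 1, 0], [0, 0, 4, 6, 1, 1, 5, 7],
      [0, 2, 0, 2, 3, 1, 3, 1]],
    [(0, 0, 4, false), (0, 0, 4, true), (1, 0, 2, false), (1, 0, 2, true), (2, 0, 2, false),
      (2, 0, 2, true), (2, 0, 3, false), (2, 0, 3, true), (2, 2, 3, false), (3, 0, 1, false),
      (3, 0, 1, true)]⟩,
   ⟨[[0, 0, 1, 1, 8, 8, 9, 9], [0, 1, 4, 6, 5, 7, 1, 0], [0, 0, 4, 4, 1, 1, 5, 5],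
      [0, 2, 4, 5, 4, 5, 3, 1]],
    [(0, 0, 4, false), (0, 0, 4, true), (1, 0, 2, false), (1, 0, 2, true), (1, 0, 3, false),
      (1, 0, 3, true), (1, 2, 3, false), (1, 2, 3, true), (2, 0, 2, false), (2, 0, 2, true),
      (3, 0, 1, false), (3, 0, 1, true), (3, 0, 2, false), (3, 0, 2, true), (3, 1, 2, false),
      (3, 1, 2, true)]⟩,
   ⟨[[0, 0, 1, 1, 8, 10, 9, 11], [0, 1, 4, 5, 4, 5, 1, 0], [0, 0, 4, 4, 1, 1, 5, 5],
      [0, 2, 1, 3, 0, 2, 3, 1]],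
    [(0, 0, 4, false), (0, 0, 4, true), (0, 0, 5, false), (0, 0, 5, true), (0, 4, 5, false),
      (1, 0, 2, false), (1, 0, 2, true), (2, 0, 2, false), (2, 0, 2, true), (3, 0, 1, false),
      (3, 0, 1, true)]⟩,
   ⟨[[0, 0, 1, 1, 8, 8, 9, 9], [0, 1, 4, 5, 1, 0, 4, 5], [0, 2, 0, 2, 3, 1, 1, 3],
      [0, 2, 4, 6, 5, 7, 3, 1]],
    [(0, 0, 4, false), (0, 0, 4, true), (1, 0, 2, false), (1, 0, 2, true), (2, 0, 1, false),
      (2, 0, 1, true), (3, 0, 1, false), (3, 0, 2, false), (3, 0, 3, false), (3, 0, 3, true),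
      (3, 1, 2, false), (3, 1, 2, true), (3, 1, 3, false), (3, 2, 3, false)]⟩,
   ⟨[[0, 0, 1, 1, 8, 8, 9, 9], [0, 1, 4, 5, 1, 0, 4, 5], [0, 2, 0, 2, 3, 1, 1, 3],
      [0, 2, 2, 6, 3, 7, 3, 1]],
    [(0, 0, 4, false), (0, 0, 4, true), (1, 0, 2, false), (1, 0, 2, true), (2, 0, 1, false),
      (2, 0, 1, true), (3, 0, 1, false), (3, 0, 1, true), (3, 0, 3, true), (3, 1, 3, false),
      (3, 1, 3, true)]⟩]

/-- The label of row `r` in column `c`. -/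
def Template.label (t : Template) (c r : ℕ) : ℕ := nth 0 (nth [] t.labels c) r

/-- Whether a label stands for the ray orthogonal to that of the representing row. -/
def oddLabel (l : ℕ) : Bool := Nat.beq (Nat.land l 1) 1

/-- The `i`-th template. -/
def template (i : ℕ) : Template := nth ⟨[], []⟩ templates i

/-- Whether `f` is `true` at all entries of a list and their indices, where the first entry has the
given index. -/
def allIndexed {α : Type} (l : List α) (f : ℕ → α → Bool) : ℕ → Bool :=
  List.rec (fun _ => true) (fun a _ ih i => andAlso (f i a) (ih (Nat.succ i))) l

/-- Whether the partial knowledge `st` contains all equalities and orthogonality relations demanded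
by the template, if row `r` and column `c` of the template are row `τ r` and column `σ c` of the
configuration. -/
def fits (st : Partial) (t : Template) (σ τ : ℕ) : Bool :=
  allIndexed t.labels (fun c col => allIndexed col (fun r l =>
    orElse (Nat.beq l (Nat.mul 2 r))
    (linked (oddLabel l) (nibble 8 τ r) (nibble 8 τ (Nat.div l 2)) (st.col (nibble 4 σ c)))) 0) 0

/-- The treatment of a leaf of the search: some template, arranged according to an element of `W`,
has to fit as far as its equalities and orthogonality relations are concerned. Its inequalities
need not be implied by what is known: if one of them is violated, this is additional knowledge,
which has to lead to a contradiction or to another template. The number `f` bounds the depth of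
this recursion. -/
def resolve (W : List (ℕ × ℕ × ℕ)) (f : ℕ) : Partial → Bool :=
  Nat.rec (fun _ => false) (fun _ ih st =>
    anyOf W fun w => andAlso (fits st (template w.1) w.2.1 w.2.2)
      (allOf (template w.1).neqs fun q =>
        andAlso (negate (linked q.2.2.2 (nibble 8 w.2.2 q.2.1) (nibble 8 w.2.2 q.2.2.1)
          (st.col (nibble 4 w.2.1 q.1))))
        (attempt false q.2.2.2 (nibble 4 w.2.1 q.1) (nibble 8 w.2.2 q.2.1)
          (nibble 8 w.2.2 q.2.2.1) st ih))) f

/-- The arrangements of templates that occur at the leaves: the number of the template, and the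
permutations of columns and of rows, written as hexadecimal digits. -/
def witnesses : List (ℕ × ℕ × ℕ) :=
  [(1, 0x1023, 0x72654310), (1, 0x1023, 0x71654320), (1, 0x0123, 0x74651230), (1, 0x0123,
   0x73651240), (1, 0x0123, 0x74652130), (1, 0x0123, 0x73652140), (1, 0x1023, 0x72653410), (1,
   0x1023, 0x71653420), (5, 0x0123, 0x76351240), (5, 0x1023, 0x75163420), (1, 0x3210, 0x72601543),
   (1, 0x3201, 0x74603521), (1, 0x1032, 0x75612034), (1, 0x0132, 0x76534012), (5, 0x2301,
   0x72410356), (4, 0x3210, 0x72506143), (4, 0x3210, 0x61347205), (4, 0x3201, 0x74605321), (4,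
   0x3201, 0x53127406), (4, 0x1023, 0x43201765), (4, 0x1023, 0x43102765), (4, 0x1023, 0x43027156),
   (4, 0x1023, 0x43017256), (4, 0x0123, 0x40215673), (4, 0x0123, 0x40125673), (2, 0x1032,
   0x75160234), (2, 0x1023, 0x65721034), (2, 0x1023, 0x65712034), (2, 0x1023, 0x65270143), (2,
   0x1023, 0x65170243), (2, 0x0132, 0x76350412), (2, 0x0132, 0x53672140), (2, 0x0123, 0x65743012),
   (2, 0x0123, 0x65734012), (2, 0x0123, 0x65470321), (2, 0x0123, 0x65370421), (0, 0x2310,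
   0x72436510), (0, 0x2310, 0x72435610), (6, 0x1032, 0x75613402), (6, 0x1023, 0x75163420), (6,
   0x1023, 0x57614302), (6, 0x0132, 0x76531204), (6, 0x0123, 0x76351240), (6, 0x0123, 0x67532104),
   (5, 0x3210, 0x72604153), (5, 0x3201, 0x74602351), (5, 0x2310, 0x74230165), (5, 0x1023,
   0x76153420), (5, 0x1023, 0x75263410), (5, 0x0123, 0x76451230), (4, 0x3210, 0x72605143), (4,
   0x2310, 0x72436105), (4, 0x2310, 0x72346105), (4, 0x2301, 0x74215306), (4, 0x2301, 0x74125306),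
   (4, 0x0123, 0x30215674), (4, 0x0123, 0x30125674), (3, 0x2310, 0x65201743), (3, 0x2310,
   0x65201734), (3, 0x2310, 0x65102743), (3, 0x2310, 0x65102734), (3, 0x2301, 0x65403721), (3,
   0x2301, 0x65403712), (3, 0x2301, 0x65304721), (3, 0x2301, 0x65304712), (2, 0x2310, 0x72416503),
   (2, 0x2310, 0x72415603), (2, 0x2301, 0x74236501), (2, 0x2301, 0x74235601), (2, 0x1032,
   0x61574320), (2, 0x1032, 0x51674320), (1, 0x3210, 0x72501643), (0, 0x2310, 0x71436520), (0,
   0x2310, 0x71435620), (0, 0x2301, 0x74216530), (0, 0x2301, 0x74215630), (0, 0x2301, 0x73216540),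
   (0, 0x2301, 0x73215640), (0, 0x1023, 0x72654301), (0, 0x1023, 0x72653401), (0, 0x1023,
   0x71654302), (0, 0x1023, 0x71653402), (0, 0x1023, 0x65721043), (0, 0x1023, 0x65721034), (0,
   0x1023, 0x65712043), (0, 0x1023, 0x65712034), (0, 0x0123, 0x74652103), (0, 0x0123, 0x74651203),
   (0, 0x0123, 0x73652104), (0, 0x0123, 0x73651204), (0, 0x0123, 0x65743021), (0, 0x0123,
   0x65743012), (0, 0x0123, 0x65734021), (0, 0x0123, 0x65734012)]

/-! ### The two searches -/

/-- Row `0` is orthogonal to the rows `1, 2` in the first column, to `3, 4` in the second, to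
`5, 6` in the third and to `7` in the fourth. -/
def patternStart : Partial := ⟨[(1, 6)], [(1, 24)], [(1, 96)], [(1, 128)], 0, 0, 0, 0⟩

/-- The pairs among the rows `1, …, 6`, in an order that keeps the search short. -/
def patternEdges : List (ℕ × ℕ) :=
  [(1, 4), (1, 3), (1, 6), (1, 5), (1, 2), (2, 6), (2, 5), (2, 4), (2, 3), (5, 6), (4, 6), (4, 5),
    (3, 4), (3, 6), (3, 5)]

/-- The search that starts from `patternStart`. The relations of row `7` come first, where the rows
`1, 2`, the rows `3, 4` and the rows `5, 6` may be interchanged. -/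
def patternSearch : Bool :=
  chain true (chain true (chain true (search true (resolve witnesses 4) patternEdges)
    [(7, 5), (7, 6)] 0) [(7, 3), (7, 4)] 0) [(7, 1), (7, 2)] 0 patternStart

/-- The pairs of rows that remain after those of `crowdedSearch`, in an order that keeps the search
short. -/
def crowdedEdges : List (ℕ × ℕ) :=
  [(1, 6), (1, 5), (1, 7), (1, 4), (2, 6), (2, 4), (2, 5), (2, 7), (3, 6), (3, 5), (3, 7), (3, 4),
    (4, 6), (4, 5), (5, 6), (6, 7), (4, 7), (5, 7)]

/-- Row `0` is orthogonal to the rows `1, 2, 3` in the first column. -/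
def crowdedStart : Partial := ⟨[(1, 14)], [], [], [], addRow 0 14 0, 0, 0, 0⟩

/-- The search that starts from `crowdedStart`. The relations of row `0` to the rows `4, …, 7` and
those within `1, 2, 3` come first, where each of these two sets of rows may be permuted. -/
def crowdedSearch : Bool :=
  chain false (chain false (search false (fun _ => false) crowdedEdges)
    [(1, 2), (1, 3), (2, 3)] 0) [(0, 4), (0, 5), (0, 6), (0, 7)] 0 crowdedStart

/-! ### Evaluation of the Boolean operations -/

@[simp] theorem force_eq {α : Type} (n : ℕ) (f : ℕ → α) : force n f = f n := by
  cases n <;> rfl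
@[simp] theorem orElse_eq (a b : Bool) : orElse a b = (a || b) := by cases a <;> rfl
@[simp] theorem andAlso_eq (a b : Bool) : andAlso a b = (a && b) := by cases a <;> rfl
@[simp] theorem negate_eq (a : Bool) : negate a = !a := by cases a <;> rfl
@[simp] theorem branch_eq {α : Type} (c : Bool) (a b : α) : branch c a b = if c then a else b := by
  cases c <;> rfl
@[simp] theorem isZero_eq (n : ℕ) : isZero n = decide (n = 0) := by
  rw [Bool.eq_iff_iff]; simp [isZero]

theorem anyOf_eq {α : Type} (l : List α) (f : α → Bool) : anyOf l f = l.any f := by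
  induction l with
  | nil => rfl
  | cons a l ih => exact (orElse_eq _ _).trans (by rw [List.any_cons, ← ih]; rfl)

theorem allOf_eq {α : Type} (l : List α) (f : α → Bool) : allOf l f = l.all f := by
  induction l with
  | nil => rfl
  | cons a l ih => exact (andAlso_eq _ _).trans (by rw [List.all_cons, ← ih]; rfl)

@[simp] theorem hit_eq (m i : ℕ) : hit m i = m.testBit i := by
  simp only [hit, Nat.testBit]
  have h : Nat.land (Nat.shiftRight m i) 1 = (m >>> i) % 2 := Nat.and_one_is_mod _
  rw [h, show (1 &&& m >>> i) = (m >>> i) % 2 by rw [Nat.and_comm]; exact Nat.and_one_is_mod _]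
  rcases Nat.mod_two_eq_zero_or_one (m >>> i) with h | h <;> rw [h] <;> rfl

theorem testBit_lor (m n i : ℕ) : (Nat.lor m n).testBit i = (m.testBit i || n.testBit i) :=
  Nat.testBit_or m n i
theorem testBit_land (m n i : ℕ) : (Nat.land m n).testBit i = (m.testBit i && n.testBit i) :=
  Nat.testBit_and m n i
theorem testBit_bit (i j : ℕ) : (Nat.shiftLeft 1 i).testBit j = decide (i = j) := by
  have : Nat.shiftLeft 1 i = 2 ^ i := by
    change 1 <<< i = 2 ^ i
    simp [Nat.shiftLeft_eq]
  rw [this, Nat.testBit_two_pow]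

section Configurations

/-! ### Columns and orthogonality relations -/

variable {P : Type*} (ν : P → P)

/-- `p` or `ν p`, according to a sign. -/
def twist (s : Bool) (p : P) : P := if s then ν p else p

/-- The rows in `p` have one ray in common and the rows in `n` the ray orthogonal to it. Here and
below, `P` is the set of rays, and `ν` takes a ray to the one orthogonal to it. -/
def IsBasis (y : Fin 8 → P) (p n : ℕ) : Prop :=
  ∃ u, ∀ r : Fin 8, (p.testBit r = true → y r = u) ∧ (n.testBit r = true → y r = ν u)

/-- The information in `col` is true for the column `y`. -/
def ColumnHolds (y : Fin 8 → P) (col : Column) : Prop := ∀ b ∈ col, IsBasis ν y b.1 b.2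

variable {ν}

theorem IsBasis.swap (hν : Function.Involutive ν) {y : Fin 8 → P} {p n : ℕ}
    (h : IsBasis ν y p n) : IsBasis ν y n p := by
  obtain ⟨u, hu⟩ := h
  exact ⟨ν u, fun r => ⟨(hu r).2, fun hr => by rw [hν u]; exact (hu r).1 hr⟩⟩

/-- The masks and the rest found by `pull` do not depend on the continuation, and what they say is
true. -/
theorem pull_spec (hν : Function.Involutive ν) {y : Fin 8 → P} (i : Fin 8) {col : Column}
    (h : ColumnHolds ν y col) :
    ∃ p n l, (∀ {α : Type} (k : ℕ → ℕ → Column → α), pull i col k = k p n l) ∧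
      IsBasis ν y p n ∧ p.testBit i = true ∧ ColumnHolds ν y l := by
  induction col with
  | nil =>
    refine ⟨Nat.shiftLeft 1 i, 0, [], fun k => rfl, ⟨y i, fun r => ⟨fun hr => ?_, by simp⟩⟩, ?_,
      by simp [ColumnHolds]⟩
    · rw [testBit_bit] at hr
      rw [Fin.ext (of_decide_eq_true hr)]
    · simp
  | cons b l ih =>
    have hb : IsBasis ν y b.1 b.2 := h b (by simp)
    have hl : ColumnHolds ν y l := fun c hc => h c (by simp [hc])
    have hunf : ∀ {α : Type} (k : ℕ → ℕ → Column → α), pull i (b :: l) k =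
        branch (hit b.1 i) (k b.1 b.2 l) (branch (hit b.2 i) (k b.2 b.1 l)
          (pull i l fun p n l' => k p n (b :: l'))) := fun k => rfl
    by_cases h1 : b.1.testBit i = true
    · exact ⟨b.1, b.2, l, fun k => by simp [hunf, h1], hb, h1, hl⟩
    by_cases h2 : b.2.testBit i = true
    · exact ⟨b.2, b.1, l, fun k => by simp [hunf, h1, h2], hb.swap hν, h2, hl⟩
    obtain ⟨p, n, l', e, hp, hi, hl'⟩ := ih hl
    refine ⟨p, n, b :: l', fun k => by simp [hunf, h1, h2, e], hp, hi, ?_⟩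
    intro c hc
    rcases List.mem_cons.1 hc with rfl | hc
    · exact hb
    · exact hl' c hc

theorem linked_sound (hν : Function.Involutive ν) {y : Fin 8 → P} {s : Bool} {i j : Fin 8}
    {col : Column} (h : ColumnHolds ν y col) (hl : linked s i j col = true) :
    y i = twist ν s (y j) := by
  obtain ⟨p, n, l, e, ⟨u, hu⟩, hi, -⟩ := pull_spec hν i h
  simp only [linked, e, branch_eq, hit_eq] at hl
  have h1 := (hu i).1 hi
  cases s with
  | false => simp only [Bool.false_eq_true, if_false] at hl; simp [twist, h1, (hu j).1 hl]
  | true => simp only [if_true] at hl; simp [twist, h1, (hu j).2 hl, hν u]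

theorem glue_spec (hν : Function.Involutive ν) (hne : ∀ p, ν p ≠ p) {y : Fin 8 → P} {s : Bool}
    {i j : Fin 8} {col : Column} (h : ColumnHolds ν y col) (hy : y i = twist ν s (y j)) {α : Type}
    (contra same : α) (k : ℕ → ℕ → Column → α) :
    glue s i j col contra same k = same ∨ ∃ p n l, glue s i j col contra same k = k p n l ∧
      IsBasis ν y p n ∧ p.testBit i = true ∧ (s = true → n.testBit j = true) ∧
      ColumnHolds ν y l := by
  obtain ⟨p, n, l, e, hp, hi, hl⟩ := pull_spec hν i h
  obtain ⟨p', n', l', e', hp', hj, hl'⟩ := pull_spec hν j hl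
  obtain ⟨u, hu⟩ := hp
  obtain ⟨u', hu'⟩ := hp'
  have h1 := (hu i).1 hi
  have h2 := (hu' j).1 hj
  simp only [glue, e, e', force_eq, branch_eq, hit_eq]
  cases s with
  | false =>
    simp only [Bool.false_eq_true, if_false]
    split_ifs with a b
    · exact Or.inl rfl
    · have := (hu j).2 b
      simp only [twist, Bool.false_eq_true, if_false] at hy
      exact absurd (by rw [← this, ← hy, h1]) (hne u)
    · refine Or.inr ⟨_, _, _, rfl, ⟨u, fun r => ?_⟩, by simp [hi], by simp, hl'⟩
      simp only [twist, Bool.false_eq_true, if_false] at hy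
      have huu : u' = u := by rw [← h1, ← h2, hy]
      subst huu
      simp only [testBit_lor, Bool.or_eq_true]
      exact ⟨fun hr => hr.elim (hu r).1 (hu' r).1, fun hr => hr.elim (hu r).2 (hu' r).2⟩
  | true =>
    simp only [if_true]
    split_ifs with a b
    · exact Or.inl rfl
    · have := (hu j).1 b
      simp only [twist, if_true] at hy
      exact absurd (by rw [← this, ← hy, h1, this]) (hne u)
    · simp only [twist, if_true] at hy
      have huu : u = ν u' := by rw [← h1, ← h2, hy]
      subst huu
      refine Or.inr ⟨_, _, _, rfl, ⟨ν u', fun r => ?_⟩, by simp [hi],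
        by simp [hj], hl'⟩
      simp only [testBit_lor, Bool.or_eq_true]
      refine ⟨fun hr => hr.elim (hu r).1 (hu' r).2, fun hr => hr.elim (hu r).2 fun h => ?_⟩
      rw [hν u']; exact (hu' r).1 h

/-! ### Configurations -/

/-- A combinatorial reason why some nonzero vector of `ℂ² ⊗ ℂ²` is orthogonal to all `y r ⊗ z r`
with `r` in `K`: a product vector works whose factors are orthogonal to `u` and to `v`, or the
vectors take at most three values up to a phase. -/
def Dependent (y z : Fin 8 → P) (K : Fin 8 → Prop) : Prop :=
  (∃ u v, ∀ r, K r → y r = u ∨ z r = v) ∨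
    ∃ a b c : Fin 8, ∀ r, K r → ∃ s, (s = a ∨ s = b ∨ s = c) ∧ y r = y s ∧ z r = z s

/-- The combinatorial content of an unextendible product basis: any two rows are orthogonal in some
column, and no set of rows is dependent in the columns `A, B` while its complement is dependent in
the columns `C, D`. -/
structure IsConfiguration (ν : P → P) (x : Fin 4 → Fin 8 → P) : Prop where
  orth : ∀ i j, i ≠ j → ∃ c, x c i = ν (x c j)
  spanning : ∀ K, Dependent (x 0) (x 1) K → ¬ Dependent (x 2) (x 3) fun r => ¬ K r

/-- A dependent set of rows leaves out at least four rows. -/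
def Spread (y z : Fin 8 → P) : Prop :=
  ∀ K, Dependent y z K → ¬ ∃ a b c : Fin 8, ∀ r, K r ∨ r = a ∨ r = b ∨ r = c

/-- Three rows are always dependent. -/
theorem dependent_three (y z : Fin 8 → P) {K : Fin 8 → Prop} {a b c : Fin 8}
    (h : ∀ r, K r → r = a ∨ r = b ∨ r = c) : Dependent y z K :=
  Or.inr ⟨a, b, c, fun r hr => ⟨r, h r hr, rfl, rfl⟩⟩

theorem IsConfiguration.spread_left {x : Fin 4 → Fin 8 → P} (h : IsConfiguration ν x) :
    Spread (x 0) (x 1) := by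
  rintro K hK ⟨a, b, c, habc⟩
  exact h.spanning K hK (dependent_three _ _ fun r hr => (habc r).resolve_left hr)

theorem IsConfiguration.spread_right {x : Fin 4 → Fin 8 → P} (h : IsConfiguration ν x) :
    Spread (x 2) (x 3) := by
  rintro K hK ⟨a, b, c, habc⟩
  refine h.spanning (fun r => ¬ K r) (dependent_three _ _ fun r hr => (habc r).resolve_left hr) ?_
  simpa using hK

/-! ### Counting rows -/

theorem exists_fin_cover (s : Finset (Fin 8)) {n : ℕ} (hs : s.card ≤ n) :
    ∃ f : Fin n → Fin 8, ∀ r ∈ s, ∃ i, r = f i := by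
  refine ⟨fun i => if h : i.1 < s.card then s.orderEmbOfFin rfl ⟨i, h⟩ else 0, fun r hr => ?_⟩
  have : r ∈ Set.range (s.orderEmbOfFin rfl) := by rw [Finset.range_orderEmbOfFin]; exact hr
  obtain ⟨i, hi⟩ := this
  exact ⟨⟨i, i.2.trans_le hs⟩, by simp [hi]⟩

/-- The set of rows with bit mask `m`. -/
def rowsOf (m : ℕ) : Finset (Fin 8) := Finset.univ.filter fun r => m.testBit r = true

theorem hit_lt {k n m : ℕ} (hk : k < 2 ^ n) (h : hit k m = true) : m < n := by
  rw [hit_eq] at h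
  by_contra hc
  rw [Nat.testBit_lt_two_pow (hk.trans_le (Nat.pow_le_pow_right (by norm_num) (not_lt.1 hc)))] at h
  simp at h

theorem card_of_large2 {m : ℕ} (h : large2 m = true) : 2 ≤ (rowsOf m).card := by
  have key : ∀ m : Fin 256, large2 m = true → 2 ≤ (rowsOf m).card := by decide +kernel
  exact key ⟨m, hit_lt (n := 256) (by norm_num) h⟩ h
theorem card_of_large3 {m : ℕ} (h : large3 m = true) : 3 ≤ (rowsOf m).card := by
  have key : ∀ m : Fin 256, large3 m = true → 3 ≤ (rowsOf m).card := by decide +kernel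
  exact key ⟨m, hit_lt (n := 256) (by norm_num) h⟩ h
theorem card_of_large4 {m : ℕ} (h : large4 m = true) : 4 ≤ (rowsOf m).card := by
  have key : ∀ m : Fin 256, large4 m = true → 4 ≤ (rowsOf m).card := by decide +kernel
  exact key ⟨m, hit_lt (n := 256) (by norm_num) h⟩ h
theorem card_of_large5 {m : ℕ} (h : large5 m = true) : 5 ≤ (rowsOf m).card := by
  have key : ∀ m : Fin 256, large5 m = true → 5 ≤ (rowsOf m).card := by decide +kernel
  exact key ⟨m, hit_lt (n := 256) (by norm_num) h⟩ h

/-- The rows outside a set of at least `8 - n` rows can be listed by a function on `Fin n`. -/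
theorem exists_cover {m n : ℕ} (hm : 8 ≤ n + (rowsOf m).card) :
    ∃ f : Fin n → Fin 8, ∀ r : Fin 8, m.testBit r = true ∨ ∃ i, r = f i := by
  obtain ⟨f, hf⟩ := exists_fin_cover (rowsOf m)ᶜ (n := n)
    (by rw [Finset.card_compl, Fintype.card_fin]; omega)
  refine ⟨f, fun r => ?_⟩
  by_cases h : m.testBit r = true
  · exact Or.inl h
  · exact Or.inr (hf r (by simpa [rowsOf] using h))

/-! ### Soundness of the rules for dependent sets -/

theorem ColumnHolds.cons {y : Fin 8 → P} {p n : ℕ} {l : Column} (hl : ColumnHolds ν y l)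
    (h : IsBasis ν y p n) : ColumnHolds ν y ((p, n) :: l) := by
  intro b hb
  rcases List.mem_cons.1 hb with rfl | hb
  · exact h
  · exact hl b hb

theorem Dependent.symm {y z : Fin 8 → P} {K : Fin 8 → Prop} (h : Dependent y z K) :
    Dependent z y K := by
  rcases h with ⟨u, v, h⟩ | ⟨a, b, c, h⟩
  · exact Or.inl ⟨v, u, fun r hr => (h r hr).symm⟩
  · refine Or.inr ⟨a, b, c, fun r hr => ?_⟩
    obtain ⟨s, hs, h1, h2⟩ := h r hr
    exact ⟨s, hs, h2, h1⟩

theorem Spread.symm {y z : Fin 8 → P} (h : Spread y z) : Spread z y := fun K hK => h K hK.symm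

/-- The sets recorded in `S` are dependent, where each of them is complemented first if
`x = 255`. -/
def SetHolds (x : ℕ) (y z : Fin 8 → P) (S : ℕ) : Prop :=
  ∀ v, S.testBit v = true → Dependent y z fun r => (v ^^^ x).testBit r = true

/-- `D` is `0` or a set of at least two rows that agree in both columns. -/
def DupHolds (y z : Fin 8 → P) (D : ℕ) : Prop :=
  D = 0 ∨ 2 ≤ (rowsOf D).card ∧ ∃ u v, ∀ r : Fin 8, D.testBit r = true → y r = u ∧ z r = v

/-- The rows in `a` agree in the column `y`. -/
def IsClass (y : Fin 8 → P) (a : ℕ) : Prop := ∃ u, ∀ r : Fin 8, a.testBit r = true → y r = u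

theorem IsBasis.left {y : Fin 8 → P} {p n : ℕ} (h : IsBasis ν y p n) : IsClass y p :=
  h.imp fun _ h r => (h r).1

theorem IsBasis.right {y : Fin 8 → P} {p n : ℕ} (h : IsBasis ν y p n) : IsClass y n := by
  obtain ⟨u, h⟩ := h
  exact ⟨ν u, fun r => (h r).2⟩

theorem SetHolds.symm {x : ℕ} {y z : Fin 8 → P} {S : ℕ} (h : SetHolds x y z S) :
    SetHolds x z y S := fun v hv => (h v hv).symm

theorem DupHolds.symm {y z : Fin 8 → P} {D : ℕ} (h : DupHolds y z D) : DupHolds z y D :=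
  h.imp_right fun ⟨h, u, v, k⟩ => ⟨h, v, u, fun r hr => (k r hr).symm⟩

theorem SetHolds.lor {x : ℕ} {y z : Fin 8 → P} {S u : ℕ} (h : SetHolds x y z S)
    (hu : Dependent y z fun r => u.testBit r = true) :
    SetHolds x y z (Nat.lor S (Nat.shiftLeft 1 (Nat.xor x u))) := by
  intro v hv
  rw [testBit_lor, testBit_bit, Bool.or_eq_true, decide_eq_true_eq] at hv
  rcases hv with hv | rfl
  · exact h v hv
  · have : Nat.xor x u ^^^ x = u := by
      change (x ^^^ u) ^^^ x = u
      rw [Nat.xor_comm x u, Nat.xor_assoc, Nat.xor_self, Nat.xor_zero]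
    rwa [this]

theorem addRow_spec {x m S : ℕ} {y z : Fin 8 → P} (h : SetHolds x y z S)
    (hm : ∀ s : Fin 8, Dependent y z fun r => m.testBit r = true ∨ r = s) :
    SetHolds x y z (addRow x m S) := by
  have key : ∀ l : List ℕ, (∀ r ∈ l, r < 8) → SetHolds x y z
      (List.rec S (fun r _ ih => branch (hit m r) ih
        (Nat.lor ih (Nat.shiftLeft 1 (Nat.xor x (Nat.lor m (Nat.shiftLeft 1 r)))))) l) := by
    intro l hl
    induction l with
    | nil => exact h
    | cons r l ih =>
      have ih := ih fun r hr => hl r (by simp [hr])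
      simp only [branch_eq] at ih ⊢
      split_ifs
      · exact ih
      · refine ih.lor ?_
        have hr : r < 8 := hl r (by simp)
        convert hm ⟨r, hr⟩ using 2 with s
        rw [testBit_lor, testBit_bit, Bool.or_eq_true, decide_eq_true_eq, Fin.ext_iff]
        exact or_congr_right eq_comm
  exact key rows (by decide)

theorem addTwoRows_spec {x m S : ℕ} {y z : Fin 8 → P} (h : SetHolds x y z S)
    (hm : ∀ s t : Fin 8, Dependent y z fun r => m.testBit r = true ∨ r = s ∨ r = t) :
    SetHolds x y z (addTwoRows x m S) := by
  have key : ∀ l : List ℕ, (∀ r ∈ l, r < 8) → SetHolds x y z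
      (List.rec S (fun r _ ih => branch (hit m r) ih
        (addRow x (Nat.lor m (Nat.shiftLeft 1 r)) ih)) l) := by
    intro l hl
    induction l with
    | nil => exact h
    | cons r l ih =>
      have ih := ih fun r hr => hl r (by simp [hr])
      simp only [branch_eq] at ih ⊢
      split_ifs
      · exact ih
      · refine addRow_spec ih fun s => ?_
        have hr : r < 8 := hl r (by simp)
        convert hm ⟨r, hr⟩ s using 2 with t
        rw [testBit_lor, testBit_bit, Bool.or_eq_true, decide_eq_true_eq, or_assoc,
          Fin.ext_iff (b := ⟨r, hr⟩), eq_comm (a := r)]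
  exact key rows (by decide)

theorem dependent_class_or {y z : Fin 8 → P} {a b : ℕ} (ha : IsClass y a) (hb : IsClass z b) :
    Dependent y z fun r => a.testBit r = true ∨ b.testBit r = true := by
  obtain ⟨u, hu⟩ := ha
  obtain ⟨v, hv⟩ := hb
  exact Or.inl ⟨u, v, fun r => Or.imp (hu r) (hv r)⟩

theorem dependent_class_row {y z : Fin 8 → P} {a : ℕ} (ha : IsClass y a) (s : Fin 8) :
    Dependent y z fun r => a.testBit r = true ∨ r = s := by
  obtain ⟨u, hu⟩ := ha
  exact Or.inl ⟨u, z s, fun r => Or.imp (hu r) fun h => by rw [h]⟩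

theorem not_large5_of_dependent {y z : Fin 8 → P} (hs : Spread y z) {m : ℕ}
    (h : Dependent y z fun r => m.testBit r = true) : large5 m ≠ true := by
  intro hm
  obtain ⟨f, hf⟩ := exists_cover (m := m) (n := 3) (by have := card_of_large5 hm; omega)
  refine hs _ h ⟨f 0, f 1, f 2, fun r => (hf r).imp_right fun ⟨i, hi⟩ => ?_⟩
  fin_cases i <;> simp [hi]

theorem not_large4_of_isClass {y z : Fin 8 → P} (hs : Spread y z) {m : ℕ} (h : IsClass y m) :
    large4 m ≠ true := by
  intro hm
  obtain ⟨f, hf⟩ := exists_cover (m := m) (n := 4) (by have := card_of_large4 hm; omega)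
  refine hs _ (dependent_class_row h (f 0)) ⟨f 1, f 2, f 3, fun r => ?_⟩
  rcases hf r with h | ⟨i, hi⟩
  · exact Or.inl (Or.inl h)
  · fin_cases i <;> simp [hi]

theorem rowsOf_lor (a b : ℕ) : rowsOf (Nat.lor a b) = rowsOf a ∪ rowsOf b := by
  ext r; simp [rowsOf]

theorem exists_row {m : ℕ} (h : 2 ≤ (rowsOf m).card) : ∃ r : Fin 8, m.testBit r = true := by
  obtain ⟨r, hr⟩ := Finset.card_pos.1 (show 0 < (rowsOf m).card by omega)
  exact ⟨r, by simpa [rowsOf] using hr⟩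

/-- Two sets `d`, `e` of rows with repeated pairs of rays cannot have three rows in their union: if
they meet, the union carries one pair of rays, so that it is dependent together with any two
further rows; otherwise it has four rows with two pairs of rays, and is dependent together with any
further row. Both make a dependent set of five rows. -/
theorem not_large3_of_dup {y z : Fin 8 → P} (hs : Spread y z) {d e : ℕ}
    (hd : 2 ≤ (rowsOf d).card) (he : 2 ≤ (rowsOf e).card)
    (hdv : ∃ u v, ∀ r : Fin 8, d.testBit r = true → y r = u ∧ z r = v)
    (hev : ∃ u v, ∀ r : Fin 8, e.testBit r = true → y r = u ∧ z r = v) :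
    large3 (Nat.lor d e) ≠ true := by
  intro hm
  obtain ⟨u, v, hdv⟩ := hdv
  obtain ⟨u', v', hev⟩ := hev
  obtain ⟨i, hi⟩ := exists_row hd
  obtain ⟨j, hj⟩ := exists_row he
  by_cases hc : ∃ r : Fin 8, d.testBit r = true ∧ e.testBit r = true
  · obtain ⟨r, hr, hr'⟩ := hc
    obtain ⟨f, hf⟩ := exists_cover (m := Nat.lor d e) (n := 5)
      (by have := card_of_large3 hm; omega)
    refine hs (fun r => (Nat.lor d e).testBit r = true ∨ r = f 0 ∨ r = f 1)
      (Or.inr ⟨i, f 0, f 1, fun s hs => ?_⟩) ⟨f 2, f 3, f 4, fun r => ?_⟩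
    · rcases hs with hs | rfl | rfl
      · refine ⟨i, Or.inl rfl, ?_⟩
        rw [testBit_lor, Bool.or_eq_true] at hs
        rcases hs with hs | hs
        · rw [(hdv s hs).1, (hdv s hs).2, (hdv i hi).1, (hdv i hi).2]; simp
        · rw [(hev s hs).1, (hev s hs).2, (hdv i hi).1, (hdv i hi).2, ← (hdv r hr).1,
            ← (hdv r hr).2, (hev r hr').1, (hev r hr').2]; simp
      · exact ⟨_, Or.inr (Or.inl rfl), rfl, rfl⟩
      · exact ⟨_, Or.inr (Or.inr rfl), rfl, rfl⟩
    · rcases hf r with h | ⟨i, hi⟩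
      · exact Or.inl (Or.inl h)
      · fin_cases i <;> simp [hi]
  · have hcard : 4 ≤ (rowsOf (Nat.lor d e)).card := by
      rw [rowsOf_lor, Finset.card_union_of_disjoint]
      · omega
      · rw [Finset.disjoint_left]
        intro r hr hr'
        exact hc ⟨r, by simpa [rowsOf] using hr, by simpa [rowsOf] using hr'⟩
    obtain ⟨f, hf⟩ := exists_cover (m := Nat.lor d e) (n := 4) (by omega)
    refine hs (fun r => (Nat.lor d e).testBit r = true ∨ r = f 0)
      (Or.inr ⟨i, j, f 0, fun s hs => ?_⟩) ⟨f 1, f 2, f 3, fun r => ?_⟩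
    · rcases hs with hs | rfl
      · rw [testBit_lor, Bool.or_eq_true] at hs
        rcases hs with hs | hs
        · exact ⟨i, Or.inl rfl, by rw [(hdv s hs).1, (hdv i hi).1],
            by rw [(hdv s hs).2, (hdv i hi).2]⟩
        · exact ⟨j, Or.inr (Or.inl rfl), by rw [(hev s hs).1, (hev j hj).1],
            by rw [(hev s hs).2, (hev j hj).2]⟩
      · exact ⟨_, Or.inr (Or.inr rfl), rfl, rfl⟩
    · rcases hf r with h | ⟨i, hi⟩
      · exact Or.inl (Or.inl h)
      · fin_cases i <;> simp [hi]

theorem addUnion_spec {x a b S D : ℕ} {y z : Fin 8 → P} (hs : Spread y z) (ha : IsClass y a)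
    (hb : IsClass z b) (hS : SetHolds x y z S) (hD : DupHolds y z D) {k : ℕ → ℕ → Bool}
    (h : addUnion x a b S D k = true) :
    ∃ S' D', SetHolds x y z S' ∧ DupHolds y z D' ∧ k S' D' = true := by
  simp only [addUnion, branch_eq, force_eq, orElse_eq, andAlso_eq, negate_eq, isZero_eq] at h
  have hab : Dependent y z fun r => (Nat.lor a b).testBit r = true := by
    simpa only [testBit_lor, Bool.or_eq_true] using dependent_class_or ha hb
  by_cases h2 : large2 b = true
  swap
  · rw [if_neg h2] at h
    exact ⟨S, D, hS, hD, h⟩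
  rw [if_pos h2, Bool.or_eq_true] at h
  have h := h.resolve_left (not_large5_of_dependent hs hab)
  have hS' : SetHolds x y z (if large4 (Nat.lor a b) = true then
      Nat.lor S (Nat.shiftLeft 1 (Nat.xor x (Nat.lor a b))) else S) := by
    split_ifs
    · exact hS.lor hab
    · exact hS
  revert h hS'
  generalize (if large4 (Nat.lor a b) = true then
      Nat.lor S (Nat.shiftLeft 1 (Nat.xor x (Nat.lor a b))) else S) = S'
  intro h hS'
  by_cases hd : large2 (Nat.land a b) = true
  swap
  · rw [if_neg hd] at h
    exact ⟨S', D, hS', hD, h⟩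
  rw [if_pos hd, Bool.or_eq_true, Bool.and_eq_true] at h
  have hdc := card_of_large2 hd
  obtain ⟨u, hu⟩ := ha
  obtain ⟨v, hv⟩ := hb
  have hdv : ∀ r : Fin 8, (Nat.land a b).testBit r = true → y r = u ∧ z r = v := by
    intro r hr
    rw [testBit_land, Bool.and_eq_true] at hr
    exact ⟨hu r hr.1, hv r hr.2⟩
  rcases h with ⟨h1, h3⟩ | h
  · rcases hD with hD | ⟨hDc, hDv⟩
    · simp [hD] at h1
    · exact absurd h3 (not_large3_of_dup hs hDc hdc hDv ⟨u, v, hdv⟩)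
  · refine ⟨_, _, addTwoRows_spec hS' fun s t => ?_, Or.inr ⟨hdc, u, v, hdv⟩, h⟩
    obtain ⟨i, hi⟩ := exists_row hdc
    refine Or.inr ⟨i, s, t, fun r hr => ?_⟩
    rcases hr with hr | rfl | rfl
    · exact ⟨i, Or.inl rfl, by rw [(hdv r hr).1, (hdv i hi).1], by rw [(hdv r hr).2, (hdv i hi).2]⟩
    · exact ⟨_, Or.inr (Or.inl rfl), rfl, rfl⟩
    · exact ⟨_, Or.inr (Or.inr rfl), rfl, rfl⟩

theorem addUnions_spec {x a S D : ℕ} {y z : Fin 8 → P} (hs : Spread y z) (ha : IsClass y a)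
    {col : Column} (hc : ColumnHolds ν z col) (hS : SetHolds x y z S) (hD : DupHolds y z D)
    {k : ℕ → ℕ → Bool} (h : addUnions x a col S D k = true) :
    ∃ S' D', SetHolds x y z S' ∧ DupHolds y z D' ∧ k S' D' = true := by
  induction col generalizing S D with
  | nil => exact ⟨S, D, hS, hD, h⟩
  | cons b l ih =>
    have hb := hc b (by simp)
    obtain ⟨S₁, D₁, hS₁, hD₁, h₁⟩ := addUnion_spec hs ha hb.left hS hD h
    obtain ⟨S₂, D₂, hS₂, hD₂, h₂⟩ := addUnion_spec hs ha hb.right hS₁ hD₁ h₁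
    exact ih (fun c hc' => hc c (by simp [hc'])) hS₂ hD₂ h₂

theorem addClass_spec {x a S D : ℕ} {y z : Fin 8 → P} (hs : Spread y z) (ha : IsClass y a)
    {col : Column} (hc : ColumnHolds ν z col) (hS : SetHolds x y z S) (hD : DupHolds y z D)
    {k : ℕ → ℕ → Bool} (h : addClass x a col S D k = true) :
    ∃ S' D', SetHolds x y z S' ∧ DupHolds y z D' ∧ k S' D' = true := by
  simp only [addClass, branch_eq, force_eq, orElse_eq] at h
  split_ifs at h with h2 h3
  · rw [Bool.or_eq_true] at h
    exact addUnions_spec hs ha hc (addRow_spec hS (dependent_class_row ha)) hD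
      (h.resolve_left (not_large4_of_isClass hs ha))
  · rw [Bool.or_eq_true] at h
    exact addUnions_spec hs ha hc hS hD (h.resolve_left (not_large4_of_isClass hs ha))
  · exact ⟨S, D, hS, hD, h⟩

/-- No row is orthogonal to three other rows in the column `y`. -/
def Uncrowded (ν : P → P) (y : Fin 8 → P) : Prop :=
  ∀ j a b c : Fin 8, a ≠ b → a ≠ c → b ≠ c → y j = ν (y a) → y j = ν (y b) → y j ≠ ν (y c)

theorem Uncrowded.not_large3 {y : Fin 8 → P} (h : Uncrowded ν y) {m : ℕ} {j : Fin 8}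
    (hm : ∀ r : Fin 8, m.testBit r = true → y j = ν (y r)) : large3 m ≠ true := by
  intro h3
  obtain ⟨a, b, c, ha, hb, hc, hab, hac, hbc⟩ := Finset.two_lt_card_iff.1 (card_of_large3 h3)
  simp only [rowsOf, Finset.mem_filter, Finset.mem_univ, true_and] at ha hb hc
  exact h j a b c hab hac hbc (hm a ha) (hm b hb) (hm c hc)

/-- The sets `p` and `n` are nonempty whenever `deg` is set, so that three rows on one side would
crowd a row on the other side. -/
theorem addBasis_spec (hν : Function.Involutive ν) {deg : Bool} {x p n S D T : ℕ}
    {y z y' z' : Fin 8 → P} (hs : Spread y z)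
    {w : ℕ} (hx : ∀ v, Dependent y z (fun r => (v ^^^ x).testBit r = true) →
      ¬ Dependent y' z' fun r => (v ^^^ w).testBit r = true) (hp : IsBasis ν y p n)
    (hdeg : deg = true → Uncrowded ν y ∧ (∃ i : Fin 8, p.testBit i = true) ∧
      ∃ j : Fin 8, n.testBit j = true)
    {col : Column} (hc : ColumnHolds ν z col) (hS : SetHolds x y z S) (hD : DupHolds y z D)
    (hT : SetHolds w y' z' T)
    {k : ℕ → ℕ → Bool} (h : addBasis deg x p n col S D T k = true) :
    ∃ S' D', SetHolds x y z S' ∧ DupHolds y z D' ∧ k S' D' = true := by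
  simp only [addBasis, orElse_eq, andAlso_eq, negate_eq, isZero_eq] at h
  rw [Bool.or_eq_true, Bool.and_eq_true, Bool.or_eq_true] at h
  rcases h with ⟨hd, h⟩ | h
  · obtain ⟨hy, ⟨i, hi⟩, j, hj⟩ := hdeg hd
    obtain ⟨u, hu⟩ := hp
    rcases h with h | h
    · exact absurd h (hy.not_large3 (j := j) fun r hr => by rw [(hu j).2 hj, (hu r).1 hr])
    · exact absurd h (hy.not_large3 (j := i) fun r hr => by
        rw [(hu i).1 hi, (hu r).2 hr, hν u])
  · obtain ⟨S₁, D₁, hS₁, hD₁, h₁⟩ := addClass_spec hs hp.left hc hS hD h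
    obtain ⟨S₂, D₂, hS₂, hD₂, h₂⟩ := addClass_spec hs hp.right hc hS₁ hD₁ h₁
    rw [Bool.or_eq_true] at h₂
    refine ⟨S₂, D₂, hS₂, hD₂, h₂.resolve_left fun h0 => ?_⟩
    obtain ⟨v, hv⟩ := Nat.exists_testBit_of_ne_zero (by simpa using h0)
    replace hv := (testBit_land S₂ T v).symm.trans hv
    rw [Bool.and_eq_true] at hv
    exact hx v (hS₂ v hv.1) (hT v hv.2)

/-! ### Soundness of the search -/

/-- The partial knowledge `st` is true for the configuration `x`. -/
structure Partial.Holds (ν : P → P) (x : Fin 4 → Fin 8 → P) (st : Partial) : Prop where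
  c0 : ColumnHolds ν (x 0) st.c0
  c1 : ColumnHolds ν (x 1) st.c1
  c2 : ColumnHolds ν (x 2) st.c2
  c3 : ColumnHolds ν (x 3) st.c3
  s0 : SetHolds 0 (x 0) (x 1) st.s0
  d0 : DupHolds (x 0) (x 1) st.d0
  s1 : SetHolds 255 (x 2) (x 3) st.s1
  d1 : DupHolds (x 2) (x 3) st.d1

theorem testBit_xor_255 (v : ℕ) (r : Fin 8) : (v ^^^ 255).testBit r = !v.testBit r := by
  rw [Nat.testBit_xor]
  have : Nat.testBit 255 r = true := by revert r; decide
  rw [this, Bool.xor_true]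

/-- `IsConfiguration.spanning`, in terms of the masks recorded for the two pairs of columns. -/
theorem IsConfiguration.incompatible {x : Fin 4 → Fin 8 → P} (h : IsConfiguration ν x) (v : ℕ)
    (h0 : Dependent (x 0) (x 1) fun r => (v ^^^ 0).testBit r = true) :
    ¬ Dependent (x 2) (x 3) fun r => (v ^^^ 255).testBit r = true := by
  have := h.spanning _ h0
  simpa only [testBit_xor_255, Nat.xor_zero, Bool.not_eq_true, Bool.not_eq_eq_eq_not, Bool.not_true]
    using this

/-- A true assumption does not lead to a contradiction, so that the search goes on with true
knowledge. -/
theorem attempt_spec (hν : Function.Involutive ν) (hne : ∀ p, ν p ≠ p) {x : Fin 4 → Fin 8 → P}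
    (hx : IsConfiguration ν x) {deg s : Bool}
    (hdeg : deg = true → s = true ∧ ∀ c, Uncrowded ν (x c)) {c : Fin 4} {i j : Fin 8}
    (hy : x c i = twist ν s (x c j)) {st : Partial} (hst : st.Holds ν x) {cont : Partial → Bool}
    (h : attempt deg s c i j st cont = true) :
    ∃ st' : Partial, st'.Holds ν x ∧ cont st' = true := by
  obtain ⟨c0, c1, c2, c3, s0, d0, s1, d1⟩ := st
  obtain ⟨h0, h1, h2, h3, hs0, hd0, hs1, hd1⟩ := hst
  have hstay : (⟨c0, c1, c2, c3, s0, d0, s1, d1⟩ : Partial).Holds ν x :=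
    ⟨h0, h1, h2, h3, hs0, hd0, hs1, hd1⟩
  fin_cases c
  · have h : glue s i j c0 true (cont ⟨c0, c1, c2, c3, s0, d0, s1, d1⟩) (fun p n l =>
        addBasis deg 0 p n c1 s0 d0 s1 fun S D => cont ⟨(p, n) :: l, c1, c2, c3, S, D, s1, d1⟩) =
        true := h
    rcases glue_spec hν hne h0 hy true (cont ⟨c0, c1, c2, c3, s0, d0, s1, d1⟩) (fun p n l =>
        addBasis deg 0 p n c1 s0 d0 s1 fun S D => cont ⟨(p, n) :: l, c1, c2, c3, S, D, s1, d1⟩)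
      with e | ⟨p, n, l, e, hp, hi, hj, hl⟩
    · exact ⟨_, hstay, e.symm.trans h⟩
    · obtain ⟨S, D, hS, hD, hk⟩ := addBasis_spec hν hx.spread_left
        (fun v a b => hx.incompatible v a b) hp
        (fun hd => ⟨(hdeg hd).2 0, ⟨i, hi⟩, j, hj (hdeg hd).1⟩) h1 hs0 hd0 hs1
        (e.symm.trans h)
      exact ⟨⟨(p, n) :: l, c1, c2, c3, S, D, s1, d1⟩,
        ⟨hl.cons hp, h1, h2, h3, hS, hD, hs1, hd1⟩, hk⟩
  · have h : glue s i j c1 true (cont ⟨c0, c1, c2, c3, s0, d0, s1, d1⟩) (fun p n l =>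
        addBasis deg 0 p n c0 s0 d0 s1 fun S D => cont ⟨c0, (p, n) :: l, c2, c3, S, D, s1, d1⟩) =
        true := h
    rcases glue_spec hν hne h1 hy true (cont ⟨c0, c1, c2, c3, s0, d0, s1, d1⟩) (fun p n l =>
        addBasis deg 0 p n c0 s0 d0 s1 fun S D => cont ⟨c0, (p, n) :: l, c2, c3, S, D, s1, d1⟩)
      with e | ⟨p, n, l, e, hp, hi, hj, hl⟩
    · exact ⟨_, hstay, e.symm.trans h⟩
    · obtain ⟨S, D, hS, hD, hk⟩ := addBasis_spec hν hx.spread_left.symm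
        (fun v a b => hx.incompatible v a.symm b) hp
        (fun hd => ⟨(hdeg hd).2 1, ⟨i, hi⟩, j, hj (hdeg hd).1⟩) h0 hs0.symm hd0.symm hs1
        (e.symm.trans h)
      exact ⟨⟨c0, (p, n) :: l, c2, c3, S, D, s1, d1⟩,
        ⟨h0, hl.cons hp, h2, h3, hS.symm, hD.symm, hs1, hd1⟩, hk⟩
  · have h : glue s i j c2 true (cont ⟨c0, c1, c2, c3, s0, d0, s1, d1⟩) (fun p n l =>
        addBasis deg 255 p n c3 s1 d1 s0 fun S D => cont ⟨c0, c1, (p, n) :: l, c3, s0, d0, S, D⟩) =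
        true := h
    rcases glue_spec hν hne h2 hy true (cont ⟨c0, c1, c2, c3, s0, d0, s1, d1⟩) (fun p n l =>
        addBasis deg 255 p n c3 s1 d1 s0 fun S D => cont ⟨c0, c1, (p, n) :: l, c3, s0, d0, S, D⟩)
      with e | ⟨p, n, l, e, hp, hi, hj, hl⟩
    · exact ⟨_, hstay, e.symm.trans h⟩
    · obtain ⟨S, D, hS, hD, hk⟩ := addBasis_spec hν hx.spread_right
        (fun v a b => hx.incompatible v b a) hp
        (fun hd => ⟨(hdeg hd).2 2, ⟨i, hi⟩, j, hj (hdeg hd).1⟩) h3 hs1 hd1 hs0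
        (e.symm.trans h)
      exact ⟨⟨c0, c1, (p, n) :: l, c3, s0, d0, S, D⟩,
        ⟨h0, h1, hl.cons hp, h3, hs0, hd0, hS, hD⟩, hk⟩
  · have h : glue s i j c3 true (cont ⟨c0, c1, c2, c3, s0, d0, s1, d1⟩) (fun p n l =>
        addBasis deg 255 p n c2 s1 d1 s0 fun S D => cont ⟨c0, c1, c2, (p, n) :: l, s0, d0, S, D⟩) =
        true := h
    rcases glue_spec hν hne h3 hy true (cont ⟨c0, c1, c2, c3, s0, d0, s1, d1⟩) (fun p n l =>
        addBasis deg 255 p n c2 s1 d1 s0 fun S D => cont ⟨c0, c1, c2, (p, n) :: l, s0, d0, S, D⟩)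
      with e | ⟨p, n, l, e, hp, hi, hj, hl⟩
    · exact ⟨_, hstay, e.symm.trans h⟩
    · obtain ⟨S, D, hS, hD, hk⟩ := addBasis_spec hν hx.spread_right.symm
        (fun v a b => hx.incompatible v b a.symm) hp
        (fun hd => ⟨(hdeg hd).2 3, ⟨i, hi⟩, j, hj (hdeg hd).1⟩) h2 hs1.symm hd1.symm hs0
        (e.symm.trans h)
      exact ⟨⟨c0, c1, c2, (p, n) :: l, s0, d0, S, D⟩,
        ⟨h0, h1, h2, hl.cons hp, hs0, hd0, hS.symm, hD.symm⟩, hk⟩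

/-- For every configuration, a successful search has a leaf whose knowledge is true for it. -/
theorem search_spec (hν : Function.Involutive ν) (hne : ∀ p, ν p ≠ p) {x : Fin 4 → Fin 8 → P}
    (hx : IsConfiguration ν x) {deg : Bool} (hdeg : deg = true → ∀ c, Uncrowded ν (x c))
    {leaf : Partial → Bool} {es : List (ℕ × ℕ)} (hes : ∀ e ∈ es, e.1 < 8 ∧ e.2 < 8 ∧ e.1 ≠ e.2)
    {st : Partial} (hst : st.Holds ν x) (h : search deg leaf es st = true) :
    ∃ st' : Partial, st'.Holds ν x ∧ leaf st' = true := by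
  induction es generalizing st with
  | nil => exact ⟨st, hst, h⟩
  | cons e es ih =>
    have ih := @ih fun e he => hes e (by simp [he])
    obtain ⟨h1, h2, h3⟩ := hes e (by simp)
    have h : branch (covered st e.1 e.2) (search deg leaf es st)
      (andAlso (attempt deg true 0 e.1 e.2 st (search deg leaf es))
      (andAlso (attempt deg true 1 e.1 e.2 st (search deg leaf es))
      (andAlso (attempt deg true 2 e.1 e.2 st (search deg leaf es))
        (attempt deg true 3 e.1 e.2 st (search deg leaf es))))) = true := h
    simp only [branch_eq, andAlso_eq] at h
    split_ifs at h
    · exact ih hst h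
    · simp only [Bool.and_eq_true] at h
      obtain ⟨c, hc⟩ := hx.orth ⟨e.1, h1⟩ ⟨e.2, h2⟩ (by simpa [Fin.ext_iff] using h3)
      have key : attempt deg true (c : ℕ) e.1 e.2 st (search deg leaf es) = true := by
        fin_cases c
        exacts [h.1, h.2.1, h.2.2.1, h.2.2.2]
      obtain ⟨st', hst', h'⟩ := attempt_spec hν hne hx (deg := deg) (s := true)
        (fun hd => ⟨rfl, hdeg hd⟩) (i := ⟨e.1, h1⟩) (j := ⟨e.2, h2⟩) hc hst key
      exact ih hst' h'

/-- The pairs in the list are orthogonal in columns that weakly increase along the list, from `lo`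
on. -/
inductive Coloured (ν : P → P) (x : Fin 4 → Fin 8 → P) : List (ℕ × ℕ) → ℕ → Prop
  | nil (lo : ℕ) : Coloured ν x [] lo
  | cons {lo : ℕ} {es : List (ℕ × ℕ)} {i j : Fin 8} {c : Fin 4} (h : x c i = ν (x c j))
      (hlo : lo ≤ c) (hes : Coloured ν x es c) : Coloured ν x (((i : ℕ), (j : ℕ)) :: es) lo

theorem chain_spec (hν : Function.Involutive ν) (hne : ∀ p, ν p ≠ p) {x : Fin 4 → Fin 8 → P}
    (hx : IsConfiguration ν x) {deg : Bool} (hdeg : deg = true → ∀ c, Uncrowded ν (x c))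
    {cont : Partial → Bool} {es : List (ℕ × ℕ)} {lo : ℕ} (hes : Coloured ν x es lo)
    {st : Partial} (hst : st.Holds ν x) (h : chain deg cont es lo st = true) :
    ∃ st' : Partial, st'.Holds ν x ∧ cont st' = true := by
  induction hes generalizing st with
  | nil => exact ⟨st, hst, h⟩
  | @cons lo es i j c hc hlo _ ih =>
    have h : (allOf [0, 1, 2, 3] fun c => orElse (negate (Nat.ble lo c))
      (attempt deg true c i j st (chain deg cont es c))) = true := h
    rw [allOf_eq, List.all_eq_true] at h
    have h := h c (by fin_cases c <;> simp)
    have hb : Nat.ble lo c = true := Nat.ble_eq_true_of_le hlo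
    simp only [orElse_eq, negate_eq, hb, Bool.not_true, Bool.false_or] at h
    obtain ⟨st', hst', h'⟩ := attempt_spec hν hne hx (deg := deg) (s := true)
        (fun hd => ⟨rfl, hdeg hd⟩) hc hst h
    exact ih hst' h'

/-! ### Soundness of the leaves -/

/-- The columns `y` satisfy all relations and inequalities of the template. -/
structure Template.Fits (t : Template) (ν : P → P) (y : Fin 4 → Fin 8 → P) : Prop where
  entry : ∀ (c : Fin 4) (r b : Fin 8) (s : Bool), t.label c r = 2 * b + s.toNat →
    y c r = twist ν s (y c b)
  neq : ∀ (c : Fin 4) (r b : Fin 8) (s : Bool), ((c : ℕ), (r : ℕ), (b : ℕ), s) ∈ t.neqs →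
    y c r ≠ twist ν s (y c b)

theorem allIndexed_eq {α : Type} (l : List α) (f : ℕ → α → Bool) (n : ℕ)
    (h : allIndexed l f n = true) (i : ℕ) (hi : i < l.length) : f (n + i) l[i] = true := by
  induction l generalizing n i with
  | nil => simp at hi
  | cons a l ih =>
    have h : andAlso (f n a) (allIndexed l f (Nat.succ n)) = true := h
    rw [andAlso_eq, Bool.and_eq_true] at h
    cases i with
    | zero => exact h.1
    | succ i =>
      simpa [Nat.succ_add, Nat.add_assoc, Nat.add_comm 1] using ih _ h.2 i (by simpa using hi)

theorem nth_eq {α : Type} (d : α) (l : List α) (n : ℕ) : nth d l n = l.getD n d := by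
  induction l generalizing n with
  | nil => rfl
  | cons a l ih =>
    cases n with
    | zero => rfl
    | succ n => exact (show nth d (a :: l) (n + 1) = nth d l n from rfl).trans (by simpa using ih n)

/-- The template has four columns of eight labels, and its inequalities concern existing rows and
columns. -/
def Template.WellFormed (t : Template) : Prop :=
  t.labels.length = 4 ∧ (∀ col ∈ t.labels, col.length = 8) ∧
    ∀ q ∈ t.neqs, q.1 < 4 ∧ q.2.1 < 8 ∧ q.2.2.1 < 8

instance (t : Template) : Decidable t.WellFormed := by unfold Template.WellFormed; infer_instance

theorem template_wellFormed : ∀ i : Fin 7, (template i).WellFormed := by decide +kernel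

theorem fits_spec {st : Partial} {t : Template} (ht : t.WellFormed) {σ τ : ℕ}
    (h : fits st t σ τ = true) (c : Fin 4) (r : Fin 8) :
    t.label c r = 2 * r ∨ linked (oddLabel (t.label c r)) (nibble 8 τ r)
      (nibble 8 τ (t.label c r / 2)) (st.col (nibble 4 σ c)) = true := by
  obtain ⟨h1, h2, -⟩ := ht
  have hc : (c : ℕ) < t.labels.length := by rw [h1]; exact c.2
  have hr : (r : ℕ) < t.labels[(c : ℕ)].length := by
    rw [h2 _ (List.getElem_mem hc)]; exact r.2
  have hl : t.label c r = t.labels[(c : ℕ)][(r : ℕ)] := by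
    simp [Template.label, nth_eq, hc, hr]
  have h := allIndexed_eq _ _ _ (allIndexed_eq _ _ _ h c hc) r hr
  simp only [Nat.zero_add, orElse_eq, Bool.or_eq_true] at h
  rw [hl]
  exact h.imp_left Nat.eq_of_beq_eq_true

theorem oddLabel_two_mul (b : ℕ) (s : Bool) : oddLabel (2 * b + s.toNat) = s := by
  have : Nat.land (2 * b + s.toNat) 1 = s.toNat := by
    refine (Nat.and_one_is_mod _).trans ?_
    cases s <;> simp [Nat.add_mod]
  rw [oddLabel, this]
  cases s <;> rfl

/-- The permutations coded by an element of the list of witnesses. -/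
def ValidWitness (w : ℕ × ℕ × ℕ) (σ : Equiv.Perm (Fin 4)) (τ : Equiv.Perm (Fin 8)) : Prop :=
  w.1 < 7 ∧ RespectsCut σ ∧ (∀ c : Fin 4, nibble 4 w.2.1 c = σ c) ∧
    ∀ r : Fin 8, nibble 8 w.2.2 r = τ r

theorem Partial.Holds.col {x : Fin 4 → Fin 8 → P} {st : Partial} (h : st.Holds ν x) (c : Fin 4) :
    ColumnHolds ν (x c) (st.col c) := by
  obtain ⟨c0, c1, c2, c3, s0, d0, s1, d1⟩ := st
  fin_cases c
  exacts [h.c0, h.c1, h.c2, h.c3]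

/-- By induction on the depth: either all inequalities of the template hold, or the violated one
extends what is known. -/
theorem resolve_spec (hν : Function.Involutive ν) (hne : ∀ p, ν p ≠ p) {x : Fin 4 → Fin 8 → P}
    (hx : IsConfiguration ν x) {W : List (ℕ × ℕ × ℕ)} (hW : ∀ w ∈ W, ∃ σ τ, ValidWitness w σ τ)
    {f : ℕ} {st : Partial} (hst : st.Holds ν x) (h : resolve W f st = true) :
    ∃ (i : Fin 7) (σ : Equiv.Perm (Fin 4)) (τ : Equiv.Perm (Fin 8)), RespectsCut σ ∧
      (template i).Fits ν fun c r => x (σ c) (τ r) := by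
  induction f generalizing st with
  | zero => exact absurd h (by simp [resolve])
  | succ f ih =>
    have h : (anyOf W fun w => andAlso (fits st (template w.1) w.2.1 w.2.2)
      (allOf (template w.1).neqs fun q =>
        andAlso (negate (linked q.2.2.2 (nibble 8 w.2.2 q.2.1) (nibble 8 w.2.2 q.2.2.1)
          (st.col (nibble 4 w.2.1 q.1))))
        (attempt false q.2.2.2 (nibble 4 w.2.1 q.1) (nibble 8 w.2.2 q.2.1)
          (nibble 8 w.2.2 q.2.2.1) st (resolve W f)))) = true := h
    rw [anyOf_eq, List.any_eq_true] at h
    obtain ⟨w, hw, h⟩ := h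
    rw [andAlso_eq, Bool.and_eq_true, allOf_eq, List.all_eq_true] at h
    obtain ⟨hf, hq⟩ := h
    obtain ⟨σ, τ, hw7, hσ, hwσ, hwτ⟩ := hW w hw
    by_cases hn : ∀ (c : Fin 4) (r b : Fin 8) (s : Bool),
        ((c : ℕ), (r : ℕ), (b : ℕ), s) ∈ (template w.1).neqs →
        x (σ c) (τ r) ≠ twist ν s (x (σ c) (τ b))
    · refine ⟨⟨w.1, hw7⟩, σ, τ, hσ, fun c r b s hl => ?_, hn⟩
      rcases fits_spec (template_wellFormed ⟨w.1, hw7⟩) hf c r with h | h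
      · have h1 : 2 * (b : ℕ) + s.toNat = 2 * r := hl.symm.trans h
        cases s with
        | true => simp only [Bool.toNat_true] at h1; omega
        | false =>
          have : b = r := by simp only [Bool.toNat_false] at h1; omega
          simp [twist, this]
      · have h2 : (2 * (b : ℕ) + s.toNat) / 2 = b := by cases s <;> (simp; try omega)
        dsimp only at h hl
        rw [hl, oddLabel_two_mul, h2, hwσ, hwτ, hwτ] at h
        exact linked_sound hν (hst.col _) h
    · push Not at hn
      obtain ⟨c, r, b, s, hm, he⟩ := hn
      have h := hq _ hm
      rw [andAlso_eq, Bool.and_eq_true] at h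
      obtain ⟨-, h⟩ := h
      simp only [hwσ, hwτ] at h
      obtain ⟨st', hst', h'⟩ := attempt_spec hν hne hx (deg := false) (by simp) he hst h
      exact ih hst' h'

/-- Evaluated by the kernel, as is `patternSearch_eq_true`. -/
theorem crowdedSearch_eq_true : crowdedSearch = true := by decide +kernel
theorem patternSearch_eq_true : patternSearch = true := by decide +kernel

instance : DecidablePred RespectsCut := fun σ => by unfold RespectsCut; infer_instance

theorem exists_validWitness {w : ℕ × ℕ × ℕ} (hw : w ∈ witnesses) : ∃ σ τ, ValidWitness w σ τ := by
  have key : ∀ w ∈ witnesses, w.1 < 7 ∧ (∃ σ : Equiv.Perm (Fin 4), RespectsCut σ ∧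
      ∀ c : Fin 4, nibble 4 w.2.1 c = σ c) ∧ (∀ r : Fin 8, nibble 8 w.2.2 r < 8) ∧
      ∀ r s : Fin 8, nibble 8 w.2.2 r = nibble 8 w.2.2 s → r = s := by decide +kernel
  obtain ⟨h7, ⟨σ, hσ, hσw⟩, hlt, hinj⟩ := key w hw
  let f : Fin 8 → Fin 8 := fun r => ⟨nibble 8 w.2.2 r, hlt r⟩
  have hf : Function.Injective f := fun r s h => hinj r s (Fin.ext_iff.1 h)
  exact ⟨σ, Equiv.ofBijective f (Finite.injective_iff_bijective.1 hf), h7, hσ, hσw, fun r => rfl⟩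

/-! ### Symmetries of configurations -/

theorem exists_perm_of_injective {f : Fin 8 → Fin 8} (hf : Function.Injective f) :
    ∃ τ : Equiv.Perm (Fin 8), ∀ r, τ r = f r :=
  ⟨Equiv.ofBijective f (Finite.injective_iff_bijective.1 hf), fun _ => rfl⟩

theorem RespectsCut.mul {σ σ' : Equiv.Perm (Fin 4)} (h : RespectsCut σ) (h' : RespectsCut σ') :
    RespectsCut (σ * σ') := fun k l => (h _ _).trans (h' k l)

theorem RespectsCut.values {σ : Equiv.Perm (Fin 4)} (h : RespectsCut σ) :
    (σ 0 = 0 ∧ σ 1 = 1 ∨ σ 0 = 1 ∧ σ 1 = 0) ∧ (σ 2 = 2 ∧ σ 3 = 3 ∨ σ 2 = 3 ∧ σ 3 = 2) ∨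
    (σ 0 = 2 ∧ σ 1 = 3 ∨ σ 0 = 3 ∧ σ 1 = 2) ∧ (σ 2 = 0 ∧ σ 3 = 1 ∨ σ 2 = 1 ∧ σ 3 = 0) := by
  revert σ; decide +kernel

/-- Dependence is invariant under permutations of the rows. -/
theorem Dependent.comp {y z : Fin 8 → P} {K : Fin 8 → Prop} (τ : Equiv.Perm (Fin 8))
    (h : Dependent (fun r => y (τ r)) (fun r => z (τ r)) K) :
    Dependent y z fun r => K (τ.symm r) := by
  rcases h with ⟨u, v, h⟩ | ⟨a, b, c, h⟩
  · exact Or.inl ⟨u, v, fun r hr => by simpa using h _ hr⟩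
  · refine Or.inr ⟨τ a, τ b, τ c, fun r hr => ?_⟩
    obtain ⟨s, hs, h1, h2⟩ := h _ hr
    exact ⟨τ s, by simpa using hs, by simpa using h1, by simpa using h2⟩

/-- The symmetries of the problem act on configurations; the exchange of `A, B` with `C, D`
replaces a set of rows by its complement. -/
theorem IsConfiguration.comp {x : Fin 4 → Fin 8 → P} (h : IsConfiguration ν x)
    {σ : Equiv.Perm (Fin 4)} (hσ : RespectsCut σ) (τ : Equiv.Perm (Fin 8)) :
    IsConfiguration ν fun c r => x (σ c) (τ r) := by
  refine ⟨fun i j hij => ?_, fun K h0 h1 => ?_⟩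
  · obtain ⟨c, hc⟩ := h.orth (τ i) (τ j) (by simpa using hij)
    exact ⟨σ.symm c, by simpa using hc⟩
  · have h0 := h0.comp τ
    have h1 := h1.comp τ
    have hsp := h.spanning fun r => K (τ.symm r)
    have hsp' := h.spanning fun r => ¬ K (τ.symm r)
    simp only [not_not] at hsp'
    rcases RespectsCut.values (σ := σ) hσ with ⟨h2 | h2, h3 | h3⟩ | ⟨h2 | h2, h3 | h3⟩ <;>
      simp only [h2.1, h2.2, h3.1, h3.2] at h0 h1
    exacts [hsp h0 h1, hsp h0 h1.symm, hsp h0.symm h1, hsp h0.symm h1.symm, hsp' h1 h0,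
      hsp' h1.symm h0, hsp' h1 h0.symm, hsp' h1.symm h0.symm]

theorem orth_symm (hν : Function.Involutive ν) {p q : P} (h : p = ν q) : q = ν p := by
  rw [h, hν q]

/-! ### No row is orthogonal to three others in one column -/

/-- The initial knowledge of `crowdedSearch` is inconsistent, if the rows have been arranged such
that the columns increase. -/
theorem false_of_crowded_sorted (hν : Function.Involutive ν) (hne : ∀ p, ν p ≠ p)
    {x : Fin 4 → Fin 8 → P} (hx : IsConfiguration ν x) (h1 : x 0 0 = ν (x 0 1))
    (h2 : x 0 0 = ν (x 0 2)) (h3 : x 0 0 = ν (x 0 3))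
    (hc : Coloured ν x [(0, 4), (0, 5), (0, 6), (0, 7)] 0)
    (hc' : Coloured ν x [(1, 2), (1, 3), (2, 3)] 0) : False := by
  have hb : IsBasis ν (x 0) 1 14 := by
    refine ⟨x 0 0, fun r => ?_⟩
    fin_cases r <;> simp [Nat.testBit, orth_symm hν h1, orth_symm hν h2, orth_symm hν h3]
  have hst : crowdedStart.Holds ν x := by
    refine ⟨?_, ?_, ?_, ?_, ?_, Or.inl rfl, ?_, Or.inl rfl⟩
    · exact ColumnHolds.cons (by simp [ColumnHolds]) hb
    · simp [crowdedStart, ColumnHolds]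
    · simp [crowdedStart, ColumnHolds]
    · simp [crowdedStart, ColumnHolds]
    · exact addRow_spec (fun v hv => by simp at hv) (dependent_class_row hb.right)
    · intro v hv
      simp [crowdedStart] at hv
  obtain ⟨st, hst, h⟩ := chain_spec hν hne hx (by simp) hc hst crowdedSearch_eq_true
  obtain ⟨st, hst, h⟩ := chain_spec hν hne hx (by simp) hc' hst h
  obtain ⟨st, hst, h⟩ := search_spec hν hne hx (by simp) (by decide) hst h
  exact Bool.false_ne_true h

/-- The rows `4, …, 7` are sorted by the column in which they are orthogonal to row `0`, and the
rows `1, 2, 3` by the columns of the opposite pairs of the triangle formed by them. -/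
theorem false_of_crowded (hν : Function.Involutive ν) (hne : ∀ p, ν p ≠ p)
    {x : Fin 4 → Fin 8 → P} (hx : IsConfiguration ν x) (h1 : x 0 0 = ν (x 0 1))
    (h2 : x 0 0 = ν (x 0 2)) (h3 : x 0 0 = ν (x 0 3)) : False := by
  have he : ∀ i : Fin 3, ∃ e : Fin 4, ∀ u v : Fin 3, u ≠ v → u ≠ i → v ≠ i →
      x e (u.succ.castLE (by norm_num)) = ν (x e (v.succ.castLE (by norm_num))) := by
    intro i
    obtain ⟨e, he⟩ := hx.orth ((i + 1).succ.castLE (by norm_num))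
      ((i + 2).succ.castLE (by norm_num)) (by revert i; decide)
    have he' := orth_symm hν he
    refine ⟨e, fun u v h1 h2 h3 => ?_⟩
    have : u = i + 1 ∧ v = i + 2 ∨ u = i + 2 ∧ v = i + 1 := by
      have : ∀ i u v : Fin 3, u ≠ v → u ≠ i → v ≠ i →
        u = i + 1 ∧ v = i + 2 ∨ u = i + 2 ∧ v = i + 1 := by decide
      exact this i u v h1 h2 h3
    rcases this with ⟨rfl, rfl⟩ | ⟨rfl, rfl⟩
    exacts [he, he']
  choose e he using he
  have hk : ∀ m : Fin 4, ∃ k : Fin 4, x k 0 = ν (x k (m.natAdd 4)) := fun m =>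
    hx.orth 0 (m.natAdd 4) (by revert m; decide)
  choose k hk using hk
  have key : ∀ (s : Equiv.Perm (Fin 3)) (t : Equiv.Perm (Fin 4)), Function.Injective
      (![0, (s 2).succ.castLE (by norm_num), (s 1).succ.castLE (by norm_num),
        (s 0).succ.castLE (by norm_num), (t 0).natAdd 4, (t 1).natAdd 4, (t 2).natAdd 4,
        (t 3).natAdd 4] : Fin 8 → Fin 8) := by decide +kernel
  obtain ⟨τ, hτ⟩ := exists_perm_of_injective (key (Tuple.sort e) (Tuple.sort k))
  have hx' := hx.comp (σ := 1) (fun k l => Iff.rfl) τ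
  have hs := Tuple.monotone_sort e
  have ht := Tuple.monotone_sort k
  generalize Tuple.sort e = s at hτ hs
  generalize Tuple.sort k = t at hτ ht
  have hA : ∀ u : Fin 3, x 0 0 = ν (x 0 (u.succ.castLE (by norm_num))) := by
    intro u; fin_cases u
    exacts [h1, h2, h3]
  have hinj : ∀ a b : Fin 3, a ≠ b → s a ≠ s b := fun a b h => by simpa using h
  refine false_of_crowded_sorted hν hne hx' ?_ ?_ ?_ ?_ ?_
  · simpa [hτ] using hA _
  · simpa [hτ] using hA _
  · simpa [hτ] using hA _
  · refine .cons (i := 0) (j := 4) (c := k (t 0)) ?_ (Nat.zero_le _) <|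
      .cons (i := 0) (j := 5) (c := k (t 1)) ?_ (ht (by decide)) <|
      .cons (i := 0) (j := 6) (c := k (t 2)) ?_ (ht (by decide)) <|
      .cons (i := 0) (j := 7) (c := k (t 3)) ?_ (ht (by decide)) (.nil _)
    all_goals simpa [hτ] using hk _
  · refine .cons (i := 1) (j := 2) (c := e (s 0)) ?_ (Nat.zero_le _) <|
      .cons (i := 1) (j := 3) (c := e (s 1)) ?_ (hs (by decide)) <|
      .cons (i := 2) (j := 3) (c := e (s 2)) ?_ (hs (by decide)) (.nil _)
    · simpa [hτ] using he (s 0) (s 2) (s 1) (hinj _ _ (by decide)) (hinj _ _ (by decide))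
        (hinj _ _ (by decide))
    · simpa [hτ] using he (s 1) (s 2) (s 0) (hinj _ _ (by decide)) (hinj _ _ (by decide))
        (hinj _ _ (by decide))
    · simpa [hτ] using he (s 2) (s 1) (s 0) (hinj _ _ (by decide)) (hinj _ _ (by decide))
        (hinj _ _ (by decide))

/-- No row of a configuration is orthogonal to three others in one column: the column may be taken
as the first one, and the four rows as the first four. -/
theorem IsConfiguration.uncrowded (hν : Function.Involutive ν) (hne : ∀ p, ν p ≠ p)
    {x : Fin 4 → Fin 8 → P} (hx : IsConfiguration ν x) (d : Fin 4) : Uncrowded ν (x d) := by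
  intro j a b c hab hac hbc ha hb hc
  have hj : ∀ r, x d j = ν (x d r) → j ≠ r := by
    rintro r h rfl
    exact hne _ h.symm
  have hd : ∀ d : Fin 4, ∃ σ : Equiv.Perm (Fin 4), RespectsCut σ ∧ σ 0 = d := by decide +kernel
  obtain ⟨σ, hσ, h0⟩ := hd d
  have hinj : Set.InjOn (![j, a, b, c, 0, 0, 0, 0] : Fin 8 → Fin 8)
      (({0, 1, 2, 3} : Finset (Fin 8)) : Set (Fin 8)) := by
    have h1 := hj a ha
    have h2 := hj b hb
    have h3 := hj c hc
    intro p hp q hq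
    simp only [Finset.coe_insert, Finset.coe_singleton, Set.mem_insert_iff,
      Set.mem_singleton_iff] at hp hq
    rcases hp with rfl | rfl | rfl | rfl <;> rcases hq with rfl | rfl | rfl | rfl <;>
      simp [h1, h2, h3, h1.symm, h2.symm, h3.symm, hab, hac, hbc, hab.symm, hac.symm, hbc.symm]
  obtain ⟨g, hg⟩ := Finset.exists_equiv_extend_of_card_eq (t := (Finset.univ : Finset (Fin 8)))
    (by simp) (Finset.subset_univ _) hinj
  have hgi : Function.Injective fun i => (g i : Fin 8) :=
    Subtype.val_injective.comp g.injective
  obtain ⟨τ, hτ⟩ := exists_perm_of_injective hgi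
  have e0 := (hτ 0).trans (hg 0 (by simp))
  have e1 := (hτ 1).trans (hg 1 (by simp))
  have e2 := (hτ 2).trans (hg 2 (by simp))
  have e3 := (hτ 3).trans (hg 3 (by simp))
  simp at e0 e1 e2 e3
  refine false_of_crowded hν hne (hx.comp hσ τ) ?_ ?_ ?_
  · simpa [h0, e0, e1] using ha
  · simpa [h0, e0, e2] using hb
  · simpa [h0, e0, e3] using hc

/-! ### Every configuration fits a template -/

/-- Up to a permutation of the rows and an admissible permutation of the columns, `x` fits one of
the templates. -/
def Matches (ν : P → P) (x : Fin 4 → Fin 8 → P) : Prop :=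
  ∃ (i : Fin 7) (σ : Equiv.Perm (Fin 4)) (τ : Equiv.Perm (Fin 8)), RespectsCut σ ∧
    (template i).Fits ν fun c r => x (σ c) (τ r)

theorem Matches.of_comp {x : Fin 4 → Fin 8 → P} {σ : Equiv.Perm (Fin 4)} (hσ : RespectsCut σ)
    (τ : Equiv.Perm (Fin 8)) (h : Matches ν fun c r => x (σ c) (τ r)) : Matches ν x := by
  obtain ⟨i, σ', τ', hσ', h⟩ := h
  exact ⟨i, σ * σ', τ * τ', RespectsCut.mul hσ hσ', h⟩

theorem matches_of_search (hν : Function.Involutive ν) (hne : ∀ p, ν p ≠ p)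
    {x : Fin 4 → Fin 8 → P} (hx : IsConfiguration ν x) {W : List (ℕ × ℕ × ℕ)}
    (hW : ∀ w ∈ W, ∃ σ τ, ValidWitness w σ τ) {f : ℕ} {es es₁ es₂ es₃ : List (ℕ × ℕ)}
    (hes : ∀ e ∈ es, e.1 < 8 ∧ e.2 < 8 ∧ e.1 ≠ e.2) (h1 : Coloured ν x es₁ 0)
    (h2 : Coloured ν x es₂ 0) (h3 : Coloured ν x es₃ 0) {st : Partial} (hst : st.Holds ν x)
    (h : chain true (chain true (chain true (search true (resolve W f) es) es₃ 0) es₂ 0) es₁ 0 st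
      = true) : Matches ν x := by
  have hu : true = true → ∀ c, Uncrowded ν (x c) := fun _ => hx.uncrowded hν hne
  obtain ⟨st, hst, h⟩ := chain_spec hν hne hx hu h1 hst h
  obtain ⟨st, hst, h⟩ := chain_spec hν hne hx hu h2 hst h
  obtain ⟨st, hst, h⟩ := chain_spec hν hne hx hu h3 hst h
  obtain ⟨st, hst, h⟩ := search_spec hν hne hx hu hes hst h
  exact resolve_spec hν hne hx hW hst h

theorem patternEdges_valid : ∀ e ∈ patternEdges, e.1 < 8 ∧ e.2 < 8 ∧ e.1 ≠ e.2 := by decide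

/-- The initial knowledge of `patternSearch` leads to a template, if the rows have been arranged
such that the columns increase. -/
theorem matches_of_sorted (hν : Function.Involutive ν) (hne : ∀ p, ν p ≠ p)
    {x : Fin 4 → Fin 8 → P} (hx : IsConfiguration ν x)
    (h : ∀ m : Fin 7, x (![0, 0, 1, 1, 2, 2, 3] m) 0 = ν (x (![0, 0, 1, 1, 2, 2, 3] m) m.succ))
    (h1 : Coloured ν x [(7, 1), (7, 2)] 0) (h2 : Coloured ν x [(7, 3), (7, 4)] 0)
    (h3 : Coloured ν x [(7, 5), (7, 6)] 0) : Matches ν x := by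
  have hb : ∀ c : Fin 4, IsBasis ν (x c) 1 ((![6, 24, 96, 128] : Fin 4 → ℕ) c) := by
    intro c
    refine ⟨x c 0, fun r => ?_⟩
    have h0 := orth_symm hν (h 0)
    have h1 := orth_symm hν (h 1)
    have h2 := orth_symm hν (h 2)
    have h3 := orth_symm hν (h 3)
    have h4 := orth_symm hν (h 4)
    have h5 := orth_symm hν (h 5)
    have h6 := orth_symm hν (h 6)
    simp at h0 h1 h2 h3 h4 h5 h6
    fin_cases c <;> fin_cases r <;>
      simp [Nat.testBit, h0, h1, h2, h3, h4, h5, h6]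
  have hst : patternStart.Holds ν x := by
    refine ⟨?_, ?_, ?_, ?_, ?_, Or.inl rfl, ?_, Or.inl rfl⟩
    · exact ColumnHolds.cons (by simp [ColumnHolds]) (hb 0)
    · exact ColumnHolds.cons (by simp [ColumnHolds]) (hb 1)
    · exact ColumnHolds.cons (by simp [ColumnHolds]) (hb 2)
    · exact ColumnHolds.cons (by simp [ColumnHolds]) (hb 3)
    · intro v hv
      simp [patternStart] at hv
    · intro v hv
      simp [patternStart] at hv
  have h0 := patternSearch_eq_true
  unfold patternSearch at h0
  exact matches_of_search hν hne hx (fun w hw => exists_validWitness hw) patternEdges_valid h1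
    h2 h3 hst h0

/-- Two rows can be ordered by the columns in which they are orthogonal to row `7`. -/
theorem exists_coloured_pair {x : Fin 4 → Fin 8 → P} (hx : IsConfiguration ν x) {a b : Fin 8}
    (ha : 7 ≠ a) (hb : 7 ≠ b) : ∃ a' b', (a' = a ∧ b' = b ∨ a' = b ∧ b' = a) ∧
      ∃ c d : Fin 4, c ≤ d ∧ x c 7 = ν (x c a') ∧ x d 7 = ν (x d b') := by
  obtain ⟨c, hc⟩ := hx.orth _ _ ha
  obtain ⟨d, hd⟩ := hx.orth _ _ hb
  rcases le_total c d with h | h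
  · exact ⟨a, b, Or.inl ⟨rfl, rfl⟩, c, d, h, hc, hd⟩
  · exact ⟨b, a, Or.inr ⟨rfl, rfl⟩, d, c, h, hd, hc⟩

/-- Within each of the pairs `1, 2` and `3, 4` and `5, 6`, the rows are sorted by the column in
which they are orthogonal to row `7`. -/
theorem matches_of_canonical (hν : Function.Involutive ν) (hne : ∀ p, ν p ≠ p)
    {x : Fin 4 → Fin 8 → P} (hx : IsConfiguration ν x)
    (h : ∀ m : Fin 7, x (![0, 0, 1, 1, 2, 2, 3] m) 0 =
      ν (x (![0, 0, 1, 1, 2, 2, 3] m) m.succ)) : Matches ν x := by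
  obtain ⟨a, a', ha, ca, da, hca, hca1, hca2⟩ :=
    exists_coloured_pair hx (a := 1) (b := 2) (by decide) (by decide)
  obtain ⟨b, b', hb, cb, db, hcb, hcb1, hcb2⟩ :=
    exists_coloured_pair hx (a := 3) (b := 4) (by decide) (by decide)
  obtain ⟨c, c', hc, cc, dc, hcc, hcc1, hcc2⟩ :=
    exists_coloured_pair hx (a := 5) (b := 6) (by decide) (by decide)
  have hinj : Function.Injective (![0, a, a', b, b', c, c', 7] : Fin 8 → Fin 8) := by
    rcases ha with ⟨rfl, rfl⟩ | ⟨rfl, rfl⟩ <;> rcases hb with ⟨rfl, rfl⟩ | ⟨rfl, rfl⟩ <;>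
      rcases hc with ⟨rfl, rfl⟩ | ⟨rfl, rfl⟩ <;> decide
  obtain ⟨τ, hτ⟩ := exists_perm_of_injective hinj
  have h1 : RespectsCut 1 := fun _ _ => Iff.rfl
  refine Matches.of_comp h1 τ
    (matches_of_sorted hν hne (hx.comp h1 τ) (fun m => ?_) ?_ ?_ ?_)
  · have h0 := h 0
    have h1 := h 1
    have h2 := h 2
    have h3 := h 3
    have h4 := h 4
    have h5 := h 5
    have h6 := h 6
    simp at h0 h1 h2 h3 h4 h5 h6
    simp only [hτ, Equiv.Perm.coe_one, id]
    fin_cases m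
    · rcases ha with ⟨rfl, rfl⟩ | ⟨rfl, rfl⟩ <;> assumption
    · rcases ha with ⟨rfl, rfl⟩ | ⟨rfl, rfl⟩ <;> assumption
    · rcases hb with ⟨rfl, rfl⟩ | ⟨rfl, rfl⟩ <;> assumption
    · rcases hb with ⟨rfl, rfl⟩ | ⟨rfl, rfl⟩ <;> assumption
    · rcases hc with ⟨rfl, rfl⟩ | ⟨rfl, rfl⟩ <;> assumption
    · rcases hc with ⟨rfl, rfl⟩ | ⟨rfl, rfl⟩ <;> assumption
    · assumption
  · refine .cons (i := 7) (j := 1) (c := ca) ?_ (Nat.zero_le _)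
      (.cons (i := 7) (j := 2) (c := da) ?_ hca (.nil _)) <;> simpa [hτ]
  · refine .cons (i := 7) (j := 3) (c := cb) ?_ (Nat.zero_le _)
      (.cons (i := 7) (j := 4) (c := db) ?_ hcb (.nil _)) <;> simpa [hτ]
  · refine .cons (i := 7) (j := 5) (c := cc) ?_ (Nat.zero_le _)
      (.cons (i := 7) (j := 6) (c := dc) ?_ hcc (.nil _)) <;> simpa [hτ]

/-- Row `0` is orthogonal to at most two of the seven other rows in each column, so that, sorted by
the column, these rows have the pattern `0, 0, 1, 1, 2, 2, 3` up to the order of the columns; this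
order is restored by a permutation that respects the cut. -/
theorem IsConfiguration.matches (hν : Function.Involutive ν) (hne : ∀ p, ν p ≠ p)
    {x : Fin 4 → Fin 8 → P} (hx : IsConfiguration ν x) : Matches ν x := by
  have hk : ∀ m : Fin 7, ∃ k : Fin 4, x k 0 = ν (x k m.succ) := fun m =>
    hx.orth 0 m.succ (Fin.succ_ne_zero m).symm
  choose κ hκ using hk
  have hmono := Tuple.monotone_sort κ
  generalize Tuple.sort κ = s at hmono
  have hle : ∀ a b : Fin 7, a ≤ b → ((κ (s a) : Fin 4) : ℕ) ≤ κ (s b) := fun a b h => hmono h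
  have hlt : ∀ a b c : Fin 7, a < b → b < c → ((κ (s a) : Fin 4) : ℕ) < κ (s c) := by
    intro a b c hab hbc
    refine lt_of_le_of_ne (hmono (hab.trans hbc).le) fun h => ?_
    have h1 : κ (s a) = κ (s c) := Fin.ext h
    have h2 : κ (s a) = κ (s b) :=
      le_antisymm (hmono hab.le) ((hmono hbc.le).trans h1.symm.le)
    have ne : ∀ {u v : Fin 7}, u < v → (s u).succ ≠ (s v).succ := fun huv h =>
      huv.ne (s.injective (Fin.succ_injective _ h))
    refine hx.uncrowded hν hne (κ (s a)) 0 (s a).succ (s b).succ (s c).succ (ne hab)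
      (ne (hab.trans hbc)) (ne hbc) (hκ _) ?_ ?_
    · rw [h2]; exact hκ _
    · rw [h1]; exact hκ _
  have finish : ∀ (σ : Equiv.Perm (Fin 4)) (f : Fin 7 → Fin 7), RespectsCut σ →
      Function.Injective f → (∀ m, κ (s (f m)) = σ (![0, 0, 1, 1, 2, 2, 3] m)) →
      Matches ν x := by
    intro σ f hσ hf h
    have hg : Function.Injective (Fin.cons 0 fun m => (s (f m)).succ : Fin 8 → Fin 8) :=
      Fin.cons_injective_iff.2 ⟨by rintro ⟨m, hm⟩; exact Fin.succ_ne_zero _ hm,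
        fun a b h => hf (s.injective (Fin.succ_injective _ h))⟩
    obtain ⟨τ, hτ⟩ := exists_perm_of_injective hg
    refine Matches.of_comp hσ τ (matches_of_canonical hν hne (hx.comp hσ τ) fun m => ?_)
    rw [hτ, hτ, Fin.cons_zero, Fin.cons_succ, ← h]
    exact hκ _
  have a01 := hle 0 1 (by decide)
  have a12 := hle 1 2 (by decide)
  have a23 := hle 2 3 (by decide)
  have a34 := hle 3 4 (by decide)
  have a45 := hle 4 5 (by decide)
  have a56 := hle 5 6 (by decide)
  have b02 := hlt 0 1 2 (by decide) (by decide)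
  have b13 := hlt 1 2 3 (by decide) (by decide)
  have b24 := hlt 2 3 4 (by decide) (by decide)
  have b35 := hlt 3 4 5 (by decide) (by decide)
  have b46 := hlt 4 5 6 (by decide) (by decide)
  have k0 : κ (s 0) = 0 := Fin.ext (by simp; omega)
  have k2 : κ (s 2) = 1 := Fin.ext (by simp; omega)
  have k4 : κ (s 4) = 2 := Fin.ext (by simp; omega)
  have k6 : κ (s 6) = 3 := Fin.ext (by simp; omega)
  have hcase : (κ (s 1) = 0 ∧ κ (s 3) = 1 ∧ κ (s 5) = 2) ∨
      (κ (s 1) = 0 ∧ κ (s 3) = 1 ∧ κ (s 5) = 3) ∨ (κ (s 1) = 0 ∧ κ (s 3) = 2 ∧ κ (s 5) = 3) ∨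
      (κ (s 1) = 1 ∧ κ (s 3) = 2 ∧ κ (s 5) = 3) := by
    simp only [Fin.ext_iff]; simp; omega
  have hperm : ∀ f : Fin 4 → Fin 4, Function.Injective f →
      (∀ k l, side (f k) = side (f l) ↔ side k = side l) →
      ∃ σ : Equiv.Perm (Fin 4), RespectsCut σ ∧ ∀ c, σ c = f c := fun f hf h =>
    ⟨Equiv.ofBijective f (Finite.injective_iff_bijective.1 hf), h, fun _ => rfl⟩
  rcases hcase with ⟨k1, k3, k5⟩ | ⟨k1, k3, k5⟩ | ⟨k1, k3, k5⟩ | ⟨k1, k3, k5⟩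
  · obtain ⟨σ, hσ, e⟩ := hperm ![0, 1, 2, 3] (by decide) (by decide)
    refine finish σ ![0, 1, 2, 3, 4, 5, 6] hσ (by decide) fun m => ?_
    rw [e]; fin_cases m <;> assumption
  · obtain ⟨σ, hσ, e⟩ := hperm ![0, 1, 3, 2] (by decide) (by decide)
    refine finish σ ![0, 1, 2, 3, 5, 6, 4] hσ (by decide) fun m => ?_
    rw [e]; fin_cases m <;> assumption
  · obtain ⟨σ, hσ, e⟩ := hperm ![2, 3, 0, 1] (by decide) (by decide)
    refine finish σ ![3, 4, 5, 6, 0, 1, 2] hσ (by decide) fun m => ?_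
    rw [e]; fin_cases m <;> assumption
  · obtain ⟨σ, hσ, e⟩ := hperm ![2, 3, 1, 0] (by decide) (by decide)
    refine finish σ ![3, 4, 5, 6, 1, 2, 0] hσ (by decide) fun m => ?_
    rw [e]; fin_cases m <;> assumption

/-! ### Templates of different families are inequivalent -/

/-- The families to which the templates belong: the last two templates both describe `F6`. -/
def familyIndex : Fin 7 → Fin 6 := ![0, 1, 2, 3, 4, 5, 5]

/-- For each template, bit `12 * (8 * r + q) + 3 * c + k` records whether the entries of the rows
`r` and `q` in column `c` may be equal (`k = 0`), orthogonal (`k = 1`), or neither (`k = 2`). -/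
def relationTables : List ℕ :=
  [0x2494519229228a48a450c3144512499229228a48a431450c922922249c51b1450c8a48a4922922c5124950cb148a48a48a48a4b1450c249c519229228a48a450cb14c5124992292250c3148a48a492292224945131450c8a48a4922922451249,
   0x249851f22f22ea4ea491450c851249f22f22ea4ea450c914f22f2224985191450cea4ea4f22f2285124950c914ea4ea4ea4ea491450c249851f22f22ea4ea450c914851249f22f2291450cea4ea4f22f2224985150c914ea4ea4f22f22851249,
   0x2499913229228a456491450c9912499223225648a450c91432292224985191450c8a44a492232285124950c9144a48a48a456491450c2499913229225648a450c91499124992232291450c8a44a432292224985150c9144a48a4922322851249,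
   0x2498519229228a48a491450c8512499229228a48a450c9149229222494613145248a48a49229224612495243148a48a48a48a43145242494619229228a48a452431446124992292291450c8a48a492292224985150c9148a48a4922922851249,
   0x2498569225258a42a491450c8562495259222a48a450c91492252524985650c9142a48a452592285624991450c8a42a48a42a450c9142498515229222a48a491450c85124992252291450c2a48a452292224985150c9148a42a4922522851249,
   0x249d11922c6288cb14aa4524d11249c62922b1488c524aa4922c62249d11524aa4b1488cc62922d11249aa452488cb1488cb14524aa4249d11c62922b1488caa4524d11249922c62aa4524b1488cc62922249d11524aa488cb14922c62d11249,
   0x249911b22862c8c9148a452491124986232291448c5248a4b228622499115248a4914c8c8623229112498a452448c914c8c9145248a4249911862b2291448c8a45249112493228628a452491448c8623222499115248a4c8c914b22862911249]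

/-- The `i`-th relation table. -/
def relationTable (i : ℕ) : ℕ := nth 0 relationTables i

/-- The index of the bit of a relation table that belongs to the `k`-th relation between the
entries of the rows `r` and `q` in column `c`. -/
def relationBit (c r q k : ℕ) : ℕ := 12 * (8 * r + q) + 3 * c + k

/-- The inequalities of the template say that in column `c` the rays of `a` and `b` are not equal
(`s = false`) or not orthogonal (`s = true`). -/
def Template.excludes (t : Template) (c a b : ℕ) (s : Bool) : Bool :=
  t.neqs.any fun e => Nat.beq e.1 c &&
    (Nat.beq e.2.1 a && Nat.beq e.2.2.1 b || Nat.beq e.2.1 b && Nat.beq e.2.2.1 a) &&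
    (e.2.2.2 == s)

/-- What a relation table has to contain so that no relation possible in a configuration that fits
the template is missing from it. -/
def TableCovers (t : Template) (T : ℕ) (c r q : ℕ) : Bool :=
  let l := t.label c r
  let m := t.label c q
  let s := xor (oddLabel l) (oddLabel m)
  if l / 2 = m / 2 then T.testBit (relationBit c r q (if s then 1 else 0))
  else (t.excludes c (l / 2) (m / 2) s || T.testBit (relationBit c r q 0)) &&
    (t.excludes c (l / 2) (m / 2) (!s) || T.testBit (relationBit c r q 1)) &&
    T.testBit (relationBit c r q 2)

/-- Every table contains the relations that are possible for its template. -/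
theorem tableCovers : ∀ (i : Fin 7) (c : Fin 4) (r q : Fin 8), (template i).label c r < 16 ∧
    TableCovers (template i) (relationTable i) c r q = true := by decide +kernel

/-- No relation in column `c` between the rows `r, q` is possible according to `T` and at the same
time possible in column `d` between the rows `m, n` according to `T'`. -/
def clash (T T' c r q d m n : ℕ) : Bool :=
  isZero (Nat.land (Nat.land (Nat.shiftRight T (relationBit c r q 0))
    (Nat.shiftRight T' (relationBit d m n 0))) 7)

/-- A clash in some column between the relations of `r, q` in the first configuration and those of
`m, n` in the second one. -/
def clashSomewhere (T T' σ r q m n : ℕ) : Bool :=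
  anyOf [0, 1, 2, 3] fun c => clash T T' c r q (nibble 4 σ c) m n

/-- Backtracking over the injective maps of rows: `done` holds the rows already mapped together
with their images, and `todo` the remaining ones. The value is `true` if every choice ends in a
clash. -/
def noMatch (T T' σ : ℕ) (todo : List ℕ) : List (ℕ × ℕ) → Bool :=
  List.rec (fun _ => false) (fun r _ ih done =>
    allOf rows fun m => orElse (anyOf done fun e => orElse (Nat.beq m e.2)
      (clashSomewhere T T' σ r e.1 m e.2)) (ih ((r, m) :: done))) todo

/-- The permutations that respect the cut, written as hexadecimal digits. -/
def cutPermutations : List ℕ :=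
  [0x0123, 0x0132, 0x1023, 0x1032, 0x2301, 0x2310, 0x3201, 0x3210]

/-- The list of admissible permutations is complete. -/
theorem exists_cutPermutation : ∀ σ : Equiv.Perm (Fin 4), RespectsCut σ →
    ∃ w ∈ cutPermutations, ∀ c : Fin 4, nibble 4 w c = σ c := by decide +kernel

theorem noMatch_eq_true (i j : Fin 7) (h : familyIndex i ≠ familyIndex j) :
    ∀ w ∈ cutPermutations, noMatch (relationTable i) (relationTable j) w rows [] = true := by
  revert i j; decide +kernel

theorem twist_twist (hν : Function.Involutive ν) (s t : Bool) (p : P) :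
    twist ν s (twist ν t p) = twist ν (xor s t) p := by
  cases s <;> cases t <;> simp [twist, hν p]

/-- The relation between two points, numbered as in the tables. -/
def Related (ν : P → P) (p q : P) : Fin 3 → Prop :=
  ![p = q, p = ν q, p ≠ q ∧ p ≠ ν q]

/-- An excluded relation does not hold in a column that fits the template. -/
theorem excludes_spec {t : Template} {x : Fin 4 → Fin 8 → P}
    (hν : Function.Involutive ν)
    (hx : t.Fits ν x) {c : Fin 4} {a b : Fin 8} {s : Bool} (h : t.excludes c a b s = true) :
    x c a ≠ twist ν s (x c b) := by
  simp only [Template.excludes, List.any_eq_true, Bool.and_eq_true, Bool.or_eq_true,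
    Nat.beq_eq, beq_iff_eq] at h
  obtain ⟨⟨e1, e2, e3, e4⟩, he, ⟨rfl, ⟨rfl, rfl⟩ | ⟨rfl, rfl⟩⟩, rfl⟩ := h
  · exact hx.neq _ _ _ _ he
  · intro h
    refine hx.neq _ _ _ _ he ?_
    rw [h, twist_twist hν]
    simp [twist]

/-- Relations that occur in a configuration that fits the template are recorded in its table. -/
theorem related_testBit (hν : Function.Involutive ν) (hne : ∀ p, ν p ≠ p) {i : Fin 7}
    {x : Fin 4 → Fin 8 → P} (hx : (template i).Fits ν x) {c : Fin 4} {r q : Fin 8} {k : Fin 3}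
    (h : Related ν (x c r) (x c q) k) :
    (relationTable i).testBit (relationBit c r q k) = true := by
  have ht := (tableCovers i c r q).2
  have hl := (tableCovers i c r q).1
  have hm := (tableCovers i c q r).1
  generalize template i = t at *
  generalize relationTable i = T at *
  have key : ∀ l < 16, ∃ (b : Fin 8) (s : Bool), l = 2 * b + s.toNat := by decide +kernel
  obtain ⟨a, s, ha⟩ := key _ hl
  obtain ⟨b, s', hb⟩ := key _ hm
  have h2 : ∀ (a : Fin 8) (s : Bool), (2 * (a : ℕ) + s.toNat) / 2 = a := by
    intro a s; cases s <;> (simp; try omega)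
  have hr := hx.entry c r a s ha
  have hq := hx.entry c q b s' hb
  simp only [TableCovers, ha, hb, h2, oddLabel_two_mul, Fin.val_inj] at ht
  have hrel : ∀ u, x c r = twist ν u (x c q) ↔ x c a = twist ν (xor u (xor s s')) (x c b) := by
    intro u
    rw [hr, hq, twist_twist hν]
    constructor
    · intro h
      have := congrArg (twist ν s) h
      rw [twist_twist hν, twist_twist hν] at this
      rw [show (u ^^ (s ^^ s')) = (s ^^ (u ^^ s')) by cases u <;> cases s <;> cases s' <;> rfl]
      rw [← this]; simp [twist]
    · intro h
      rw [h, twist_twist hν]; congr 1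
      cases u <;> cases s <;> cases s' <;> rfl
  have h0 := hrel false
  have h1 := hrel true
  simp only [Bool.false_bne, Bool.true_bne] at h0 h1
  rw [show twist ν false (x c q) = x c q from rfl] at h0
  rw [show twist ν true (x c q) = ν (x c q) from rfl] at h1
  split_ifs at ht with hab hs
  · subst hab
    have : x c r = ν (x c q) := by rw [h1, hs]; rfl
    have hn : x c r ≠ x c q := by rw [this]; exact hne _
    fin_cases k
    · exact absurd h hn
    · exact ht
    · exact absurd this h.2
  · subst hab
    have : x c r = x c q := by rw [h0]; simp [twist, hs]
    have hn : x c r ≠ ν (x c q) := by rw [this]; exact (hne _).symm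
    fin_cases k
    · exact ht
    · exact absurd h hn
    · exact absurd this h.1
  · simp only [Bool.and_eq_true, Bool.or_eq_true] at ht
    obtain ⟨⟨t0, t1⟩, t2⟩ := ht
    fin_cases k
    · exact t0.resolve_left fun e => excludes_spec hν hx e (h0.1 h)
    · exact t1.resolve_left fun e => excludes_spec hν hx e (h1.1 h)
    · exact t2

theorem exists_related (p q : P) : ∃ k, Related ν p q k := by
  by_cases h : p = q
  · exact ⟨0, h⟩
  · by_cases h' : p = ν q
    exacts [⟨1, h'⟩, ⟨2, h, h'⟩]

theorem clash_eq_false {T T' c r q d m n k : ℕ} (hk : k < 3)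
    (h : T.testBit (relationBit c r q k) = true) (h' : T'.testBit (relationBit d m n k) = true) :
    clash T T' c r q d m n = false := by
  rw [clash, isZero, Bool.eq_false_iff]
  intro h0
  have h0 := Nat.eq_of_beq_eq_true h0
  have := congrArg (fun u => Nat.testBit u k) h0
  simp only [testBit_land, Nat.zero_testBit] at this
  have e : ∀ T i, Nat.testBit (Nat.shiftRight T i) k = T.testBit (i + k) := fun T i =>
    Nat.testBit_shiftRight T
  have h7 : Nat.testBit 7 k = true := by interval_cases k <;> rfl
  rw [e, e, h7] at this
  simp only [relationBit, Nat.add_zero] at this h h'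
  simp [h, h'] at this

/-- The actual permutation of rows survives all tests of the backtracking procedure. -/
theorem noMatch_spec (hν : Function.Involutive ν) (hne : ∀ p, ν p ≠ p) {i j : Fin 7}
    {x : Fin 4 → Fin 8 → P} {σ : Equiv.Perm (Fin 4)} {τ : Equiv.Perm (Fin 8)}
    (hi : (template i).Fits ν fun c r => x (σ c) (τ r)) (hj : (template j).Fits ν x) {w : ℕ}
    (hw : ∀ c : Fin 4, nibble 4 w c = σ c) {todo : List ℕ} (htodo : ∀ r ∈ todo, r < 8)
    (hnd : todo.Nodup) {done : List (ℕ × ℕ)}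
    (hdone : ∀ e ∈ done, e.1 ∉ todo ∧ ∃ r : Fin 8, e = ((r : ℕ), (τ r : ℕ))) :
    noMatch (relationTable i) (relationTable j) w todo done = false := by
  induction todo generalizing done with
  | nil => rfl
  | cons r todo ih =>
    change (allOf rows fun m => orElse (anyOf done fun e => orElse (Nat.beq m e.2)
      (clashSomewhere _ _ w r e.1 m e.2)) (noMatch _ _ w todo ((r, m) :: done))) = false
    rw [allOf_eq, List.all_eq_false]
    have hr := htodo r (by simp)
    have hmem : ∀ m : Fin 8, (m : ℕ) ∈ rows := by decide
    refine ⟨τ ⟨r, hr⟩, hmem _, ?_⟩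
    rw [orElse_eq, anyOf_eq, Bool.not_eq_true, Bool.or_eq_false_iff, List.any_eq_false]
    refine ⟨fun e he => ?_, ih (fun r hr => htodo r (by simp [hr])) hnd.of_cons ?_⟩
    · obtain ⟨hne', q, rfl⟩ := hdone e he
      rw [orElse_eq, Bool.not_eq_true, Bool.or_eq_false_iff]
      constructor
      · rw [Bool.eq_false_iff]
        intro h
        have := τ.injective (Fin.ext (Nat.eq_of_beq_eq_true h))
        simp [← this] at hne'
      · rw [clashSomewhere, anyOf_eq, List.any_eq_false]
        have : ∀ c : Fin 4, clash (relationTable i) (relationTable j) c r q (nibble 4 w c)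
            (τ ⟨r, hr⟩) (τ q) = false := by
          intro c
          obtain ⟨k, hk⟩ := exists_related (ν := ν) (x (σ c) (τ ⟨r, hr⟩)) (x (σ c) (τ q))
          rw [hw]
          exact clash_eq_false k.2 (related_testBit hν hne hi (r := ⟨r, hr⟩) hk)
            (related_testBit hν hne hj hk)
        intro c hc
        have : ∃ c' : Fin 4, (c' : ℕ) = c := ⟨⟨c, by simp at hc; omega⟩, rfl⟩
        obtain ⟨c, rfl⟩ := this
        rw [Bool.not_eq_true]
        exact this c
    · intro e he
      rcases List.mem_cons.1 he with rfl | he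
      · exact ⟨(List.nodup_cons.1 hnd).1, ⟨r, hr⟩, rfl⟩
      · obtain ⟨h, h'⟩ := hdone e he
        exact ⟨fun h1 => h (by simp [h1]), h'⟩

/-- Configurations related by an admissible permutation of the columns and a permutation of the
rows belong to templates of the same family. -/
theorem familyIndex_eq_of_fits (hν : Function.Involutive ν) (hne : ∀ p, ν p ≠ p) {i j : Fin 7}
    {x : Fin 4 → Fin 8 → P} {σ : Equiv.Perm (Fin 4)} (hσ : RespectsCut σ)
    {τ : Equiv.Perm (Fin 8)} (hi : (template i).Fits ν fun c r => x (σ c) (τ r))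
    (hj : (template j).Fits ν x) : familyIndex i = familyIndex j := by
  by_contra h
  obtain ⟨w, hw, hwσ⟩ := exists_cutPermutation σ hσ
  have h1 := noMatch_eq_true i j h w hw
  rw [noMatch_spec hν hne hi hj hwσ (by decide) (by decide) (by simp)] at h1
  exact Bool.false_ne_true h1

end Configurations

/-! ### Rays in `ℂ²` -/

/-- The ray spanned by a vector of `ℂ²`. -/
abbrev ray (v : Qubit) : Submodule ℂ Qubit := ℂ ∙ v

/-- The orthogonal complement. On the rays of `ℂ²`, which are the lines, it takes a ray to the one
orthogonal to it. -/
def orth (K : Submodule ℂ Qubit) : Submodule ℂ Qubit := Kᗮ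

theorem orth_involutive : Function.Involutive orth := fun K =>
  Submodule.orthogonal_orthogonal K

theorem orth_ne (K : Submodule ℂ Qubit) : orth K ≠ K := by
  intro h
  have h1 : K ⊓ Kᗮ = ⊥ := K.inf_orthogonal_eq_bot
  have h2 : K ⊔ Kᗮ = ⊤ := Submodule.sup_orthogonal_of_hasOrthogonalProjection
  change Kᗮ = K at h
  rw [h, inf_idem] at h1
  rw [h, sup_idem, h1] at h2
  exact bot_ne_top h2

/-- The antisymmetric form on `ℂ²`. -/
def bracket (v w : Qubit) : ℂ := v 0 * w 1 - v 1 * w 0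

theorem inner_eq (v w : Qubit) : inner ℂ v w = star (v 0) * w 0 + star (v 1) * w 1 := by
  simp [PiLp.inner_apply, Fin.sum_univ_two, mul_comm]

theorem ne_zero_iff {v : Qubit} : v ≠ 0 ↔ v 0 ≠ 0 ∨ v 1 ≠ 0 := by
  rw [← not_iff_not]
  push Not
  constructor
  · rintro rfl; simp
  · rintro ⟨h0, h1⟩; ext i; fin_cases i <;> simpa

theorem perp_ne_zero {v : Qubit} (h : v ≠ 0) : perp v ≠ 0 := by
  rw [ne_zero_iff] at *
  simpa [perp, or_comm] using h

theorem ray_eq_ray_iff {v w : Qubit} (hv : v ≠ 0) (hw : w ≠ 0) :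
    ray v = ray w ↔ bracket v w = 0 := by
  constructor
  · intro h
    have : v ∈ ray w := h ▸ Submodule.mem_span_singleton_self v
    obtain ⟨c, rfl⟩ := Submodule.mem_span_singleton.1 this
    simp [bracket]; ring
  · intro h
    have key : ∀ {v w : Qubit}, v ≠ 0 → w ≠ 0 → bracket v w = 0 → ray v ≤ ray w := by
      intro v w hv hw h
      rw [Submodule.span_singleton_le_iff_mem, Submodule.mem_span_singleton]
      rw [bracket, sub_eq_zero] at h
      rcases ne_zero_iff.1 hw with h0 | h1
      · refine ⟨v 0 / w 0, ?_⟩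
        ext i; fin_cases i <;> simp <;> field_simp
        linear_combination h
      · refine ⟨v 1 / w 1, ?_⟩
        ext i; fin_cases i <;> simp <;> field_simp
        linear_combination -h
    refine le_antisymm (key hv hw h) (key hw hv ?_)
    rw [← neg_eq_zero, ← h]; simp [bracket]; ring

theorem orth_ray {v : Qubit} (hv : v ≠ 0) : orth (ray v) = ray (perp v) := by
  apply le_antisymm
  · intro w hw
    have hw : inner ℂ v w = 0 := Submodule.mem_orthogonal_singleton_iff_inner_right.1 hw
    by_cases h : w = 0
    · simp [h]
    have : ray w = ray (perp v) := by
      rw [ray_eq_ray_iff h (perp_ne_zero hv)]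
      rw [inner_eq] at hw
      simp [bracket, perp] at *
      linear_combination hw
    exact this ▸ Submodule.mem_span_singleton_self w
  · rw [Submodule.span_singleton_le_iff_mem]
    refine Submodule.mem_orthogonal_singleton_iff_inner_right.2 ?_
    rw [inner_eq]; simp [perp]; ring

theorem ray_eq_orth_iff {v w : Qubit} (hv : v ≠ 0) (hw : w ≠ 0) :
    ray v = orth (ray w) ↔ inner ℂ w v = 0 := by
  rw [orth_ray hw, ray_eq_ray_iff hv (perp_ne_zero hw), inner_eq]
  simp only [bracket, perp]
  constructor <;> intro h
  · simp at h; simp; linear_combination h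
  · simp at h; simp; linear_combination h

theorem ray_smul {c : ℂ} (hc : c ≠ 0) (v : Qubit) : ray (c • v) = ray v :=
  Submodule.span_singleton_smul_eq (IsUnit.mk0 c hc) v

theorem ne_zero_of_isState {v : Qubit} (h : IsState v) : v ≠ 0 := by
  rintro rfl; simp [IsState] at h

theorem isState_iff {v : Qubit} : IsState v ↔ v 0 * star (v 0) + v 1 * star (v 1) = 1 := by
  have h : ((‖v‖ ^ 2 : ℝ) : ℂ) = v 0 * star (v 0) + v 1 * star (v 1) := by
    have := inner_self_eq_norm_sq_to_K (𝕜 := ℂ) v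
    rw [inner_eq] at this
    push_cast
    rw [mul_comm (v 0), mul_comm (v 1)]
    exact this.symm
  rw [IsState, ← h, Complex.ofReal_eq_one, pow_eq_one_iff_of_nonneg (norm_nonneg v) two_ne_zero]

theorem isState_perp {v : Qubit} (h : IsState v) : IsState (perp v) := by
  rw [isState_iff] at *
  simp [perp] at *
  linear_combination h

theorem isState_ketZero : IsState ketZero := by
  rw [isState_iff]; simp [ketZero]

theorem perp_ketZero : perp ketZero = ketOne := by
  ext i; fin_cases i <;> simp [perp, ketZero, ketOne]

theorem isState_ketOne : IsState ketOne := perp_ketZero ▸ isState_perp isState_ketZero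

theorem ray_eq_iff_phase {v w : Qubit} (hv : IsState v) (hw : IsState w) :
    ray v = ray w ↔ ∃ c : ℂ, ‖c‖ = 1 ∧ w = c • v := by
  constructor
  · intro h
    have : w ∈ ray v := h ▸ Submodule.mem_span_singleton_self w
    obtain ⟨c, rfl⟩ := Submodule.mem_span_singleton.1 this
    refine ⟨c, ?_, rfl⟩
    rw [IsState] at hv hw
    rw [norm_smul, hv, mul_one] at hw
    exact hw
  · rintro ⟨c, hc, rfl⟩
    rw [ray_smul]
    rintro rfl; simp at hc

theorem differentStates_iff {v w : Qubit} (hv : IsState v) (hw : IsState w) :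
    v ≁ w ↔ ray v ≠ ray w := by
  rw [DifferentStates, Ne, ray_eq_iff_phase hv hw]

theorem differentStates_perp_iff {v w : Qubit} (hv : IsState v) (hw : IsState w) :
    v ≁ perp w ↔ ray v ≠ orth (ray w) := by
  rw [differentStates_iff hv (isState_perp hw), orth_ray (ne_zero_of_isState hw)]

theorem ray_ketOne : ray ketOne = orth (ray ketZero) := by
  rw [orth_ray (ne_zero_of_isState isState_ketZero), perp_ketZero]

theorem ray_perp {v : Qubit} (h : IsState v) : ray (perp v) = orth (ray v) :=
  (orth_ray (ne_zero_of_isState h)).symm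

/-! ### Product vectors -/

theorem sum_four {M : Type*} [AddCommMonoid M] (f : Fin 2 × Fin 2 → Fin 2 × Fin 2 → M) :
    ∑ x : Fin 4 → Fin 2, f (x 0, x 1) (x 2, x 3) = ∑ u, ∑ v, f u v := by
  rw [← Fintype.sum_prod_type']
  let e : (Fin 4 → Fin 2) ≃ (Fin 2 × Fin 2) × (Fin 2 × Fin 2) :=
    { toFun := fun x => ((x 0, x 1), (x 2, x 3))
      invFun := fun y => ![y.1.1, y.1.2, y.2.1, y.2.2]
      left_inv := fun x => by funext i; fin_cases i <;> rfl
      right_inv := fun y => rfl }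
  exact Fintype.sum_equiv e _ _ fun x => rfl

/-- The inner product of the product vector `a ⊗ b` with `p`. -/
def pairing (a b : Qubit) (p : TwoQubit) : ℂ :=
  ∑ u : Fin 2 × Fin 2, star (a u.1) * star (b u.2) * p u

theorem inner_tensorCut (ψ : Fin 4 → Qubit) (p q : TwoQubit) :
    inner ℂ (tensorFour ψ) (tensorCut p q) =
      pairing (ψ 0) (ψ 1) p * pairing (ψ 2) (ψ 3) q := by
  rw [PiLp.inner_apply, pairing, pairing, Finset.sum_mul_sum, ← sum_four]
  refine Finset.sum_congr rfl fun x _ => ?_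
  simp [tensorFour, tensorCut, Fin.prod_univ_four]
  ring

theorem sum_prod_four (f : Fin 4 → Fin 2 → ℂ) :
    ∑ x : Fin 4 → Fin 2, ∏ k, f k (x k) = ∏ k, ∑ i, f k i := by
  rw [Finset.prod_univ_sum]; simp

theorem inner_tensorFour (ψ φ : Fin 4 → Qubit) :
    inner ℂ (tensorFour ψ) (tensorFour φ) = ∏ k, inner ℂ (ψ k) (φ k) := by
  simp only [PiLp.inner_apply]
  rw [← sum_prod_four]
  refine Finset.sum_congr rfl fun x _ => ?_
  simp [tensorFour, Finset.prod_mul_distrib]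

theorem norm_tensorFour (ψ : Fin 4 → Qubit) : ‖tensorFour ψ‖ = ∏ k, ‖ψ k‖ := by
  have h := inner_tensorFour ψ ψ
  simp only [inner_self_eq_norm_sq_to_K] at h
  have h : ‖tensorFour ψ‖ ^ 2 = (∏ k, ‖ψ k‖) ^ 2 := by
    rw [← Finset.prod_pow]
    exact_mod_cast h
  exact (pow_left_inj₀ (norm_nonneg _) (Finset.prod_nonneg fun _ _ => norm_nonneg _)
    two_ne_zero).1 h

theorem tensorFour_smul (c : Fin 4 → ℂ) (ψ : Fin 4 → Qubit) :
    tensorFour (fun k => c k • ψ k) = (∏ k, c k) • tensorFour ψ := by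
  ext x; simp [tensorFour, Finset.prod_mul_distrib]

theorem permuteSystems_tensorFour (σ : Equiv.Perm (Fin 4)) (ψ : Fin 4 → Qubit) :
    permuteSystems σ (tensorFour ψ) = tensorFour fun k => ψ (σ.symm k) := by
  ext x
  simp only [permuteSystems, tensorFour, Function.comp]
  exact Fintype.prod_equiv σ _ _ fun k => by simp

/-! ### Local unitaries -/

/-- The action of a `2 × 2` matrix on `ℂ²`. -/
def act (U : Matrix (Fin 2) (Fin 2) ℂ) (v : Qubit) : Qubit := WithLp.toLp 2 (U.mulVec v)

theorem localUnitary_tensorFour (U : Fin 4 → Matrix.unitaryGroup (Fin 2) ℂ) (ψ : Fin 4 → Qubit) :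
    localUnitary U (tensorFour ψ) = tensorFour fun k => act (U k) (ψ k) := by
  ext x
  simp only [localUnitary, tensorFour, act, Matrix.mulVec, dotProduct, ← Finset.prod_mul_distrib]
  exact sum_prod_four fun k i => (U k : Matrix (Fin 2) (Fin 2) ℂ) (x k) i * ψ k i

theorem act_zero (U : Matrix (Fin 2) (Fin 2) ℂ) (v : Qubit) :
    act U v 0 = U 0 0 * v 0 + U 0 1 * v 1 := by
  simp [act]

theorem act_one (U : Matrix (Fin 2) (Fin 2) ℂ) (v : Qubit) :
    act U v 1 = U 1 0 * v 0 + U 1 1 * v 1 := by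
  simp [act]

theorem bracket_act (U : Matrix (Fin 2) (Fin 2) ℂ) (v w : Qubit) :
    bracket (act U v) (act U w) = U.det * bracket v w := by
  simp only [bracket, act_zero, act_one, Matrix.det_fin_two]; ring

theorem inner_act (U : Matrix.unitaryGroup (Fin 2) ℂ) (v w : Qubit) :
    inner ℂ (act U v) (act U w) = inner ℂ v w := by
  have h := Matrix.mem_unitaryGroup_iff'.1 U.2
  have h00 := congrFun₂ h 0 0
  have h01 := congrFun₂ h 0 1
  have h10 := congrFun₂ h 1 0
  have h11 := congrFun₂ h 1 1
  simp [Matrix.mul_apply, Fin.sum_univ_two, Matrix.star_apply] at h00 h01 h10 h11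
  simp only [inner_eq, act_zero, act_one, star_add, star_mul']
  simp
  linear_combination (starRingEnd ℂ (v 0) * w 0) * h00 + (starRingEnd ℂ (v 0) * w 1) * h01 +
    (starRingEnd ℂ (v 1) * w 0) * h10 + (starRingEnd ℂ (v 1) * w 1) * h11

theorem norm_act (U : Matrix.unitaryGroup (Fin 2) ℂ) (v : Qubit) : ‖act U v‖ = ‖v‖ := by
  have h := inner_act U v v
  simp only [inner_self_eq_norm_sq_to_K] at h
  have h : ‖act U v‖ ^ 2 = ‖v‖ ^ 2 := by exact_mod_cast h
  exact (pow_left_inj₀ (norm_nonneg _) (norm_nonneg _) two_ne_zero).1 h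

theorem det_ne_zero (U : Matrix.unitaryGroup (Fin 2) ℂ) :
    (U : Matrix (Fin 2) (Fin 2) ℂ).det ≠ 0 :=
  (Matrix.UnitaryGroup.det_isUnit U).ne_zero

/-- Two equal nonzero product vectors have the same rays in every factor. -/
theorem ray_eq_of_tensorFour_eq {ψ φ : Fin 4 → Qubit} {c : ℂ} (hφ : ∀ k, φ k ≠ 0)
    (h : tensorFour φ = c • tensorFour ψ) (k : Fin 4) (hψ : ψ k ≠ 0) : ray (φ k) = ray (ψ k) := by
  classical
  have hx : ∀ l, ∃ i, φ l i ≠ 0 := fun l => by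
    rcases ne_zero_iff.1 (hφ l) with h | h
    exacts [⟨0, h⟩, ⟨1, h⟩]
  choose x hx using hx
  have key : ∀ i, φ k i * ∏ l ∈ Finset.univ.erase k, φ l (x l) =
      c * (ψ k i * ∏ l ∈ Finset.univ.erase k, ψ l (x l)) := by
    intro i
    have := congrArg (fun v : FourQubit => v (Function.update x k i)) h
    simp only [tensorFour, PiLp.smul_apply, smul_eq_mul] at this
    rw [← Finset.mul_prod_erase _ _ (Finset.mem_univ k),
      ← Finset.mul_prod_erase _ _ (Finset.mem_univ k)] at this
    simp only [Function.update_self] at this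
    convert this using 2
    · exact Finset.prod_congr rfl fun l hl => by
        rw [Function.update_of_ne (Finset.ne_of_mem_erase hl)]
    · congr 1
      exact Finset.prod_congr rfl fun l hl => by
        rw [Function.update_of_ne (Finset.ne_of_mem_erase hl)]
  have hA : ∏ l ∈ Finset.univ.erase k, φ l (x l) ≠ 0 :=
    Finset.prod_ne_zero_iff.2 fun l _ => hx l
  rw [ray_eq_ray_iff (hφ k) hψ, bracket]
  have h0 := key 0
  have h1 := key 1
  apply mul_right_cancel₀ hA
  linear_combination ψ k 1 * h0 - ψ k 0 * h1

/-! ### Determinants of product vectors -/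

/-- Up to complex conjugation and sign, the determinant of the product vectors `a r ⊗ b r` in
`ℂ² ⊗ ℂ²`. -/
def quadDet (a b : Fin 4 → Qubit) : ℂ :=
  bracket (a 0) (a 1) * bracket (a 2) (a 3) * (bracket (b 0) (b 2) * bracket (b 1) (b 3)) -
    bracket (a 0) (a 2) * bracket (a 1) (a 3) * (bracket (b 0) (b 1) * bracket (b 2) (b 3))

theorem pairing_eq (a b : Qubit) (p : TwoQubit) : pairing a b p =
    star (a 0) * star (b 0) * p (0, 0) + star (a 0) * star (b 1) * p (0, 1) +
      star (a 1) * star (b 0) * p (1, 0) + star (a 1) * star (b 1) * p (1, 1) := by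
  simp only [pairing, Fintype.sum_prod_type, Fin.sum_univ_two]; ring

/-- The rows are the conjugates of the product vectors `a r ⊗ b r`. -/
def productMatrix (a b : Fin 4 → Qubit) : Matrix (Fin 4) (Fin 4) ℂ := fun r =>
  ![star (a r 0) * star (b r 0), star (a r 0) * star (b r 1), star (a r 1) * star (b r 0),
    star (a r 1) * star (b r 1)]

theorem det_productMatrix (a b : Fin 4 → Qubit) :
    (productMatrix a b).det = -star (quadDet a b) := by
  simp [Matrix.det_succ_row_zero, Fin.sum_univ_succ, productMatrix, quadDet, bracket,
    Fin.succAbove, Matrix.submatrix]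
  ring

/-- Four product vectors fail to span `ℂ² ⊗ ℂ²` exactly if their determinant vanishes. -/
theorem exists_pairing_eq_zero_iff (a b : Fin 4 → Qubit) :
    (∃ p : TwoQubit, p ≠ 0 ∧ ∀ r, pairing (a r) (b r) p = 0) ↔ quadDet a b = 0 := by
  rw [← star_eq_zero, ← neg_eq_zero, ← det_productMatrix, ← Matrix.exists_mulVec_eq_zero_iff]
  have key : ∀ (p : TwoQubit) (v : Fin 4 → ℂ), v = ![p (0, 0), p (0, 1), p (1, 0), p (1, 1)] →
      ((productMatrix a b).mulVec v = 0 ↔ ∀ r, pairing (a r) (b r) p = 0) := by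
    rintro p v rfl
    rw [funext_iff]
    refine forall_congr' fun r => ?_
    rw [pairing_eq]
    simp [Matrix.mulVec, dotProduct, Fin.sum_univ_four, productMatrix]
  constructor
  · rintro ⟨p, hp, h⟩
    refine ⟨_, fun h0 => hp ?_, (key p _ rfl).2 h⟩
    have h0 := fun i => congrFun h0 i
    have h00 := h0 0
    have h01 := h0 1
    have h10 := h0 2
    have h11 := h0 3
    simp at h00 h01 h10 h11
    ext ⟨i, j⟩
    fin_cases i <;> fin_cases j <;> simpa
  · rintro ⟨v, hv, h⟩
    let p : TwoQubit := WithLp.toLp 2 fun u =>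
      v ((![![0, 1], ![2, 3]] : Fin 2 → Fin 2 → Fin 4) u.1 u.2)
    have hvp : v = ![p (0, 0), p (0, 1), p (1, 0), p (1, 1)] := by
      funext i; fin_cases i <;> rfl
    refine ⟨p, fun h0 => hv ?_, (key p v hvp).1 h⟩
    rw [hvp, h0]
    funext i; fin_cases i <;> rfl

/-! ### Unextendibility in terms of sets of rows -/

/-- Some nonzero vector of `ℂ² ⊗ ℂ²` is orthogonal to the product vectors `y r ⊗ z r` with `r` in
`K`. -/
def Singular (y z : Fin 8 → Qubit) (K : Fin 8 → Prop) : Prop :=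
  ∃ p : TwoQubit, p ≠ 0 ∧ ∀ r, K r → pairing (y r) (z r) p = 0

theorem pairing_eq_zero_of_ray {a a' b b' : Qubit} {p : TwoQubit} (ha : ray a = ray a')
    (hb : ray b = ray b') (h : pairing a b p = 0) : pairing a' b' p = 0 := by
  have ha' : a' ∈ ray a := ha ▸ Submodule.mem_span_singleton_self a'
  have hb' : b' ∈ ray b := hb ▸ Submodule.mem_span_singleton_self b'
  obtain ⟨c, rfl⟩ := Submodule.mem_span_singleton.1 ha'
  obtain ⟨d, rfl⟩ := Submodule.mem_span_singleton.1 hb'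
  have : pairing (c • a) (d • b) p = star c * star d * pairing a b p := by
    simp [pairing_eq]; ring
  rw [this, h, mul_zero]

theorem Singular.symm {y z : Fin 8 → Qubit} {K : Fin 8 → Prop} (h : Singular y z K) :
    Singular z y K := by
  obtain ⟨p, hp, h⟩ := h
  refine ⟨WithLp.toLp 2 fun u => p u.swap, fun h0 => hp ?_, fun r hr => ?_⟩
  · ext u
    have := congrArg (fun v : TwoQubit => v u.swap) h0
    simpa using this
  · rw [← h r hr, pairing_eq, pairing_eq]; simp; ring

theorem Singular.comp {y z : Fin 8 → Qubit} {K : Fin 8 → Prop} (τ : Equiv.Perm (Fin 8))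
    (h : Singular (fun r => y (τ r)) (fun r => z (τ r)) K) :
    Singular y z fun r => K (τ.symm r) := by
  obtain ⟨p, hp, h⟩ := h
  exact ⟨p, hp, fun r hr => by simpa using h _ hr⟩

/-- Dependent sets of rows do not span: if `u` and `v` are as in the first case of `Dependent`, the
product of vectors orthogonal to `u` and `v` is orthogonal to all rows of the set; in the second
case three vectors do not span a space of dimension four. -/
theorem Dependent.singular {y z : Fin 8 → Qubit} {K : Fin 8 → Prop}
    (h : Dependent (fun r => ray (y r)) (fun r => ray (z r)) K) : Singular y z K := by
  rcases h with ⟨u, v, h⟩ | ⟨a, b, c, h⟩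
  · have key : ∀ (y : Fin 8 → Qubit) (u : Submodule ℂ Qubit),
        ∃ w : Qubit, w ≠ 0 ∧ ∀ r, ray (y r) = u → inner ℂ (y r) w = 0 := by
      intro y u
      by_cases hu : ∃ r, ray (y r) = u
      · obtain ⟨s, rfl⟩ := hu
        by_cases hs : y s = 0
        · refine ⟨ketZero, ne_zero_of_isState isState_ketZero, fun r hr => ?_⟩
          have : y r = 0 := by simpa [hs] using hr
          simp [this]
        · refine ⟨perp (y s), perp_ne_zero hs, fun r hr => ?_⟩
          have : y r ∈ ray (y s) := hr ▸ Submodule.mem_span_singleton_self (y r)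
          obtain ⟨c, hc⟩ := Submodule.mem_span_singleton.1 this
          rw [← hc, inner_eq]; simp [perp]; ring
      · exact ⟨ketZero, ne_zero_of_isState isState_ketZero, fun r hr => absurd ⟨r, hr⟩ hu⟩
    obtain ⟨a, ha, hau⟩ := key y u
    obtain ⟨b, hb, hbv⟩ := key z v
    refine ⟨WithLp.toLp 2 fun t => a t.1 * b t.2, fun h0 => ?_, fun r hr => ?_⟩
    · have h0 : ∀ i j, a i * b j = 0 := fun i j => congrArg (fun v : TwoQubit => v (i, j)) h0
      obtain ⟨i, hi⟩ : ∃ i, a i ≠ 0 := by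
        rcases ne_zero_iff.1 ha with h | h
        exacts [⟨_, h⟩, ⟨_, h⟩]
      obtain ⟨j, hj⟩ : ∃ j, b j ≠ 0 := by
        rcases ne_zero_iff.1 hb with h | h
        exacts [⟨_, h⟩, ⟨_, h⟩]
      exact mul_ne_zero hi hj (h0 i j)
    · have : pairing (y r) (z r) (WithLp.toLp 2 fun t => a t.1 * b t.2) =
          inner ℂ (y r) a * inner ℂ (z r) b := by
        rw [pairing_eq, inner_eq, inner_eq]; simp; ring
      rw [this]
      rcases h r hr with h | h
      · rw [hau r h, zero_mul]
      · rw [hbv r h, mul_zero]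
  · obtain ⟨p, hp, hk⟩ := (exists_pairing_eq_zero_iff ![y a, y b, y c, y c]
      ![z a, z b, z c, z c]).2 (by simp [quadDet, bracket]; ring)
    refine ⟨p, hp, fun r hr => ?_⟩
    obtain ⟨s, hs, h1, h2⟩ := h r hr
    refine pairing_eq_zero_of_ray h1.symm h2.symm ?_
    rcases hs with rfl | rfl | rfl
    exacts [hk 0, hk 1, hk 2]

/-- No nonzero `p ⊗ q` is orthogonal to all rows: the rows orthogonal to `p` and those orthogonal
to `q` never exhaust the rows. -/
def Unextendible (ψ : QubitMatrix) : Prop :=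
  ∀ K : Fin 8 → Prop, Singular (fun r => ψ r 0) (fun r => ψ r 1) K →
    ¬ Singular (fun r => ψ r 2) (fun r => ψ r 3) fun r => ¬ K r

/-- Orthogonality of product vectors is orthogonality in some column, and a product vector `p ⊗ q`
is orthogonal to a row if `p` is orthogonal to its part in `A, B`, or `q` to its part in `C, D`. -/
theorem isUPB44_iff {ψ : QubitMatrix} (hψ : ∀ r c, IsState (ψ r c)) :
    IsUPB44 (rowVectors ψ) ↔
      (∀ r s, r ≠ s → ∃ c, ray (ψ r c) = orth (ray (ψ s c))) ∧ Unextendible ψ := by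
  have hn : ∀ r, ‖rowVectors ψ r‖ = 1 := fun r => by
    rw [rowVectors, norm_tensorFour]
    exact Finset.prod_eq_one fun c _ => hψ r c
  have h0 : ∀ r c, ψ r c ≠ 0 := fun r c => ne_zero_of_isState (hψ r c)
  have ho : ∀ r s, inner ℂ (rowVectors ψ r) (rowVectors ψ s) = 0 ↔
      ∃ c, ray (ψ s c) = orth (ray (ψ r c)) := fun r s => by
    simp only [rowVectors, inner_tensorFour, Finset.prod_eq_zero_iff, Finset.mem_univ, true_and,
      ray_eq_orth_iff (h0 _ _) (h0 _ _)]
  have hu : (∃ p q : TwoQubit, p ≠ 0 ∧ q ≠ 0 ∧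
      ∀ i, inner ℂ (rowVectors ψ i) (tensorCut p q) = 0) ↔ ¬ Unextendible ψ := by
    simp only [rowVectors, inner_tensorCut, mul_eq_zero, Unextendible]
    push Not
    constructor
    · rintro ⟨p, q, hp, hq, h⟩
      exact ⟨fun r => pairing (ψ r 0) (ψ r 1) p = 0, ⟨p, hp, fun _ => id⟩, q, hq,
        fun r hr => (h r).resolve_left hr⟩
    · rintro ⟨K, ⟨p, hp, h⟩, q, hq, h'⟩
      refine ⟨p, q, hp, hq, fun r => ?_⟩
      by_cases hr : K r
      exacts [Or.inl (h r hr), Or.inr (h' r hr)]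
  rw [IsUPB44, hu, not_not]
  constructor
  · rintro ⟨⟨-, h⟩, -, h'⟩
    exact ⟨fun r s hrs => (ho s r).1 (h hrs.symm), h'⟩
  · rintro ⟨h, h'⟩
    exact ⟨⟨hn, fun r s hrs => (ho r s).2 (h s r hrs.symm)⟩, fun r => ⟨ψ r, rfl⟩, h'⟩

/-! ### Criteria for linear independence -/

/-- Four product vectors `a r ⊗ b r` are linearly independent if `a 0` and `a 1` are equal and the
remaining pairs relevant for the determinant are different. -/
theorem quadDet_ne_zero_of_parallel {a b : Fin 4 → Qubit} (ha : ∀ r, a r ≠ 0)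
    (hb : ∀ r, b r ≠ 0) (h01 : ray (a 0) = ray (a 1)) (h02 : ray (a 0) ≠ ray (a 2))
    (h13 : ray (a 1) ≠ ray (a 3)) (k01 : ray (b 0) ≠ ray (b 1)) (k23 : ray (b 2) ≠ ray (b 3)) :
    quadDet a b ≠ 0 := by
  rw [Ne, ray_eq_ray_iff (ha _) (ha _)] at h02 h13
  rw [Ne, ray_eq_ray_iff (hb _) (hb _)] at k01 k23
  rw [ray_eq_ray_iff (ha _) (ha _)] at h01
  rw [quadDet, h01]
  simp [h02, h13, k01, k23]

theorem quadDet_congr {a b a' b' : Fin 4 → Qubit} (ha : ∀ r, ray (a r) = ray (a' r))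
    (hb : ∀ r, ray (b r) = ray (b' r)) : quadDet a b = 0 ↔ quadDet a' b' = 0 := by
  rw [← exists_pairing_eq_zero_iff, ← exists_pairing_eq_zero_iff]
  refine exists_congr fun p => and_congr_right fun _ => forall_congr' fun r => ?_
  exact ⟨pairing_eq_zero_of_ray (ha r) (hb r),
    pairing_eq_zero_of_ray (ha r).symm (hb r).symm⟩

theorem bracket_perp_self {v : Qubit} (hv : IsState v) : bracket v (perp v) = 1 := by
  rw [isState_iff] at hv
  simp [bracket, perp] at *
  linear_combination hv

theorem bracket_perp_perp (v w : Qubit) : bracket (perp v) (perp w) = star (bracket v w) := by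
  simp [bracket, perp]; ring

/-- For two states, `|[v, w]|² + |⟨v, w⟩|² = 1`. -/
theorem normSq_bracket_add {v w : Qubit} (hv : IsState v) (hw : IsState w) :
    Complex.normSq (bracket v w) + Complex.normSq (inner ℂ v w) = 1 := by
  rw [isState_iff] at hv hw
  have : ((Complex.normSq (bracket v w) + Complex.normSq (inner ℂ v w) : ℝ) : ℂ) = 1 := by
    push_cast
    rw [Complex.normSq_eq_conj_mul_self, Complex.normSq_eq_conj_mul_self, inner_eq]
    simp [bracket] at *
    linear_combination (w 0 * starRingEnd ℂ (w 0) + w 1 * starRingEnd ℂ (w 1)) * hv + hw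
  exact_mod_cast this

/-- Four product vectors `a r ⊗ b r` are linearly independent if they are arranged in a square with
orthogonal `a`-factors along two opposite sides and orthogonal `b`-factors along the other two,
unless `a 0` and `a 2` are orthogonal: then one term of the determinant has absolute value one, and
the other a smaller one. -/
theorem quadDet_ne_zero_of_antipodal {a b : Fin 4 → Qubit} (ha : ∀ r, IsState (a r))
    (hb : ∀ r, IsState (b r)) (h01 : ray (a 0) = orth (ray (a 1)))
    (h23 : ray (a 2) = orth (ray (a 3))) (k02 : ray (b 0) = orth (ray (b 2)))
    (k13 : ray (b 1) = orth (ray (b 3))) (h02 : ray (a 0) ≠ orth (ray (a 2))) :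
    quadDet a b ≠ 0 := by
  rw [Ne, quadDet_congr (a' := ![a 0, perp (a 0), a 2, perp (a 2)])
    (b' := ![b 0, b 1, perp (b 0), perp (b 1)])]
  · have e1 := normSq_bracket_add (ha 2) (ha 0)
    have e2 := normSq_bracket_add (hb 0) (hb 1)
    rw [Ne, ray_eq_orth_iff (ne_zero_of_isState (ha 0)) (ne_zero_of_isState (ha 2)),
      ← Complex.normSq_eq_zero] at h02
    have p1 := Complex.normSq_nonneg (inner ℂ (a 2) (a 0))
    have p2 := Complex.normSq_nonneg (inner ℂ (b 0) (b 1))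
    have p3 := Complex.normSq_nonneg (bracket (a 2) (a 0))
    have p4 := Complex.normSq_nonneg (bracket (b 0) (b 1))
    have e3 : Complex.normSq (bracket (a 0) (a 2)) = Complex.normSq (bracket (a 2) (a 0)) := by
      rw [← Complex.normSq_neg]; congr 1; simp [bracket]; ring
    have h1 : Complex.normSq (bracket (a 0) (a 2)) * Complex.normSq (bracket (b 0) (b 1)) < 1 := by
      rw [e3]
      have : 0 < Complex.normSq (inner ℂ (a 2) (a 0)) := lt_of_le_of_ne p1 (Ne.symm h02)
      nlinarith
    simp only [quadDet, Matrix.cons_val]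
    rw [bracket_perp_self (ha 0), bracket_perp_self (ha 2), bracket_perp_self (hb 0),
      bracket_perp_self (hb 1), bracket_perp_perp, bracket_perp_perp]
    intro h
    have h2 : ((Complex.normSq (bracket (a 0) (a 2)) *
        Complex.normSq (bracket (b 0) (b 1)) : ℝ) : ℂ) = 1 := by
      push_cast
      rw [Complex.normSq_eq_conj_mul_self, Complex.normSq_eq_conj_mul_self]
      simp only [Complex.star_def] at h
      linear_combination -h
    rw [Complex.ofReal_eq_one] at h2
    exact h1.ne h2
  · intro r
    fin_cases r
    · rfl
    · change ray (a 1) = ray (perp (a 0))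
      rw [ray_perp (ha 0), h01, orth_involutive]
    · rfl
    · change ray (a 3) = ray (perp (a 2))
      rw [ray_perp (ha 2), h23, orth_involutive]
  · intro r
    fin_cases r
    · rfl
    · rfl
    · change ray (b 2) = ray (perp (b 0))
      rw [ray_perp (hb 0), k02, orth_involutive]
    · change ray (b 3) = ray (perp (b 1))
      rw [ray_perp (hb 1), k13, orth_involutive]

theorem quadDet_eq_zero_of_singular {y z : Fin 8 → Qubit} {K : Fin 8 → Prop} (h : Singular y z K)
    (s : Fin 4 → Fin 8) (hs : ∀ i, K (s i)) :
    quadDet (fun i => y (s i)) (fun i => z (s i)) = 0 := by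
  obtain ⟨p, hp, h⟩ := h
  exact (exists_pairing_eq_zero_iff _ _).1 ⟨p, hp, fun i => h _ (hs i)⟩

theorem singular_of_quadDet_eq_zero {y z : Fin 8 → Qubit} {K : Fin 8 → Prop} (s : Fin 4 → Fin 8)
    (h : quadDet (fun i => y (s i)) (fun i => z (s i)) = 0) (hs : ∀ r, K r → ∃ i, s i = r) :
    Singular y z K := by
  obtain ⟨p, hp, h⟩ := (exists_pairing_eq_zero_iff _ _).2 h
  refine ⟨p, hp, fun r hr => ?_⟩
  obtain ⟨i, rfl⟩ := hs r hr
  exact h i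

/-! ### Matrices that fit a template are unextendible -/

/-- According to the table, the `k`-th relation is impossible in column `c` between the rows
`r, q`. -/
def never (T k c r q : ℕ) : Bool := negate (hit T (relationBit c r q k))

/-- The table shows that four of the rows in `m` give linearly independent vectors in the columns
`c, d`, by one of the two criteria for the determinant. -/
def certified (T c d m : ℕ) : Bool :=
  anyOf rows fun i => andAlso (hit m i) (anyOf rows fun j => andAlso (hit m j) (andAlso
    (never T 2 c i j) (orElse
      (andAlso (never T 1 c i j) (andAlso (never T 0 d i j)
        (anyOf rows fun k => andAlso (hit m k) (andAlso (never T 0 c i k)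
          (anyOf rows fun l => andAlso (hit m l) (andAlso (never T 0 c j l)
            (never T 0 d k l)))))))
      (andAlso (never T 0 c i j)
        (anyOf rows fun k => andAlso (hit m k) (andAlso (never T 0 d i k) (andAlso
          (never T 2 d i k) (andAlso (never T 1 c i k)
          (anyOf rows fun l => andAlso (hit m l) (andAlso (never T 0 c k l) (andAlso
            (never T 2 c k l) (andAlso (never T 0 d j l) (never T 2 d j l)))))))))))))

/-- The sets of rows of `F4` that the criteria for the determinant leave open. -/
def openSets : List ℕ := [101, 89, 166, 154]

/-- For every set `m` of rows, the criteria show that `m` spans in the columns `A, B` or its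
complement in the columns `C, D`, apart from the open sets of `F4`. -/
theorem certified_or (i : Fin 7) : ∀ m : Fin 256,
    orElse (certified (relationTable i) 0 1 m) (orElse (certified (relationTable i) 1 0 m)
      (orElse (certified (relationTable i) 2 3 (255 - m))
        (certified (relationTable i) 3 2 (255 - m)))) = true ∨
      i = 3 ∧ (m : ℕ) ∈ openSets := by
  revert i; decide +kernel

/-- The tables show that any two rows are orthogonal in some column. -/
theorem orthogonal_somewhere (i : Fin 7) : ∀ r s : Fin 8, r ≠ s → ∃ c : Fin 4,
    never (relationTable i) 0 c r s = true ∧ never (relationTable i) 2 c r s = true := by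
  revert i; decide +kernel

theorem not_related_of_never {i : Fin 7} {x : Fin 4 → Fin 8 → Submodule ℂ Qubit}
    (hx : (template i).Fits orth x) {k : Fin 3} {c : Fin 4} {r q : Fin 8}
    (h : never (relationTable i) k c r q = true) : ¬ Related orth (x c r) (x c q) k := by
  intro h'
  rw [never, negate_eq, hit_eq, related_testBit orth_involutive orth_ne hx h'] at h
  simp at h

theorem eq_of_never {i : Fin 7} {x : Fin 4 → Fin 8 → Submodule ℂ Qubit}
    (hx : (template i).Fits orth x) {c : Fin 4} {r q : Fin 8}
    (h : never (relationTable i) 1 c r q = true) (h' : never (relationTable i) 2 c r q = true) :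
    x c r = x c q := by
  by_contra h0
  refine not_related_of_never hx (k := 2) h' ?_
  exact ⟨h0, fun h1 =>
    not_related_of_never hx (k := 1) h h1⟩

theorem orth_of_never {i : Fin 7} {x : Fin 4 → Fin 8 → Submodule ℂ Qubit}
    (hx : (template i).Fits orth x) {c : Fin 4} {r q : Fin 8}
    (h : never (relationTable i) 0 c r q = true) (h' : never (relationTable i) 2 c r q = true) :
    x c r = orth (x c q) := by
  by_contra h0
  refine not_related_of_never hx (k := 2) h' ?_
  exact ⟨fun h1 =>
    not_related_of_never hx (k := 0) h h1, h0⟩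

theorem not_singular_of_certified {i : Fin 7} {ψ : QubitMatrix} (hψ : ∀ r c, IsState (ψ r c))
    (hx : (template i).Fits orth fun c r => ray (ψ r c)) {c d : Fin 4} {m : ℕ}
    {K : Fin 8 → Prop} (hm : ∀ r : Fin 8, m.testBit r = true → K r)
    (h : certified (relationTable i) c d m = true) :
    ¬ Singular (fun r => ψ r c) (fun r => ψ r d) K := by
  have hrow : ∀ r ∈ rows, ∃ r' : Fin 8, (r' : ℕ) = r := by decide
  simp only [certified, anyOf_eq, andAlso_eq, orElse_eq, List.any_eq_true, Bool.and_eq_true,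
    Bool.or_eq_true, hit_eq] at h
  intro hs
  obtain ⟨a, ha, ha', b, hb, hb', hab, h⟩ := h
  obtain ⟨a, rfl⟩ := hrow a ha
  obtain ⟨b, rfl⟩ := hrow b hb
  rcases h with ⟨hab', kab, e, he, he', hae, f, hf, hf', hbf, kef⟩ |
    ⟨hab', e, he, he', kae, kae', hae, f, hf, hf', hef, hef', kbf, kbf'⟩ <;>
  obtain ⟨e, rfl⟩ := hrow e he <;> obtain ⟨f, rfl⟩ := hrow f hf <;>
  have hdet := quadDet_eq_zero_of_singular hs ![a, b, e, f] (fun t => hm _ (by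
    fin_cases t <;> assumption))
  · refine quadDet_ne_zero_of_parallel (fun r => ne_zero_of_isState (hψ _ _))
      (fun r => ne_zero_of_isState (hψ _ _)) ?_ ?_ ?_ ?_ ?_ hdet
    · exact eq_of_never hx hab' hab
    · exact not_related_of_never hx (k := 0) hae
    · exact not_related_of_never hx (k := 0) hbf
    · exact not_related_of_never hx (k := 0) kab
    · exact not_related_of_never hx (k := 0) kef
  · refine quadDet_ne_zero_of_antipodal (fun r => hψ _ _) (fun r => hψ _ _) ?_ ?_ ?_ ?_ ?_ hdet
    · exact orth_of_never hx hab' hab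
    · exact orth_of_never hx hef hef'
    · exact orth_of_never hx kae kae'
    · exact orth_of_never hx kbf kbf'
    · exact not_related_of_never hx (k := 1) hae

/-- A matrix that fits a template is unextendible, provided that the open sets are excluded in the
case of `F4`. -/
theorem unextendible_of_fits {i : Fin 7} {ψ : QubitMatrix} (hψ : ∀ r c, IsState (ψ r c))
    (hx : (template i).Fits orth fun c r => ray (ψ r c))
    (h4 : i = 3 → ∀ m ∈ openSets, Singular (fun r => ψ r 0) (fun r => ψ r 1)
      (fun r => m.testBit r = true) → ¬ Singular (fun r => ψ r 2) (fun r => ψ r 3)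
      fun r => ¬ m.testBit r = true) : Unextendible ψ := by
  intro K hK hK'
  have hm : ∃ m : Fin 256, ∀ r : Fin 8, (m : ℕ).testBit r = true ↔ K r := by
    classical
    refine ⟨⟨Nat.ofBits fun r => decide (K r), Nat.ofBits_lt_two_pow _⟩, fun r => ?_⟩
    simp [Nat.testBit_ofBits_lt]
  obtain ⟨m, hm⟩ := hm
  have hcompl : ∀ (m : Fin 256) (r : Fin 8), (255 - (m : ℕ)).testBit r = true →
      ¬ (m : ℕ).testBit r = true := by decide +kernel
  have h2 : ∀ r : Fin 8, (255 - (m : ℕ)).testBit r = true → ¬ K r := fun r hr hr' =>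
    hcompl m r hr ((hm r).2 hr')
  rcases certified_or i m with h | ⟨hi, h⟩
  · simp only [orElse_eq, Bool.or_eq_true] at h
    rcases h with h | h | h | h
    · exact not_singular_of_certified hψ hx (c := 0) (d := 1) (fun r => (hm r).1) h hK
    · exact not_singular_of_certified hψ hx (c := 1) (d := 0) (fun r => (hm r).1) h hK.symm
    · exact not_singular_of_certified hψ hx (c := 2) (d := 3) h2 h hK'
    · exact not_singular_of_certified hψ hx (c := 3) (d := 2) h2 h hK'.symm
  · have : (fun r : Fin 8 => (m : ℕ).testBit r = true) = K := funext fun r => propext (hm r)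
    refine h4 hi m h ?_ ?_
    · rw [this]; exact hK
    · simpa only [hm] using hK'

theorem orthogonal_of_fits {i : Fin 7} {x : Fin 4 → Fin 8 → Submodule ℂ Qubit}
    (hx : (template i).Fits orth x) (r s : Fin 8) (h : r ≠ s) : ∃ c, x c r = orth (x c s) := by
  obtain ⟨c, h0, h2⟩ := orthogonal_somewhere i r s h
  exact ⟨c, orth_of_never hx h0 h2⟩

/-! ### The exceptional parameters of `F4` -/

theorem ofReal_norm_sq (x : ℂ) : ((‖x‖ ^ 2 : ℝ) : ℂ) = x * star x := by
  rw [Complex.star_def, Complex.mul_conj']; push_cast; rfl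

/-- The determinant in the columns `A, B` of four rows. -/
abbrev detAB (ψ : QubitMatrix) (s : Fin 4 → Fin 8) : ℂ :=
  quadDet (fun i => ψ (s i) 0) fun i => ψ (s i) 1

/-- The determinant in the columns `C, D` of four rows. -/
abbrev detCD (ψ : QubitMatrix) (s : Fin 4 → Fin 8) : ℂ :=
  quadDet (fun i => ψ (s i) 2) fun i => ψ (s i) 3

/-- The determinants in the columns `A, B` of the four open sets of `F4`: they vanish in pairs. -/
theorem detAB_F4 {f5 : Qubit} (hf : IsState f5) (g3 g4 h3 i2 i3 : Qubit) :
    detAB (F4 f5 g3 g4 h3 i2 i3) ![0, 2, 5, 6] =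
      g3 0 * star (g4 0) + f5 1 * star (f5 1) * (g3 1 * star (g4 1)) ∧
    detAB (F4 f5 g3 g4 h3 i2 i3) ![0, 3, 4, 6] =
      star (g3 0 * star (g4 0) + f5 1 * star (f5 1) * (g3 1 * star (g4 1))) ∧
    detAB (F4 f5 g3 g4 h3 i2 i3) ![1, 2, 5, 7] =
      -(g3 1 * star (g4 1) + f5 1 * star (f5 1) * (g3 0 * star (g4 0))) ∧
    detAB (F4 f5 g3 g4 h3 i2 i3) ![1, 3, 4, 7] =
      -star (g3 1 * star (g4 1) + f5 1 * star (f5 1) * (g3 0 * star (g4 0))) := by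
  rw [isState_iff] at hf
  refine ⟨?_, ?_, ?_, ?_⟩ <;>
    simp [quadDet, bracket, F4, perp, ketZero, ketOne] at hf ⊢
  · linear_combination (g3 0 * starRingEnd ℂ (g4 0)) * hf
  · linear_combination (g4 0 * starRingEnd ℂ (g3 0)) * hf
  · linear_combination -(g3 1 * starRingEnd ℂ (g4 1)) * hf
  · linear_combination -(g4 1 * starRingEnd ℂ (g3 1)) * hf

/-- The determinants in the columns `C, D` of the complements of the four open sets of `F4`. -/
theorem detCD_F4 {h3 : Qubit} (hh : IsState h3) (f5 g3 g4 i2 i3 : Qubit) :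
    detCD (F4 f5 g3 g4 h3 i2 i3) ![1, 5, 2, 7] =
      -((i2 0 * i3 1 - i2 1 * i3 0) * star (i3 1) +
        h3 1 * star (h3 1) * ((i2 0 * star (i3 0) + i2 1 * star (i3 1)) * i3 0)) ∧
    detCD (F4 f5 g3 g4 h3 i2 i3) ![1, 4, 3, 7] =
      (i2 0 * star (i3 0) + i2 1 * star (i3 1)) * i3 0 +
        h3 1 * star (h3 1) * ((i2 0 * i3 1 - i2 1 * i3 0) * star (i3 1)) ∧
    detCD (F4 f5 g3 g4 h3 i2 i3) ![0, 5, 2, 6] =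
      -star ((i2 0 * i3 1 - i2 1 * i3 0) * star (i3 1) +
        h3 1 * star (h3 1) * ((i2 0 * star (i3 0) + i2 1 * star (i3 1)) * i3 0)) ∧
    detCD (F4 f5 g3 g4 h3 i2 i3) ![0, 4, 3, 6] =
      star ((i2 0 * star (i3 0) + i2 1 * star (i3 1)) * i3 0 +
        h3 1 * star (h3 1) * ((i2 0 * i3 1 - i2 1 * i3 0) * star (i3 1))) := by
  rw [isState_iff] at hh
  refine ⟨?_, ?_, ?_, ?_⟩ <;>
    simp [quadDet, bracket, F4, perp, ketZero, ketOne] at hh ⊢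
  · linear_combination -((i2 0 * i3 1 - i2 1 * i3 0) * starRingEnd ℂ (i3 1)) * hh
  · linear_combination ((i2 0 * starRingEnd ℂ (i3 0) + i2 1 * starRingEnd ℂ (i3 1)) * i3 0) * hh
  · linear_combination -((starRingEnd ℂ (i2 0) * starRingEnd ℂ (i3 1) -
      starRingEnd ℂ (i2 1) * starRingEnd ℂ (i3 0)) * i3 1) * hh
  · linear_combination ((starRingEnd ℂ (i2 0) * i3 0 + starRingEnd ℂ (i2 1) * i3 1) *
      starRingEnd ℂ (i3 0)) * hh

/-- The affine coordinate of a generic state is neither zero nor infinite. -/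
theorem coord_ne_zero_of_isGenericState {v : Qubit} (h : IsGenericState v) : v 0 ≠ 0 ∧ v 1 ≠ 0 := by
  obtain ⟨hv, h0, h1⟩ := h
  have hn := ne_zero_of_isState hv
  rw [differentStates_iff hv isState_ketZero, Ne,
    ray_eq_ray_iff hn (ne_zero_of_isState isState_ketZero)] at h0
  rw [differentStates_iff hv isState_ketOne, Ne,
    ray_eq_ray_iff hn (ne_zero_of_isState isState_ketOne)] at h1
  simp [bracket, ketZero, ketOne] at h0 h1
  exact ⟨h1, h0⟩

/-- The exceptional value `-s` with `s = F⁻¹`, cleared of denominators; the amplitudes of one state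
are `x, y`, and the conjugate amplitudes of the other are `c, d`. -/
theorem conj_ratio_eq_iff {x y c d F : ℂ} (hx : x ≠ 0) (hc : c ≠ 0) (hF : F ≠ 0) :
    y / x * (d / c) = -F⁻¹ ↔ x * c + F * (y * d) = 0 := by
  rw [← sub_eq_zero, show y / x * (d / c) - -F⁻¹ = (x * c + F * (y * d)) / (x * c * F) by
    field_simp; ring, div_eq_zero_iff, or_iff_left (by simp [*])]

theorem conj_ratio_eq_iff' {x y c d F : ℂ} (hx : x ≠ 0) (hc : c ≠ 0) :
    y / x * (d / c) = -F⁻¹⁻¹ ↔ y * d + F * (x * c) = 0 := by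
  rw [← sub_eq_zero, show y / x * (d / c) - -F⁻¹⁻¹ = (y * d + F * (x * c)) / (x * c) by
    field_simp; ring, div_eq_zero_iff, or_iff_left (by simp [*])]

/-- An exceptional value of the coordinate `y / x`, cleared of denominators, with
`r = H / (1 - H)`; the amplitudes of the other state are `u, v`, and their conjugates `c, d`. -/
theorem ratio_eq_iff {x y u v c d H : ℂ} (hx : x ≠ 0) (hu : u ≠ 0) (hd : d ≠ 0)
    (hH : 1 - H ≠ 0) :
    y / x = (1 + H / (1 - H)) * (v / u) + H / (1 - H) / (d / c) ↔
      (x * v - y * u) * d + H * ((x * c + y * d) * u) = 0 := by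
  rw [← sub_eq_zero, show y / x - ((1 + H / (1 - H)) * (v / u) + H / (1 - H) / (d / c)) =
    -(((x * v - y * u) * d + H * ((x * c + y * d) * u)) / (x * u * d * (1 - H))) by
      field_simp; ring, neg_eq_zero, div_eq_zero_iff, or_iff_left (by simp [*])]

theorem ratio_eq_iff' {x y u v c d H : ℂ} (hx : x ≠ 0) (hu : u ≠ 0) (hd : d ≠ 0)
    (hH : 1 - H ≠ 0) :
    y / x = -(H / (1 - H) * (v / u) + (1 + H / (1 - H)) / (d / c)) ↔
      (x * c + y * d) * u + H * ((x * v - y * u) * d) = 0 := by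
  rw [← sub_eq_zero, show y / x - -(H / (1 - H) * (v / u) + (1 + H / (1 - H)) / (d / c)) =
    ((x * c + y * d) * u + H * ((x * v - y * u) * d)) / (x * u * d * (1 - H)) by
      field_simp; ring, div_eq_zero_iff, or_iff_left (by simp [*])]

/-- The parameters of `F4` are exceptional exactly if there are four rows such that these are
linearly dependent in the columns `A, B` and the other four in the columns `C, D`. -/
theorem exceptional4_iff {f5 g3 g4 h3 i2 i3 : Qubit} (h : Ineq4 f5 g3 g4 h3 i2 i3) :
    Exceptional4 f5 g3 g4 h3 i2 i3 ↔
      (detAB (F4 f5 g3 g4 h3 i2 i3) ![0, 2, 5, 6] = 0 ∧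
        detCD (F4 f5 g3 g4 h3 i2 i3) ![1, 4, 3, 7] = 0) ∨
      (detAB (F4 f5 g3 g4 h3 i2 i3) ![0, 3, 4, 6] = 0 ∧
        detCD (F4 f5 g3 g4 h3 i2 i3) ![1, 5, 2, 7] = 0) ∨
      (detAB (F4 f5 g3 g4 h3 i2 i3) ![1, 2, 5, 7] = 0 ∧
        detCD (F4 f5 g3 g4 h3 i2 i3) ![0, 4, 3, 6] = 0) ∨
      (detAB (F4 f5 g3 g4 h3 i2 i3) ![1, 3, 4, 7] = 0 ∧
        detCD (F4 f5 g3 g4 h3 i2 i3) ![0, 5, 2, 6] = 0) := by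
  obtain ⟨hf, hg3, hg4, hh, hi2, hi3, -⟩ := h
  obtain ⟨a1, a2, a3, a4⟩ := detAB_F4 hf.1 g3 g4 h3 i2 i3
  obtain ⟨b1, b2, b3, b4⟩ := detCD_F4 hh.1 f5 g3 g4 i2 i3
  rw [a1, a2, a3, a4, b1, b2, b3, b4]
  simp only [neg_eq_zero, star_eq_zero]
  obtain ⟨f0, f1⟩ := coord_ne_zero_of_isGenericState hf
  obtain ⟨g30, g31⟩ := coord_ne_zero_of_isGenericState hg3
  obtain ⟨g40, g41⟩ := coord_ne_zero_of_isGenericState hg4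
  obtain ⟨h0, h1⟩ := coord_ne_zero_of_isGenericState hh
  obtain ⟨i20, i21⟩ := coord_ne_zero_of_isGenericState hi2
  obtain ⟨i30, i31⟩ := coord_ne_zero_of_isGenericState hi3
  have nf := isState_iff.1 hf.1
  have nh := isState_iff.1 hh.1
  have hs : ((1 + (‖affineCoord f5‖ ^ 2)⁻¹ : ℝ) : ℂ) = (f5 1 * star (f5 1))⁻¹ := by
    rw [Complex.ofReal_add, Complex.ofReal_inv, ofReal_norm_sq, affineCoord, star_div₀]
    have := star_ne_zero.2 f0
    have := star_ne_zero.2 f1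
    push_cast
    field_simp
    linear_combination nf
  have hr : ((‖affineCoord h3‖ ^ 2 : ℝ) : ℂ) = h3 1 * star (h3 1) / (1 - h3 1 * star (h3 1)) := by
    rw [ofReal_norm_sq, affineCoord, star_div₀, div_mul_div_comm]
    congr 1
    linear_combination nh
  have hH : 1 - h3 1 * star (h3 1) ≠ 0 := by
    rw [← nh, add_sub_cancel_right]
    exact mul_ne_zero h0 (star_ne_zero.2 h0)
  have hF : f5 1 * star (f5 1) ≠ 0 := mul_ne_zero f1 (star_ne_zero.2 f1)
  have sg40 := star_ne_zero.2 g40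
  have sg41 := star_ne_zero.2 g41
  have si30 := star_ne_zero.2 i30
  have si31 := star_ne_zero.2 i31
  rw [Exceptional4]
  simp only [hs, hr]
  generalize f5 1 * star (f5 1) = F at *
  generalize h3 1 * star (h3 1) = H at *
  simp only [affineCoord, star_div₀]
  generalize star (g4 0) = c40 at *
  generalize star (g4 1) = c41 at *
  generalize star (i3 0) = c30 at *
  generalize star (i3 1) = c31 at *
  rw [conj_ratio_eq_iff g30 sg40 hF, conj_ratio_eq_iff' g30 sg40,
    ratio_eq_iff i20 i30 si31 hH, ratio_eq_iff' i20 i30 si31 hH]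
  tauto

/-! ### Matrices described by templates -/

/-- The rays of the entries of a matrix, arranged by columns. -/
def rays (M : QubitMatrix) : Fin 4 → Fin 8 → Submodule ℂ Qubit := fun c r => ray (M r c)

/-- The row whose entry represents the entry of row `r` in column `c`. -/
def Template.source (t : Template) (c : Fin 4) (r : Fin 8) : Fin 8 := Fin.ofNat 8 (t.label c r / 2)

/-- Labels refer to representing rows, and a representing row represents itself. -/
theorem template_label (i : Fin 7) : ∀ (c : Fin 4) (r : Fin 8),
    (template i).label c r = 2 * ((template i).source c r : ℕ) +
      (oddLabel ((template i).label c r)).toNat ∧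
    (template i).label c ((template i).source c r) = 2 * ((template i).source c r : ℕ) := by
  revert i; decide +kernel

/-- The inequalities of a template concern representing rows. -/
theorem template_neqs (i : Fin 7) : ∀ e ∈ (template i).neqs,
    (template i).label (Fin.ofNat 4 e.1 : Fin 4) (Fin.ofNat 8 e.2.1 : Fin 8) =
      2 * (Fin.ofNat 8 e.2.1 : Fin 8) ∧
    (template i).label (Fin.ofNat 4 e.1 : Fin 4) (Fin.ofNat 8 e.2.2.1 : Fin 8) =
      2 * (Fin.ofNat 8 e.2.2.1 : Fin 8) := by
  revert i; decide +kernel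

/-- The parameters `w` satisfy the inequalities of the template. -/
def Template.Admits (t : Template) (w : Fin 4 → Fin 8 → Qubit) : Prop :=
  ∀ e ∈ t.neqs, ray (w (Fin.ofNat 4 e.1) (Fin.ofNat 8 e.2.1)) ≠
    twist orth e.2.2.2 (ray (w (Fin.ofNat 4 e.1) (Fin.ofNat 8 e.2.2.1)))

/-- The matrix described by a template, with parameters `w c b` for the representing rows `b` of
the columns `c`. -/
def Template.matrix (t : Template) (w : Fin 4 → Fin 8 → Qubit) : QubitMatrix := fun r c =>
  if oddLabel (t.label c r) then perp (w c (t.source c r)) else w c (t.source c r)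

theorem isState_matrix {t : Template} {w : Fin 4 → Fin 8 → Qubit} (hw : ∀ c b, IsState (w c b))
    (r : Fin 8) (c : Fin 4) : IsState (t.matrix w r c) := by
  rw [Template.matrix]
  split_ifs
  exacts [isState_perp (hw _ _), hw _ _]

theorem ray_matrix {t : Template} {w : Fin 4 → Fin 8 → Qubit} (hw : ∀ c b, IsState (w c b))
    (r : Fin 8) (c : Fin 4) :
    ray (t.matrix w r c) = twist orth (oddLabel (t.label c r)) (ray (w c (t.source c r))) := by
  rw [Template.matrix, twist]
  split_ifs
  exacts [ray_perp (hw _ _), rfl]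

theorem matrix_of_label {t : Template} {w : Fin 4 → Fin 8 → Qubit} {c : Fin 4} {b : Fin 8}
    (h : t.label c b = 2 * (b : ℕ)) : t.matrix w b c = w c b := by
  have h1 := oddLabel_two_mul b false
  simp only [Bool.toNat_false, Nat.add_zero] at h1
  rw [Template.matrix, h, h1, Template.source, h]
  simp

theorem fits_matrix {i : Fin 7} {w : Fin 4 → Fin 8 → Qubit} (hw : ∀ c b, IsState (w c b))
    (h : (template i).Admits w) : (template i).Fits orth (rays ((template i).matrix w)) := by
  constructor
  · intro c r b s hl
    obtain ⟨h1, h2⟩ := template_label i c r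
    have hb : (template i).source c r = b ∧ oddLabel ((template i).label c r) = s := by
      rw [hl, oddLabel_two_mul] at h1 ⊢
      exact ⟨Fin.ext (by omega), rfl⟩
    rw [rays, rays, ray_matrix hw, hb.2]
    rw [hb.1] at h2 ⊢
    rw [matrix_of_label h2]
  · intro c r b s he
    have h1 := template_neqs i _ he
    have h2 := h _ he
    simp only [Fin.ofNat_val_eq_self] at h1 h2
    rw [rays, rays, matrix_of_label h1.1, matrix_of_label h1.2]
    exact h2

theorem admits_of_fits {i : Fin 7} {x : Fin 4 → Fin 8 → Submodule ℂ Qubit}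
    (hx : (template i).Fits orth x) {w : Fin 4 → Fin 8 → Qubit}
    (hw : ∀ c b, ray (w c b) = x c b) : (template i).Admits w := by
  intro e he
  obtain ⟨h1, h2, h3⟩ := (template_wellFormed i).2.2 e he
  rw [hw, hw]
  refine hx.neq _ _ _ _ ?_
  rw [Fin.val_ofNat, Fin.val_ofNat, Fin.val_ofNat, Nat.mod_eq_of_lt h1, Nat.mod_eq_of_lt h2,
    Nat.mod_eq_of_lt h3]
  exact he

theorem ray_matrix_of_fits {i : Fin 7} {x : Fin 4 → Fin 8 → Submodule ℂ Qubit}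
    (hx : (template i).Fits orth x) {w : Fin 4 → Fin 8 → Qubit} (hs : ∀ c b, IsState (w c b))
    (hw : ∀ c b, ray (w c b) = x c b) (r : Fin 8) (c : Fin 4) :
    ray ((template i).matrix w r c) = x c r := by
  rw [ray_matrix hs, hx.entry c r _ _ (template_label i c r).1, hw]

/-! ### The matrices and conditions of the six families -/

/-- The conditions on a state in the form used by the templates, where row `0` represents
`|0⟩`. -/
theorem isGenericState_iff {v : Qubit} : IsGenericState v ↔
    IsState v ∧ ray ketZero ≠ ray v ∧ ray ketZero ≠ orth (ray v) := by
  rw [IsGenericState]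
  refine and_congr_right fun hv => ?_
  rw [differentStates_iff hv isState_ketZero, differentStates_iff hv isState_ketOne, ray_ketOne,
    ne_comm, Ne, Ne, Ne]
  refine and_congr Iff.rfl (not_congr ⟨orth_symm orth_involutive, orth_symm orth_involutive⟩)

theorem differentStates_ketZero_iff {v : Qubit} (hv : IsState v) :
    v ≁ ketZero ↔ ray ketZero ≠ ray v := by
  rw [differentStates_iff hv isState_ketZero, ne_comm]

theorem differentStates_ketOne_iff {v : Qubit} (hv : IsState v) :
    v ≁ ketOne ↔ ray ketZero ≠ orth (ray v) := by
  rw [differentStates_iff hv isState_ketOne, ray_ketOne, Ne, Ne]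
  exact not_congr ⟨orth_symm orth_involutive, orth_symm orth_involutive⟩

theorem oddLabel_eq (l : ℕ) : oddLabel l = decide (l % 2 = 1) := by
  have : Nat.land l 1 = l % 2 := Nat.and_one_is_mod l
  rw [oddLabel, this]
  rcases Nat.mod_two_eq_zero_or_one l with h | h <;> rw [h] <;> rfl

open scoped Fin.NatCast in
/-- `simp` turns `Fin.ofNat n 1` into a cast, which this lemma evaluates. -/
theorem cast_one_eq (n : ℕ) [NeZero n] : ((1 : ℕ) : Fin n) = 1 := rfl

section
-- the same simp set serves all templates
set_option linter.unusedSimpArgs false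
variable {w : Fin 4 → Fin 8 → Qubit}

theorem matrix_template_zero (h0 : ∀ c, w c 0 = ketZero) :
    (template 0).matrix w = F1 (w 0 4) (w 1 2) (w 2 2) (w 3 2) (w 3 3) := by
  funext r c
  fin_cases r <;> fin_cases c <;>
    simp [Template.matrix, Template.source, Template.label, template, templates, nth_eq,
      oddLabel_eq, F1, h0, perp_ketZero, cast_one_eq]

theorem matrix_template_one (h0 : ∀ c, w c 0 = ketZero) :
    (template 1).matrix w = F2 (w 0 4) (w 1 2) (w 2 2) (w 3 1) (w 3 2) (w 3 3) := by
  funext r c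
  fin_cases r <;> fin_cases c <;>
    simp [Template.matrix, Template.source, Template.label, template, templates, nth_eq,
      oddLabel_eq, F2, h0, perp_ketZero, cast_one_eq]

theorem matrix_template_two (h0 : ∀ c, w c 0 = ketZero) :
    (template 2).matrix w = F3 (w 0 4) (w 1 2) (w 2 2) (w 2 3) (w 3 1) := by
  funext r c
  fin_cases r <;> fin_cases c <;>
    simp [Template.matrix, Template.source, Template.label, template, templates, nth_eq,
      oddLabel_eq, F3, h0, perp_ketZero, cast_one_eq]

theorem matrix_template_three (h0 : ∀ c, w c 0 = ketZero) :
    (template 3).matrix w = F4 (w 0 4) (w 1 2) (w 1 3) (w 2 2) (w 3 1) (w 3 2) := by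
  funext r c
  fin_cases r <;> fin_cases c <;>
    simp [Template.matrix, Template.source, Template.label, template, templates, nth_eq,
      oddLabel_eq, F4, h0, perp_ketZero, cast_one_eq]

theorem matrix_template_four (h0 : ∀ c, w c 0 = ketZero) :
    (template 4).matrix w = F5 (w 0 4) (w 0 5) (w 1 2) (w 2 2) (w 3 1) := by
  funext r c
  fin_cases r <;> fin_cases c <;>
    simp [Template.matrix, Template.source, Template.label, template, templates, nth_eq,
      oddLabel_eq, F5, h0, perp_ketZero, cast_one_eq]

theorem matrix_template_five (h0 : ∀ c, w c 0 = ketZero) :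
    (template 5).matrix w = F6 (w 0 4) (w 1 2) (w 2 1) (w 3 1) (w 3 2) (w 3 3) := by
  funext r c
  fin_cases r <;> fin_cases c <;>
    simp [Template.matrix, Template.source, Template.label, template, templates, nth_eq,
      oddLabel_eq, F6, h0, perp_ketZero, cast_one_eq]

theorem matrix_template_six (h0 : ∀ c, w c 0 = ketZero) :
    (template 6).matrix w = F6 (w 0 4) (w 1 2) (w 2 1) (w 3 1) (w 3 1) (w 3 3) := by
  funext r c
  fin_cases r <;> fin_cases c <;>
    simp [Template.matrix, Template.source, Template.label, template, templates, nth_eq,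
      oddLabel_eq, F6, h0, perp_ketZero, cast_one_eq]

theorem admits_template_zero (h0 : ∀ c, w c 0 = ketZero) (hs : ∀ c b, IsState (w c b)) :
    (template 0).Admits w ↔ Cond1 (w 0 4) (w 1 2) (w 2 2) (w 3 2) (w 3 3) := by
  have hp := fun c b => isState_perp (hs c b)
  simp [Template.Admits, template, templates, nth_eq, twist, h0, Cond1, isGenericState_iff, hs,
    differentStates_ketZero_iff, differentStates_ketOne_iff, differentStates_iff, hp, ray_perp,
    cast_one_eq]
  tauto

theorem admits_template_one (h0 : ∀ c, w c 0 = ketZero) (hs : ∀ c b, IsState (w c b)) :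
    (template 1).Admits w ↔ Cond2 (w 0 4) (w 1 2) (w 2 2) (w 3 1) (w 3 2) (w 3 3) := by
  have hp := fun c b => isState_perp (hs c b)
  simp [Template.Admits, template, templates, nth_eq, twist, h0, Cond2, isGenericState_iff, hs,
    differentStates_ketZero_iff, differentStates_ketOne_iff, differentStates_iff, hp, ray_perp,
    cast_one_eq]
  tauto

theorem admits_template_two (h0 : ∀ c, w c 0 = ketZero) (hs : ∀ c b, IsState (w c b)) :
    (template 2).Admits w ↔ Cond3 (w 0 4) (w 1 2) (w 2 2) (w 2 3) (w 3 1) := by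
  have hp := fun c b => isState_perp (hs c b)
  simp [Template.Admits, template, templates, nth_eq, twist, h0, Cond3, isGenericState_iff, hs,
    differentStates_ketZero_iff, differentStates_ketOne_iff, differentStates_iff, hp, ray_perp,
    cast_one_eq]
  tauto

theorem admits_template_three (h0 : ∀ c, w c 0 = ketZero) (hs : ∀ c b, IsState (w c b)) :
    (template 3).Admits w ↔ Ineq4 (w 0 4) (w 1 2) (w 1 3) (w 2 2) (w 3 1) (w 3 2) := by
  have hp := fun c b => isState_perp (hs c b)
  simp [Template.Admits, template, templates, nth_eq, twist, h0, Ineq4, isGenericState_iff, hs,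
    differentStates_ketZero_iff, differentStates_ketOne_iff, differentStates_iff, hp, ray_perp,
    cast_one_eq]
  tauto

theorem admits_template_four (h0 : ∀ c, w c 0 = ketZero) (hs : ∀ c b, IsState (w c b)) :
    (template 4).Admits w ↔ Cond5 (w 0 4) (w 0 5) (w 1 2) (w 2 2) (w 3 1) := by
  have hp := fun c b => isState_perp (hs c b)
  simp [Template.Admits, template, templates, nth_eq, twist, h0, Cond5, isGenericState_iff, hs,
    differentStates_ketZero_iff, differentStates_ketOne_iff, differentStates_iff, hp, ray_perp,
    cast_one_eq]
  tauto

theorem admits_template_five (h0 : ∀ c, w c 0 = ketZero) (hs : ∀ c b, IsState (w c b)) :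
    (template 5).Admits w ↔ Cond6 (w 0 4) (w 1 2) (w 2 1) (w 3 1) (w 3 2) (w 3 3) ∧
      w 3 1 ≁ w 3 2 := by
  have hp := fun c b => isState_perp (hs c b)
  simp [Template.Admits, template, templates, nth_eq, twist, h0, Cond6, isGenericState_iff, hs,
    differentStates_ketZero_iff, differentStates_ketOne_iff, differentStates_iff, hp, ray_perp,
    cast_one_eq]
  tauto

theorem admits_template_six (h0 : ∀ c, w c 0 = ketZero) (hs : ∀ c b, IsState (w c b)) :
    (template 6).Admits w ↔ Cond6 (w 0 4) (w 1 2) (w 2 1) (w 3 1) (w 3 1) (w 3 3) := by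
  have ho : ¬ ray (w 3 1) = orth (ray (w 3 1)) := (orth_ne _).symm
  have hp := fun c b => isState_perp (hs c b)
  simp [Template.Admits, template, templates, nth_eq, twist, h0, Cond6, isGenericState_iff, hs,
    differentStates_ketZero_iff, differentStates_ketOne_iff, differentStates_iff, hp, ray_perp,
    cast_one_eq]
  tauto

end

theorem matrix_mem_family {i : Fin 7} {w : Fin 4 → Fin 8 → Qubit} (h0 : ∀ c, w c 0 = ketZero)
    (hs : ∀ c b, IsState (w c b)) (h : (template i).Admits w)
    (h4 : i = 3 → ¬ Exceptional4 (w 0 4) (w 1 2) (w 1 3) (w 2 2) (w 3 1) (w 3 2)) :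
    (template i).matrix w ∈ family (familyIndex i) := by
  fin_cases i
  · exact ⟨_, _, _, _, _, (admits_template_zero h0 hs).1 h, matrix_template_zero h0⟩
  · exact ⟨_, _, _, _, _, _, (admits_template_one h0 hs).1 h, matrix_template_one h0⟩
  · exact ⟨_, _, _, _, _, (admits_template_two h0 hs).1 h, matrix_template_two h0⟩
  · exact ⟨_, _, _, _, _, _, ⟨(admits_template_three h0 hs).1 h, h4 rfl⟩,
      matrix_template_three h0⟩
  · exact ⟨_, _, _, _, _, (admits_template_four h0 hs).1 h, matrix_template_four h0⟩
  · exact ⟨_, _, _, _, _, _, ((admits_template_five h0 hs).1 h).1, matrix_template_five h0⟩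
  · exact ⟨_, _, _, _, _, _, (admits_template_six h0 hs).1 h, matrix_template_six h0⟩

/-- The parameters `w` describe a matrix with the rays of `M` that fits the template and is not
exceptional. -/
structure Describes (i : Fin 7) (w : Fin 4 → Fin 8 → Qubit) (M : QubitMatrix) : Prop where
  zero : ∀ c, w c 0 = ketZero
  state : ∀ c b, IsState (w c b)
  admits : (template i).Admits w
  regular : i = 3 → ¬ Exceptional4 (w 0 4) (w 1 2) (w 1 3) (w 2 2) (w 3 1) (w 3 2)
  isState : ∀ r c, IsState (M r c)
  ray_eq : ∀ r c, ray (M r c) = ray ((template i).matrix w r c)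

theorem Describes.of_eq {i : Fin 7} {w : Fin 4 → Fin 8 → Qubit} {M : QubitMatrix}
    (zero : ∀ c, w c 0 = ketZero) (state : ∀ c b, IsState (w c b)) (admits : (template i).Admits w)
    (regular : i = 3 → ¬ Exceptional4 (w 0 4) (w 1 2) (w 1 3) (w 2 2) (w 3 1) (w 3 2))
    (h : (template i).matrix w = M) : Describes i w M where
  zero := zero
  state := state
  admits := admits
  regular := regular
  isState := by rw [← h]; exact isState_matrix state
  ray_eq := by rw [← h]; exact fun _ _ => rfl

/-! ### Members of the families in terms of templates -/

/-- Parameters of a template, named as in the families of matrices. -/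
def parameters (f5 f6 g3 g4 h2 h3 h4 i2 i3 i4 : Qubit) : Fin 4 → Fin 8 → Qubit :=
  ![![ketZero, ketZero, ketZero, ketZero, f5, f6, ketZero, ketZero],
    ![ketZero, ketZero, g3, g4, ketZero, ketZero, ketZero, ketZero],
    ![ketZero, h2, h3, h4, ketZero, ketZero, ketZero, ketZero],
    ![ketZero, i2, i3, i4, ketZero, ketZero, ketZero, ketZero]]

section
variable {f5 f6 g3 g4 h2 h3 h4 i2 i3 i4 : Qubit}

theorem parameters_zero (c : Fin 4) : parameters f5 f6 g3 g4 h2 h3 h4 i2 i3 i4 c 0 = ketZero := by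
  fin_cases c <;> rfl

theorem isState_parameters (a : IsState f5) (b : IsState f6) (c : IsState g3) (d : IsState g4)
    (e : IsState h2) (f : IsState h3) (g : IsState h4) (h : IsState i2) (i : IsState i3)
    (j : IsState i4) (k : Fin 4) (r : Fin 8) :
    IsState (parameters f5 f6 g3 g4 h2 h3 h4 i2 i3 i4 k r) := by
  have hk := isState_ketZero
  fin_cases k <;> fin_cases r <;> assumption
end

theorem exists_describes_F1 {f5 g3 h3 i3 i4 : Qubit} (hc : Cond1 f5 g3 h3 i3 i4) :
    ∃ i w, familyIndex i = 0 ∧ Describes i w (F1 f5 g3 h3 i3 i4) := by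
  have hk := isState_ketZero
  obtain ⟨a, b, c, d, e, -⟩ := id hc
  have hs := isState_parameters a.1 hk b.1 hk hk c.1 hk hk d.1 e.1
  exact ⟨0, _, rfl, .of_eq parameters_zero hs
    ((admits_template_zero parameters_zero hs).2 hc)
    (fun h => absurd h (by decide))
    (matrix_template_zero parameters_zero)⟩

theorem exists_describes_F2 {f5 g3 h3 i2 i3 i4 : Qubit} (hc : Cond2 f5 g3 h3 i2 i3 i4) :
    ∃ i w, familyIndex i = 1 ∧ Describes i w (F2 f5 g3 h3 i2 i3 i4) := by
  have hk := isState_ketZero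
  obtain ⟨a, b, c, d, e, f, -⟩ := id hc
  have hs := isState_parameters a.1 hk b.1 hk hk c.1 hk d.1 e f
  exact ⟨1, _, rfl, .of_eq parameters_zero hs
    ((admits_template_one parameters_zero hs).2 hc)
    (fun h => absurd h (by decide))
    (matrix_template_one parameters_zero)⟩

theorem exists_describes_F3 {f5 g3 h3 h4 i2 : Qubit} (hc : Cond3 f5 g3 h3 h4 i2) :
    ∃ i w, familyIndex i = 2 ∧ Describes i w (F3 f5 g3 h3 h4 i2) := by
  have hk := isState_ketZero
  obtain ⟨a, b, c, d, e, -⟩ := id hc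
  have hs := isState_parameters a.1 hk b.1 hk hk c.1 d.1 e.1 hk hk
  exact ⟨2, _, rfl, .of_eq parameters_zero hs
    ((admits_template_two parameters_zero hs).2 hc)
    (fun h => absurd h (by decide))
    (matrix_template_two parameters_zero)⟩

theorem exists_describes_F4 {f5 g3 g4 h3 i2 i3 : Qubit} (hc : Cond4 f5 g3 g4 h3 i2 i3) :
    ∃ i w, familyIndex i = 3 ∧ Describes i w (F4 f5 g3 g4 h3 i2 i3) := by
  have hk := isState_ketZero
  obtain ⟨a, b, c, d, e, f, -⟩ := id hc.1
  have hs := isState_parameters a.1 hk b.1 c.1 hk d.1 hk e.1 f.1 hk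
  exact ⟨3, _, rfl, .of_eq parameters_zero hs
    ((admits_template_three parameters_zero hs).2 hc.1)
    (fun _ => hc.2)
    (matrix_template_three parameters_zero)⟩

theorem exists_describes_F5 {f5 f6 g3 h3 i2 : Qubit} (hc : Cond5 f5 f6 g3 h3 i2) :
    ∃ i w, familyIndex i = 4 ∧ Describes i w (F5 f5 f6 g3 h3 i2) := by
  have hk := isState_ketZero
  obtain ⟨a, b, c, d, e, -⟩ := id hc
  have hs := isState_parameters a.1 b.1 c.1 hk hk d.1 hk e.1 hk hk
  exact ⟨4, _, rfl, .of_eq parameters_zero hs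
    ((admits_template_four parameters_zero hs).2 hc)
    (fun h => absurd h (by decide))
    (matrix_template_four parameters_zero)⟩

/-- If `i3` is `i2` up to a phase, it may be replaced by `i2` without changing the rays. -/
theorem ray_F6_congr {f5 g3 h2 i2 i3 i4 : Qubit} (h2s : IsState i2) (h3s : IsState i3)
    (h : ray i3 = ray i2) (r : Fin 8) (c : Fin 4) :
    ray (F6 f5 g3 h2 i2 i3 i4 r c) = ray (F6 f5 g3 h2 i2 i2 i4 r c) := by
  have hp : ray (perp i3) = ray (perp i2) := by rw [ray_perp h3s, ray_perp h2s, h]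
  fin_cases r <;> fin_cases c <;> simp [F6, h, hp]

theorem exists_describes_F6 {f5 g3 h2 i2 i3 i4 : Qubit} (hc : Cond6 f5 g3 h2 i2 i3 i4) :
    ∃ i w, familyIndex i = 5 ∧ Describes i w (F6 f5 g3 h2 i2 i3 i4) := by
  have hk := isState_ketZero
  obtain ⟨a, b, c, d, e, f, c1, c2, c3, c4, c5, c6, c7, c8⟩ := id hc
  by_cases h23 : i2 ≁ i3
  · have hs := isState_parameters a.1 hk b.1 hk c.1 hk hk d e f
    exact ⟨5, _, rfl, .of_eq parameters_zero hs
      ((admits_template_five parameters_zero hs).2 ⟨hc, h23⟩)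
      (fun h => absurd h (by decide)) (matrix_template_five parameters_zero)⟩
  · -- `i3` is `i2` up to a phase, so that both are represented by `i2`
    have hs := isState_parameters a.1 hk b.1 hk c.1 hk hk d d f
    have hray : ray i3 = ray i2 := by
      rw [differentStates_iff d e, not_not] at h23
      exact h23.symm
    have hrefl : ¬ i2 ≁ i2 := by rw [differentStates_iff d d]; simp
    have hperp : i2 ≁ perp i2 := by
      rw [differentStates_perp_iff d d]
      exact (orth_ne _).symm
    have hd := Describes.of_eq (i := 6) (M := F6 f5 g3 h2 i2 i2 i4) parameters_zero hs
      ((admits_template_six parameters_zero hs).2 ⟨a, b, c, d, d, f, c1, hperp, c3, c1, c3, c6,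
        Or.inr (c7.resolve_left h23), Or.inr hrefl⟩) (fun h => absurd h (by decide))
      (matrix_template_six parameters_zero)
    refine ⟨6, _, rfl, hd.zero, hd.state, hd.admits, hd.regular, ?_, ?_⟩
    · intro r c
      fin_cases r <;> fin_cases c <;>
        simp [F6, hk, isState_ketOne, a.1, b.1, c.1, d, e, f, isState_perp]
    · intro r c
      rw [← hd.ray_eq]
      exact ray_F6_congr d e hray r c

theorem exists_describes {j : Fin 6} {M : QubitMatrix} (hM : M ∈ family j) :
    ∃ i w, familyIndex i = j ∧ Describes i w M := by
  fin_cases j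
  · obtain ⟨_, _, _, _, _, h, rfl⟩ := hM
    exact exists_describes_F1 h
  · obtain ⟨_, _, _, _, _, _, h, rfl⟩ := hM
    exact exists_describes_F2 h
  · obtain ⟨_, _, _, _, _, h, rfl⟩ := hM
    exact exists_describes_F3 h
  · obtain ⟨_, _, _, _, _, _, h, rfl⟩ := hM
    exact exists_describes_F4 h
  · obtain ⟨_, _, _, _, _, h, rfl⟩ := hM
    exact exists_describes_F5 h
  · obtain ⟨_, _, _, _, _, _, h, rfl⟩ := hM
    exact exists_describes_F6 h

theorem Describes.fits {i : Fin 7} {w : Fin 4 → Fin 8 → Qubit} {M : QubitMatrix}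
    (h : Describes i w M) : (template i).Fits orth (rays M) := by
  have : rays M = rays ((template i).matrix w) := by
    funext c r; exact h.ray_eq r c
  rw [this]
  exact fits_matrix h.state h.admits

/-! ### Members of the families are unextendible product bases -/

theorem Unextendible.comp {ψ : QubitMatrix} (h : Unextendible ψ) {σ : Equiv.Perm (Fin 4)}
    (hσ : RespectsCut σ) (τ : Equiv.Perm (Fin 8)) :
    Unextendible fun r c => ψ (τ r) (σ c) := by
  intro K h0 h1
  have h0 := Singular.comp (y := fun r => ψ r (σ 0)) (z := fun r => ψ r (σ 1)) τ h0
  have h1 := Singular.comp (y := fun r => ψ r (σ 2)) (z := fun r => ψ r (σ 3)) τ h1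
  have hsp := h fun r => K (τ.symm r)
  have hsp' := h fun r => ¬ K (τ.symm r)
  simp only [not_not] at hsp'
  rcases RespectsCut.values (σ := σ) hσ with ⟨h2 | h2, h3 | h3⟩ | ⟨h2 | h2, h3 | h3⟩ <;>
    simp only [h2.1, h2.2, h3.1, h3.2] at h0 h1
  exacts [hsp h0 h1, hsp h0 h1.symm, hsp h0.symm h1, hsp h0.symm h1.symm, hsp' h1 h0,
    hsp' h1.symm h0, hsp' h1 h0.symm, hsp' h1.symm h0.symm]

theorem not_unextendible_of_det {ψ : QubitMatrix} {s s' : Fin 4 → Fin 8} (h : detAB ψ s = 0)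
    (h' : detCD ψ s' = 0) (hs : ∀ r, (∃ i, s i = r) ∨ ∃ i, s' i = r) : ¬ Unextendible ψ :=
  fun hψ => hψ (fun r => ∃ i, s i = r) (singular_of_quadDet_eq_zero s h fun _ => id)
    (singular_of_quadDet_eq_zero s' h' fun r hr => (hs r).resolve_left hr)

/-- For exceptional parameters, some `p` and `q` are orthogonal to complementary quadruples of rows
of `F4`. This also holds after any operation on the matrix that preserves the vanishing of the
determinants. -/
theorem not_unextendible_of_exceptional {f5 g3 g4 h3 i2 i3 : Qubit} (h : Ineq4 f5 g3 g4 h3 i2 i3)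
    (he : Exceptional4 f5 g3 g4 h3 i2 i3) {ψ : QubitMatrix}
    (hA : ∀ s, detAB (F4 f5 g3 g4 h3 i2 i3) s = 0 → detAB ψ s = 0)
    (hC : ∀ s, detCD (F4 f5 g3 g4 h3 i2 i3) s = 0 → detCD ψ s = 0) : ¬ Unextendible ψ := by
  rcases (exceptional4_iff h).1 he with ⟨a, b⟩ | ⟨a, b⟩ | ⟨a, b⟩ | ⟨a, b⟩ <;>
    exact not_unextendible_of_det (hA _ a) (hC _ b) (by decide)

/-- The open sets of `F4` are those of the determinants in `exceptional4_iff`, which do not vanish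
together because the parameters are regular. -/
theorem Describes.isUPB44 {i : Fin 7} {w : Fin 4 → Fin 8 → Qubit} {M : QubitMatrix}
    (h : Describes i w M) : IsUPB44 (rowVectors M) := by
  rw [isUPB44_iff h.isState]
  have hfits := h.fits
  refine ⟨fun r s hrs => orthogonal_of_fits hfits r s hrs,
    unextendible_of_fits h.isState hfits ?_⟩
  rintro rfl m hm h1 h2
  refine h.regular rfl ?_
  have hi := (admits_template_three h.zero h.state).1 h.admits
  have hM : ∀ r c, ray (M r c) = ray (F4 (w 0 4) (w 1 2) (w 1 3) (w 2 2) (w 3 1) (w 3 2) r c) := by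
    rw [← matrix_template_three h.zero]
    exact h.ray_eq
  have key : ∀ s s' : Fin 4 → Fin 8, (∀ i, m.testBit (s i) = true) →
      (∀ i, ¬ m.testBit (s' i) = true) →
      detAB (F4 (w 0 4) (w 1 2) (w 1 3) (w 2 2) (w 3 1) (w 3 2)) s = 0 ∧
      detCD (F4 (w 0 4) (w 1 2) (w 1 3) (w 2 2) (w 3 1) (w 3 2)) s' = 0 := by
    intro s s' hs hs'
    exact ⟨(quadDet_congr (fun _ => hM _ _) fun _ => hM _ _).1
        (quadDet_eq_zero_of_singular h1 s hs),
      (quadDet_congr (fun _ => hM _ _) fun _ => hM _ _).1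
        (quadDet_eq_zero_of_singular h2 s' hs')⟩
  rw [exceptional4_iff hi]
  simp only [openSets, List.mem_cons, List.not_mem_nil, or_false] at hm
  rcases hm with rfl | rfl | rfl | rfl
  · exact Or.inl (key _ _ (by decide) (by decide))
  · exact Or.inr (Or.inl (key _ _ (by decide) (by decide)))
  · exact Or.inr (Or.inr (Or.inl (key _ _ (by decide) (by decide))))
  · exact Or.inr (Or.inr (Or.inr (key _ _ (by decide) (by decide))))

/-! ### Invariance under equivalence -/

theorem act_ne_zero (U : Matrix.unitaryGroup (Fin 2) ℂ) {v : Qubit} (h : v ≠ 0) :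
    act U v ≠ 0 := by
  rw [← norm_ne_zero_iff, norm_act]
  exact norm_ne_zero_iff.2 h

/-- Unitaries preserve equality and orthogonality of rays. -/
theorem ray_act_iff (U : Matrix.unitaryGroup (Fin 2) ℂ) {v w : Qubit} (hv : v ≠ 0) (hw : w ≠ 0)
    (s : Bool) : ray (act U v) = twist orth s (ray (act U w)) ↔ ray v = twist orth s (ray w) := by
  cases s
  · change ray _ = ray _ ↔ ray _ = ray _
    rw [ray_eq_ray_iff hv hw, ray_eq_ray_iff (act_ne_zero U hv) (act_ne_zero U hw), bracket_act,
      mul_eq_zero, or_iff_right (det_ne_zero U)]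
  · change ray _ = orth (ray _) ↔ ray _ = orth (ray _)
    rw [ray_eq_orth_iff hv hw, ray_eq_orth_iff (act_ne_zero U hv) (act_ne_zero U hw), inner_act]

theorem Template.Fits.act {t : Template} {M : QubitMatrix} (h : t.Fits orth (rays M))
    (hM : ∀ r c, M r c ≠ 0) (U : Fin 4 → Matrix.unitaryGroup (Fin 2) ℂ) :
    t.Fits orth (rays fun r c => UPB.act (U c) (M r c)) where
  entry c r b s hl := (ray_act_iff (U c) (hM _ _) (hM _ _) s).2 (h.entry c r b s hl)
  neq c r b s he := mt (ray_act_iff (U c) (hM _ _) (hM _ _) s).1 (h.neq c r b s he)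

/-- Equivalent members of two families have configurations related by permutations, since local
unitaries and phases do not change the relations between rays. -/
theorem eq_of_equivalent {j k : Fin 6} {M N : QubitMatrix} (hM : M ∈ family j)
    (hN : N ∈ family k) (h : Equivalent (rowVectors M) (rowVectors N)) : j = k := by
  obtain ⟨i, w, rfl, hMi⟩ := exists_describes hM
  obtain ⟨i', w', rfl, hNi⟩ := exists_describes hN
  obtain ⟨σ, U, τ, c, hσ, -, h⟩ := h
  refine familyIndex_eq_of_fits orth_involutive orth_ne hσ (τ := τ) ?_ hNi.fits
  have hM0 : ∀ r c, M r c ≠ 0 := fun r c => ne_zero_of_isState (hMi.isState r c)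
  have hN0 : ∀ r c, N r c ≠ 0 := fun r c => ne_zero_of_isState (hNi.isState r c)
  convert hMi.fits.act hM0 fun d => U (σ d) using 1
  funext d r
  have hr := h r
  rw [rowVectors, rowVectors, permuteSystems_tensorFour, localUnitary_tensorFour] at hr
  have := ray_eq_of_tensorFour_eq (hN0 _) hr (σ d) (act_ne_zero _ (hM0 _ _))
  simpa [rays] using this

/-! ### Completeness of the families -/

theorem exists_act_eq_ketZero {v : Qubit} (hv : IsState v) :
    ∃ U : Matrix.unitaryGroup (Fin 2) ℂ, act U v = ketZero := by
  rw [isState_iff] at hv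
  simp only [Complex.star_def] at hv
  refine ⟨⟨!![star (v 0), star (v 1); -v 1, v 0], ?_⟩, ?_⟩
  · rw [Matrix.mem_unitaryGroup_iff]
    ext i j
    fin_cases i <;> fin_cases j <;>
      simp [Matrix.mul_apply, Fin.sum_univ_two, Matrix.star_apply]
    · linear_combination hv
    · ring
    · ring
    · linear_combination hv
  · ext i
    fin_cases i
    · simp [act_zero, ketZero]; linear_combination hv
    · simp [act_one, ketZero]; ring

theorem quadDet_act (U V : Matrix (Fin 2) (Fin 2) ℂ) (a b : Fin 4 → Qubit) :
    quadDet (fun i => act U (a i)) (fun i => act V (b i)) =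
      U.det ^ 2 * V.det ^ 2 * quadDet a b := by
  simp only [quadDet, bracket_act]; ring

/-- The factors of the product vectors can be taken as unit vectors. -/
theorem exists_states {T : Fin 8 → FourQubit} (hT : IsUPB44 T) :
    ∃ ψ : QubitMatrix, (∀ r c, IsState (ψ r c)) ∧ T = rowVectors ψ := by
  obtain ⟨hT, hp, -⟩ := hT
  choose φ hφ using hp
  have hn : ∀ r, ∏ k, ‖φ r k‖ = 1 := fun r => by
    rw [← norm_tensorFour, ← hφ]; exact hT.1 r
  refine ⟨fun r c => ((‖φ r c‖⁻¹ : ℝ) : ℂ) • φ r c, fun r c => ?_, funext fun r => ?_⟩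
  · have : ‖φ r c‖ ≠ 0 := fun h0 => by
      have := hn r
      rw [Finset.prod_eq_zero (Finset.mem_univ c) h0] at this
      exact zero_ne_one this
    rw [IsState, norm_smul]
    simp [this]
  · rw [rowVectors, tensorFour_smul, ← hφ, ← Complex.ofReal_prod, Finset.prod_inv_distrib, hn]
    simp

/-- The rays of a UPB form a configuration, which fits a template after permutations. Local
unitaries make its first row `|0⟩|0⟩|0⟩|0⟩`, and the remaining entries of the representing rows are
the parameters; they are not exceptional because the UPB is unextendible. -/
theorem exists_equivalent {T : Fin 8 → FourQubit} (hT : IsUPB44 T) :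
    ∃ j, ∃ M ∈ family j, Equivalent T (rowVectors M) := by
  obtain ⟨ψ, hψ, rfl⟩ := exists_states hT
  obtain ⟨ho, hu⟩ := (isUPB44_iff hψ).1 hT
  have hconf : IsConfiguration orth (rays ψ) :=
    ⟨ho, fun K h0 h1 => hu K (Dependent.singular h0) (Dependent.singular h1)⟩
  obtain ⟨i, σ, τ, hσ, hfits⟩ := hconf.matches orth_involutive orth_ne
  have hy : ∀ r c, IsState (ψ (τ r) (σ c)) := fun r c => hψ _ _
  have hU := fun c => exists_act_eq_ketZero (hy 0 c)
  choose U hU using hU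
  -- the normal form: the first row of `z` consists of `|0⟩`
  let z : QubitMatrix := fun r c => act (U c) (ψ (τ r) (σ c))
  have hz : ∀ r c, IsState (z r c) := fun r c => (norm_act _ _).trans (hy r c)
  have hzfits : (template i).Fits orth (rays z) :=
    Template.Fits.act (M := fun r c => ψ (τ r) (σ c)) hfits
      (fun r c => ne_zero_of_isState (hy r c)) U
  let w : Fin 4 → Fin 8 → Qubit := fun c b => z b c
  have hw0 : ∀ c, w c 0 = ketZero := hU
  have hws : ∀ c b, IsState (w c b) := fun c b => hz b c
  have hadm : (template i).Admits w := admits_of_fits hzfits fun _ _ => rfl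
  have hray : ∀ r c, ray ((template i).matrix w r c) = ray (z r c) := fun r c =>
    ray_matrix_of_fits hzfits hws (fun _ _ => rfl) r c
  have hreg : i = 3 → ¬ Exceptional4 (w 0 4) (w 1 2) (w 1 3) (w 2 2) (w 3 1) (w 3 2) := by
    rintro rfl he
    have hne : ∀ c, (U c : Matrix (Fin 2) (Fin 2) ℂ).det ^ 2 ≠ 0 := fun c =>
      pow_ne_zero 2 (det_ne_zero _)
    have hF := matrix_template_three hw0
    have hray3 : ∀ r c, ray ((template 3).matrix w r c) = ray (z r c) := hray
    refine not_unextendible_of_exceptional ((admits_template_three hw0 hws).1 hadm) he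
      (ψ := fun r c => ψ (τ r) (σ c)) ?_ ?_ (hu.comp hσ τ)
    · intro s hs
      rw [← hF, detAB, quadDet_congr (fun _ => hray3 _ _) fun _ => hray3 _ _, quadDet_act,
        mul_eq_zero] at hs
      exact hs.resolve_left (mul_ne_zero (hne _) (hne _))
    · intro s hs
      rw [← hF, detCD, quadDet_congr (fun _ => hray3 _ _) fun _ => hray3 _ _, quadDet_act,
        mul_eq_zero] at hs
      exact hs.resolve_left (mul_ne_zero (hne _) (hne _))
  refine ⟨_, _, matrix_mem_family hw0 hws hadm hreg, ?_⟩
  have hphase := fun r c => (ray_eq_iff_phase (hz r c) (isState_matrix hws r c)).1 (hray r c).symm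
  choose d hd hM using hphase
  refine ⟨σ⁻¹, U, τ⁻¹, fun r => ∏ k, d (τ⁻¹ r) k, fun k l => ?_, fun r => ?_, fun r => ?_⟩
  · have := hσ (σ⁻¹ k) (σ⁻¹ l)
    simpa using this.symm
  · rw [norm_prod]
    exact Finset.prod_eq_one fun k _ => hd _ _
  · rw [rowVectors, rowVectors, permuteSystems_tensorFour, localUnitary_tensorFour,
      ← tensorFour_smul]
    congr 1
    funext k
    rw [hM]
    simp [z]
    rfl

/-! ### Examples of members -/

/-- The state with real amplitudes `a` and `b`. -/
def realState (a b : ℝ) : Qubit := !₂[(a : ℂ), (b : ℂ)]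

theorem isState_realState {a b : ℝ} (h : a ^ 2 + b ^ 2 = 1) : IsState (realState a b) := by
  rw [isState_iff]
  simp only [realState]
  simp
  exact_mod_cast (by linarith : a * a + b * b = 1)

theorem differentStates_realState {a b c d : ℝ} (h : a ^ 2 + b ^ 2 = 1) (h' : c ^ 2 + d ^ 2 = 1)
    (hne : a * d - b * c ≠ 0) : realState a b ≁ realState c d := by
  rw [differentStates_iff (isState_realState h) (isState_realState h'), Ne,
    ray_eq_ray_iff (ne_zero_of_isState (isState_realState h))
      (ne_zero_of_isState (isState_realState h'))]
  simp only [bracket, realState]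
  simp
  exact_mod_cast hne

theorem perp_realState (a b : ℝ) : perp (realState a b) = realState (-b) a := by
  ext i; fin_cases i <;> simp [perp, realState]

theorem ketZero_eq : ketZero = realState 1 0 := by
  ext i; fin_cases i <;> simp [ketZero, realState]

theorem ketOne_eq : ketOne = realState 0 1 := by
  ext i; fin_cases i <;> simp [ketOne, realState]

theorem isGenericState_realState {a b : ℝ} (h : a ^ 2 + b ^ 2 = 1) (ha : a ≠ 0) (hb : b ≠ 0) :
    IsGenericState (realState a b) := by
  refine ⟨isState_realState h, ?_, ?_⟩
  · rw [ketZero_eq]; exact differentStates_realState h (by norm_num) (by simpa using hb)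
  · rw [ketOne_eq]; exact differentStates_realState h (by norm_num) (by simpa using ha)

/-- Members with real amplitudes, from the Pythagorean triples `3, 4, 5` and `5, 12, 13`. -/
theorem family_nonempty (j : Fin 6) : (family j).Nonempty := by
  let p := realState (3 / 5) (4 / 5)
  let q := realState (5 / 13) (12 / 13)
  let u := realState (4 / 5) (3 / 5)
  have hp : IsGenericState p := isGenericState_realState (by norm_num) (by norm_num) (by norm_num)
  have hq : IsGenericState q := isGenericState_realState (by norm_num) (by norm_num) (by norm_num)
  have hu : IsGenericState u := isGenericState_realState (by norm_num) (by norm_num) (by norm_num)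
  have hpq : p ≁ q := differentStates_realState (by norm_num) (by norm_num) (by norm_num)
  have hpu : p ≁ u := differentStates_realState (by norm_num) (by norm_num) (by norm_num)
  have hqu : q ≁ u := differentStates_realState (by norm_num) (by norm_num) (by norm_num)
  have hpq' : p ≁ perp q := by
    rw [perp_realState]
    exact differentStates_realState (by norm_num) (by norm_num) (by norm_num)
  fin_cases j
  · exact ⟨_, p, p, p, p, q, ⟨hp, hp, hp, hp, hq, hpq⟩, rfl⟩
  · exact ⟨_, p, p, p, p, p, q, ⟨hp, hp, hp, hp, hp.1, hq.1, hpq, hpq'⟩, rfl⟩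
  · exact ⟨_, p, p, p, q, p, ⟨hp, hp, hp, hq, hp, hpq⟩, rfl⟩
  · refine ⟨_, p, p, q, p, p, q, ⟨⟨hp, hp, hq, hp, hp, hq, hpq, hpq', hpq, hpq'⟩, ?_⟩, rfl⟩
    -- the product of the two coordinates is positive, whereas `-s` and `-s⁻¹` are negative
    rintro ⟨h, -⟩
    have hs : 0 < 1 + (‖affineCoord p‖ ^ 2)⁻¹ := by positivity
    have e : affineCoord p * star (affineCoord q) = ((16 / 5 : ℝ) : ℂ) := by
      simp [affineCoord, p, q, realState]
      norm_num
    rw [e] at h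
    rcases h with h | h
    · have h : (16 / 5 : ℝ) = -(1 + (‖affineCoord p‖ ^ 2)⁻¹) := by exact_mod_cast h
      linarith
    · have h : (16 / 5 : ℝ) = -(1 + (‖affineCoord p‖ ^ 2)⁻¹)⁻¹ := by exact_mod_cast h
      have := inv_pos.2 hs
      linarith
  · exact ⟨_, p, q, p, p, p, ⟨hp, hq, hp, hp, hp, hpq⟩, rfl⟩
  · exact ⟨_, p, p, p, p, q, u, ⟨hp, hp, hp, hp.1, hq.1, hu.1, hp.2.1, hpq', hpu, hq.2.1, hqu,
      hu.2.2, Or.inl hpq, Or.inl hu.2.1⟩, rfl⟩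

end UPB

end

theorem mainTheorem1 :
    -- every member of every family is a UPB of size eight in `ℂ⁴ ⊗ ℂ⁴`
    (∀ j, (family j).Nonempty ∧ ∀ M ∈ family j, IsUPB44 (rowVectors M)) ∧
    -- the six families are pairwise inequivalent
    (∀ j k, j ≠ k → ∀ M ∈ family j, ∀ N ∈ family k,
      ¬ Equivalent (rowVectors M) (rowVectors N)) ∧
    -- the six families are complete
    (∀ T : Fin 8 → FourQubit, IsUPB44 T → ∃ j, ∃ M ∈ family j, Equivalent T (rowVectors M)) ∧
    -- the parameters of `F4` that were excluded as exceptional do not give a UPB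
    (∀ f5 g3 g4 h3 i2 i3 : Qubit, Ineq4 f5 g3 g4 h3 i2 i3 → Exceptional4 f5 g3 g4 h3 i2 i3 →
      ¬ IsUPB44 (rowVectors (F4 f5 g3 g4 h3 i2 i3))) := by
  refine ⟨fun j => ⟨UPB.family_nonempty j, fun M hM => ?_⟩, fun j k hjk M hM N hN h =>
    hjk (UPB.eq_of_equivalent hM hN h), fun T hT => UPB.exists_equivalent hT, ?_⟩
  · obtain ⟨i, w, -, h⟩ := UPB.exists_describes hM
    exact h.isUPB44
  · intro f5 g3 g4 h3 i2 i3 h he hU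
    have hs : ∀ r c, IsState (F4 f5 g3 g4 h3 i2 i3 r c) := by
      obtain ⟨a, b, c, d, e, f, -⟩ := h
      intro r k
      fin_cases r <;> fin_cases k <;>
        simp [F4, UPB.isState_ketZero, UPB.isState_ketOne, a.1, b.1, c.1, d.1, e.1, f.1,
          UPB.isState_perp]
    exact UPB.not_unextendible_of_exceptional h he (fun _ => id) (fun _ => id)
      ((UPB.isUPB44_iff hs).1 hU).2
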